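/- Let $Q$ be a real symmetric $2\times 2$ matrix, $A(z)=\tfrac12 z^{T}Qz$ the corresponding quadratic symbol on $T^*\mathbb R$, $z=(x,p)$, and let $\omega\in\mathbb C$ satisfy $\omega^2=\det Q$. Throughout, $\tfrac{2A}{i\hbar\omega}\tan u$ (with $u=\tfrac{i\hbar\omega D}{2}$ or $u=\tfrac{t\omega}{2}$) is replaced by its limit when $\omega=0$. Write $\star$ for the Moyal product $$C\star C'=\sum_{k\ge 0}\frac1{k!}\Big(\frac{i\hbar}2\Big)^k C_{,\mu_1\cdots\mu_k}J^{\mu_1\nu_1}\cdots J^{\mu_k\nu_k}C'_{,\nu_1\cdots\nu_k},\qquad J=\begin{pmatrix}0&1\\-1&0\end{pmatrix}.$$ For a function $f$ on $\mathbb R$ put $$\mathcal F_A(f)=\sec\frac{i\hbar\omega D}{2}\;\exp\Big[\frac{2A}{i\hbar\omega}\tan\frac{i\hbar\omega D}{2}-AD\Big]\,f(A),$$ a formal power series in $\hbar$: expand the operator in powers of $\hbar$, each coefficient being a polynomial in $D$ and $A$; then $D^k$ acts on $f$ as the $k$-th derivative (and not on the factors $A$), and the result is evaluated at $A(z)$.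 1. (Formal $\hbar$.) Let $\mathcal A$ be an algebra of smooth complex-valued functions on $\mathbb R$ containing the polynomials and, with each $f$, all the quotients $y\mapsto (f(y)-f(a))/(y-a)$, $a\in\mathbb R$ (for example all smooth functions, the real-analytic functions, or the polynomials). Let $f\mapsto f(\widehat A)$ be a functional calculus for $\widehat A$ on $\mathcal A$; that is, the map from $f$ to the symbol $B$ of $\widehat B=f(\widehat A)$ is a morphism of unital complex algebras from $\mathcal A$ to $(C^\infty(T^*\mathbb R)[[\hbar]],\star)$ sending the function $y$ to $A$. Then for every $f\in\mathcal A$ the symbol of $f(\widehat A)$ is $B=\mathcal F_A(f)$. 2. (Weyl operators, $\hbar>0$ a number.) An operator $T$ from the Schwartz space $\mathcal S(\mathbb R)$ to $L^2(\mathbb R)$ has Weyl symbol $B$ if, for all $\varphi,\psi\in\mathcal S(\mathbb R)$, $$\langle\psi,T\varphi\rangle=\iint B(x,p)\,W(\varphi,\psi)(x,p)\,dx\,dp,\qquad W(\varphi,\psi)(x,p)=\frac1{2\pi\hbar}\int e^{-isp/\hbar}\varphi(x+\tfrac s2)\overline{\psi(x-\tfrac s2)}\,ds,$$ the double integral being absolutely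 convergent. Let $\widehat A:\mathcal S(\mathbb R)\to\mathcal S(\mathbb R)$ be the linear operator with Weyl symbol $A$. (a) For every complex polynomial $f$, the Weyl symbol of $f(\widehat A)$ is $\mathcal F_A(f)$ (a series with finitely many non-zero terms, of order at most $\deg f$ in $\hbar$). (b) Let $U(t)=e^{-it\widehat A/\hbar}$, $t\in\mathbb R$, be a strongly continuous one-parameter unitary group on $L^2(\mathbb R)$ whose generator extends $-\tfrac{i}{\hbar}\widehat A$ from $\mathcal S(\mathbb R)$. Then for every real $t$ with $\cos\frac{t\omega}2\neq0$, the Weyl symbol of $e^{-it\widehat A/\hbar}$ is $$\sec\frac{t\omega}{2}\;\exp\Big[\frac{2A}{i\hbar\omega}\tan\frac{t\omega}{2}\Big].$$ -/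

import Mathlib

open scoped SchwartzMap PowerSeries Polynomial

noncomputable section

namespace QuadSymbol

/-- The phase space `T*ℝ`, with coordinates `z 0 = x` and `z 1 = p`. -/
abbrev PhaseSpace : Type := Fin 2 → ℝ

/-- The quadratic symbol `A(z) = ½ zᵀ Q z`. -/
def quadraticSymbol (Q : Matrix (Fin 2) (Fin 2) ℝ) (z : PhaseSpace) : ℝ :=
  (1 / 2) * (z ⬝ᵥ Q.mulVec z)

/-! ### Formal symbols and the Moyal product -/

/-- A formal symbol `∑ ħⁿ Cₙ`: a power series in the formal parameter `ħ = PowerSeries.X` whose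
coefficients are functions on the phase space.  See `IsSmoothSymbol` for smoothness. -/
abbrev FormalSymbol : Type := PowerSeries (PhaseSpace → ℂ)

/-- Membership in `C^∞(T*ℝ)[[ħ]]`: all coefficients are smooth. -/
def IsSmoothSymbol (C : FormalSymbol) : Prop :=
  ∀ n, ContDiff ℝ (⊤ : ℕ∞) (PowerSeries.coeff n C)

/-- The Poisson tensor `J = [[0, 1], [-1, 0]]`. -/
def poissonTensor : Matrix (Fin 2) (Fin 2) ℝ := !![0, 1; -1, 0]

/-- The `k`-th partial derivative `∂_{μ 0} ⋯ ∂_{μ (k-1)} C`. -/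
def partialDeriv {k : ℕ} (μ : Fin k → Fin 2) (C : PhaseSpace → ℂ) (z : PhaseSpace) : ℂ :=
  iteratedFDeriv ℝ k C z (fun i => Pi.single (μ i) 1)

/-- `{C, D}_k = C_{,μ¹…μᵏ} J^{μ¹ν¹} ⋯ J^{μᵏνᵏ} D_{,ν¹…νᵏ}`. -/
def bracket (k : ℕ) (C D : PhaseSpace → ℂ) (z : PhaseSpace) : ℂ :=
  ∑ μ : Fin k → Fin 2, ∑ ν : Fin k → Fin 2,
    ((∏ i, poissonTensor (μ i) (ν i) : ℝ) : ℂ) * partialDeriv μ C z * partialDeriv ν D z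

/-- The Moyal product `C ⋆ D = ∑ₖ (1/k!) (iħ/2)ᵏ {C, D}_k`, extended `ħ`-bilinearly to formal
symbols. -/
def moyal (C D : FormalSymbol) : FormalSymbol :=
  PowerSeries.mk fun n => ∑ k ∈ Finset.range (n + 1), ∑ ij ∈ Finset.HasAntidiagonal.antidiagonal (n - k),
    ((1 / (k.factorial : ℂ)) * (Complex.I / 2) ^ k) •
      bracket k (PowerSeries.coeff ij.1 C) (PowerSeries.coeff ij.2 D)

/-- `𝒜` is an algebra of smooth functions of one real variable (under pointwise operations) which
contains the coordinate function `y` and the quotients `(f(y) - f(a)) / (y - a)` of its members.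
Examples: polynomials, entire functions, real-analytic functions, all smooth functions. -/
structure IsSmoothFunctionAlgebra (𝒜 : Subalgebra ℂ (ℝ → ℂ)) : Prop where
  contDiff : ∀ f ∈ 𝒜, ContDiff ℝ (⊤ : ℕ∞) f
  coord_mem : (fun y : ℝ => (y : ℂ)) ∈ 𝒜
  exists_quotient : ∀ f ∈ 𝒜, ∀ a : ℝ, ∃ g ∈ 𝒜, ∀ y : ℝ, f y = f a + ((y : ℂ) - a) * g y

/-- A functional calculus for the operator with symbol `A`, transported to symbols.  Operators are
identified with their symbols, so that composition becomes the Moyal product.  It is a morphism of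
unital algebras `f ↦ (symbol of f(Â))` from `𝒜` to `(C^∞(T*ℝ)[[ħ]], ⋆)` which sends the coordinate
function `y` to `A`. -/
structure IsFunctionalCalculus (𝒜 : Subalgebra ℂ (ℝ → ℂ)) (A : PhaseSpace → ℝ)
    (Φ : 𝒜 →ₗ[ℂ] FormalSymbol) : Prop where
  smooth : ∀ f, IsSmoothSymbol (Φ f)
  map_one : Φ 1 = 1
  map_mul : ∀ f g, Φ (f * g) = moyal (Φ f) (Φ g)
  map_coord : ∀ f : 𝒜, (∀ y : ℝ, (f : ℝ → ℂ) y = (y : ℂ)) →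
    Φ f = PowerSeries.C (fun z => (A z : ℂ))

/-! ### The operator `sec(iħωD/2) exp[(2A/(iħω)) tan(iħωD/2) - AD]` -/

/-- The power series `sec u`. -/
def secSeries : ℂ⟦X⟧ := (PowerSeries.cos ℂ)⁻¹

/-- The power series `tan u`. -/
def tanSeries : ℂ⟦X⟧ := PowerSeries.sin ℂ * secSeries

/-- The power series `(tan u) / u`. -/
def tancSeries : ℂ⟦X⟧ := PowerSeries.mk fun n => PowerSeries.coeff (n + 1) tanSeries

theorem X_mul_tancSeries : PowerSeries.X * tancSeries = tanSeries := by
  ext n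
  cases n with
  | zero => simp [tanSeries, PowerSeries.sin]
  | succ n => simp [tancSeries, PowerSeries.coeff_succ_X_mul]

/-- `iħωD/2`, in the ring `ℂ[D][[ħ]]` where `D = Polynomial.X` and `ħ = PowerSeries.X`. -/
def argSeries (ω : ℂ) : ℂ[X]⟦X⟧ :=
  PowerSeries.C (Polynomial.C (Complex.I * ω / 2) * Polynomial.X) * PowerSeries.X

theorem hasSubst_argSeries (ω : ℂ) : PowerSeries.HasSubst (argSeries ω) :=
  PowerSeries.HasSubst.of_constantCoeff_zero' (by simp [argSeries])

/-- The term `(2a/(iħω)) tan(iħωD/2) = aD · (tan u)/u`, `u = iħωD/2`, of `ℂ[D][[ħ]]`, at the value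
`a` of the symbol `A`.  The second form makes sense for `ω = 0` too; for the first one see
`mul_tanTerm`. -/
def tanTerm (ω a : ℂ) : ℂ[X]⟦X⟧ :=
  PowerSeries.C (Polynomial.C a * Polynomial.X) * PowerSeries.subst (argSeries ω) tancSeries

theorem mul_tanTerm (ω a : ℂ) :
    PowerSeries.C (Polynomial.C (Complex.I * ω)) * PowerSeries.X * tanTerm ω a =
      PowerSeries.C (Polynomial.C (2 * a)) * PowerSeries.subst (argSeries ω) tanSeries := by
  rw [← X_mul_tancSeries, PowerSeries.subst_mul (hasSubst_argSeries ω),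
    PowerSeries.subst_X (hasSubst_argSeries ω), tanTerm]
  have h : (PowerSeries.C (Polynomial.C (Complex.I * ω)) : ℂ[X]⟦X⟧) =
      PowerSeries.C (Polynomial.C 2) * PowerSeries.C (Polynomial.C (Complex.I * ω / 2)) := by
    rw [← map_mul, ← map_mul]; congr 2; ring
  rw [h, argSeries]
  simp only [map_mul]
  ring

/-- `sec(iħωD/2) exp[(2a/(iħω)) tan(iħωD/2) - aD]` as an element of `ℂ[D][[ħ]]`.  The exponent has
no term of order `0` in `ħ`, so that each power of `ħ` has a polynomial in `D` as coefficient. -/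
def secExpSeries (ω a : ℂ) : ℂ[X]⟦X⟧ :=
  PowerSeries.subst (argSeries ω) secSeries *
    PowerSeries.subst (tanTerm ω a - PowerSeries.C (Polynomial.C a * Polynomial.X))
      (PowerSeries.exp ℂ)

theorem constantCoeff_exponent (ω a : ℂ) :
    PowerSeries.constantCoeff
      (tanTerm ω a - PowerSeries.C (Polynomial.C a * Polynomial.X)) = 0 := by
  have h0 : PowerSeries.constantCoeff (PowerSeries.subst (argSeries ω) tancSeries) = 1 := by
    have hz : PowerSeries.constantCoeff (argSeries ω) = 0 := by simp [argSeries]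
    have h1 : PowerSeries.constantCoeff tancSeries = 1 := by
      have ha : Finset.HasAntidiagonal.antidiagonal 1 = {((0 : ℕ), (1 : ℕ)), (1, 0)} := rfl
      simp [tancSeries, tanSeries, secSeries, PowerSeries.coeff_mul, PowerSeries.sin,
        PowerSeries.cos, ha]
    have h2 : tancSeries = (tancSeries - PowerSeries.C 1) + PowerSeries.C 1 := by ring
    rw [h2, PowerSeries.subst_add (hasSubst_argSeries ω), map_add]
    have h3 := PowerSeries.constantCoeff_subst_eq_zero (R := ℂ) (a := argSeries ω)
      hz (tancSeries - PowerSeries.C 1) (by simp [h1])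
    erw [h3]
    rw [map_one, ← PowerSeries.coe_substAlgHom (hasSubst_argSeries ω), map_one, map_one, zero_add]
  simp [tanTerm, h0]

/-- `sec(iħωD/2) exp[(2A/(iħω)) tan(iħωD/2) - AD] f(A)`: at every point `z`, the operator above with
`a = A(z)` is applied to `f`, where `D` acts as the derivative of `f`, and the result is evaluated
at `A(z)`. -/
def secExpFormula (ω : ℂ) (A : PhaseSpace → ℝ) (f : ℝ → ℂ) : FormalSymbol :=
  PowerSeries.mk fun n z =>
    (PowerSeries.coeff n (secExpSeries ω (A z))).sum fun k c => c * iteratedDeriv k f (A z)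

/-! ### Weyl quantization on `L²(ℝ)` for a numerical value `h > 0` of `ħ` -/

/-- The Hilbert space `L²(ℝ)`. -/
abbrev L2 : Type := MeasureTheory.Lp ℂ 2 (MeasureTheory.volume : MeasureTheory.Measure ℝ)

/-- The cross-Wigner function
`W(φ, ψ)(x, p) = (2πħ)⁻¹ ∫ e^{-isp/ħ} φ(x + s/2) conj(ψ(x - s/2)) ds`. -/
def wigner (h : ℝ) (φ ψ : 𝓢(ℝ, ℂ)) (z : PhaseSpace) : ℂ :=
  (1 / (2 * Real.pi * h) : ℂ) *
    ∫ s : ℝ, Complex.exp (-(Complex.I * s * z 1 / h)) * φ (z 0 + s / 2) *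
      (starRingEnd ℂ) (ψ (z 0 - s / 2))

/-- `B` is the Weyl symbol of `T` (an operator from Schwartz functions to `L²(ℝ)`).  This is the
weak form of
`(Tφ)(x) = ∫ e^{i(x-y)p/ħ} B((x+y)/2, p) φ(y) dy dp / (2πħ)`:
pair with `ψ`, and change variables to the midpoint and the difference of `x` and `y`. -/
def HasWeylSymbol (h : ℝ) (T : 𝓢(ℝ, ℂ) → L2) (B : PhaseSpace → ℂ) : Prop :=
  ∀ φ ψ : 𝓢(ℝ, ℂ), MeasureTheory.Integrable (fun z => B z * wigner h φ ψ z) ∧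
    inner ℂ (ψ.toLp 2 : L2) (T φ) = ∫ z, B z * wigner h φ ψ z

/-- `U t = e^{-itH/ħ}`: a strongly continuous one-parameter unitary group on `L²(ℝ)` whose
generator extends `-iH/ħ` from Schwartz functions. -/
structure IsTimeEvolution (h : ℝ) (H : 𝓢(ℝ, ℂ) →ₗ[ℂ] 𝓢(ℝ, ℂ)) (U : ℝ → L2 →L[ℂ] L2) : Prop where
  mem_unitary : ∀ t, U t ∈ unitary (L2 →L[ℂ] L2)
  map_add : ∀ s t, U (s + t) = U s * U t
  continuous : ∀ v, Continuous fun t => U t v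
  hasDerivAt : ∀ φ : 𝓢(ℝ, ℂ),
    HasDerivAt (fun t => U t (φ.toLp 2)) ((-Complex.I / (h : ℂ)) • ((H φ).toLp 2 : L2)) 0

/-- `tan(tω/2) / ω`, with its limit `t/2` at `ω = 0`. -/
def tanQuotient (ω : ℂ) (t : ℝ) : ℂ :=
  if ω = 0 then (t : ℂ) / 2 else Complex.tan (t * ω / 2) / ω

/-- `sec(tω/2) exp[(2A/(iħω)) tan(tω/2)]`. -/
def evolutionSymbol (h : ℝ) (ω : ℂ) (A : PhaseSpace → ℝ) (t : ℝ) (z : PhaseSpace) : ℂ :=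
  (Complex.cos (t * ω / 2))⁻¹ *
    Complex.exp (2 * (A z : ℂ) / (Complex.I * h) * tanQuotient ω t)

end QuadSymbol

end

open QuadSymbol

/-! Write κ = iħω/2 and τ = tan(κD)/κ, a power series that makes sense for ω = 0 as well. At the
value a of A, the operator in 𝓕_A is sec(κD) exp(a(τ - D)). Differentiating the result in a
multiplies the operator by τ: the exponential contributes τ - D, and f contributes D. Replacing f by
y f uses [P(D), y] = P'(D), together with ∂_D sec(κD) = κ² sec(κD) τ and ∂_D(τ - D) = κ²τ². So if G
is 𝓕_A(f) as a function of a, then y f gives a G - (ħ²ω²/4)(G' + a G''), which is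
`expOp_secArg_coord_mul`. On the other side, A is quadratic, so A ⋆ G(A) has only three terms; the
Poisson bracket vanishes and the second bracket is 2 det Q (G' + A G'') (`secondBracket_comp`). As
ω² = det Q, multiplication by y becomes left Moyal multiplication by A.

For formal ħ, this determines the calculus. Given a point z₀, put a = A(z₀) and f = f(a) + (y - a)
g. The difference between the two candidates for f is (A - a) ⋆ the difference for g, and this
product improves the order of vanishing at z₀ by one, if an order loss of 2n is allowed in the
coefficient of ħⁿ (`vanishesAt_starShifted`). Repeating it shows that every coefficient vanishes at
z₀.

For a number ħ > 0, everything is tested against Wigner functions. Half-sums of W(Xφ, ψ) and W(φ,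
Xψ), and of their analogues with P, are products of W with a coordinate; half-differences are
derivatives of W. Integration by parts therefore turns Â acting on φ into a Moyal product acting on
the symbol (`integral_mul_wigner_quadraticOp`). Polynomials follow by induction on the degree.

For the unitary group, the proposed symbol satisfies the Schrödinger equation weakly
(`hasDerivWithinAt_weylForm_evolution`). On an analytic vector, both the group and the Weyl form are
sums of their Taylor series (`IsTimeEvolution.hasSum_inner`, `IsAnalyticVector.hasSum_weylForm`), so
equality propagates from t = 0 in steps of bounded length. If det Q > 0, the poles of the secant on
the real axis are avoided through complex times in the half-plane where the symbol stays bounded;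
the series does not see the detour. Gaussians of every width and centre are analytic vectors. No L²
bound for the Weyl form is known beforehand, so the passage to all Schwartz functions goes through
convolution: both functionals are compatible with superpositions of translates, and narrowing
Gaussians form an approximate identity (`IsTame.eq_zero`). -/

noncomputable section

/-! ### Formal power series in ħ. -/

namespace QuadSymbol

/-! ### Differential operators with constant coefficients -/

/-- `P ↦ (P(D) f)(y)`. -/
def diffOp (f : ℝ → ℂ) (y : ℝ) : ℂ[X] →ₗ[ℂ] ℂ :=
  Polynomial.lsum fun k => LinearMap.mulRight ℂ (iteratedDeriv k f y)

theorem diffOp_apply (f : ℝ → ℂ) (y : ℝ) (P : ℂ[X]) :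
    diffOp f y P = P.sum fun k c => c * iteratedDeriv k f y := rfl

theorem diffOp_monomial (f : ℝ → ℂ) (y : ℝ) (k : ℕ) (c : ℂ) :
    diffOp f y (Polynomial.monomial k c) = c * iteratedDeriv k f y := by
  simp [diffOp_apply]

theorem contDiff_diffOp {f : ℝ → ℂ} (hf : ContDiff ℝ (⊤ : ℕ∞) f) (P : ℂ[X]) :
    ContDiff ℝ (⊤ : ℕ∞) fun y => diffOp f y P := by
  induction P using Polynomial.induction_on' with
  | add p q hp hq => simpa only [map_add] using hp.add hq
  | monomial k c =>
    simp only [diffOp_monomial]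
    refine contDiff_const.mul ?_
    rw [iteratedDeriv_eq_iterate]
    exact hf.iterate_deriv k

theorem hasDerivAt_diffOp {f : ℝ → ℂ} (hf : ContDiff ℝ (⊤ : ℕ∞) f) (P : ℂ[X]) (y : ℝ) :
    HasDerivAt (fun y => diffOp f y P) (diffOp f y (Polynomial.X * P)) y := by
  induction P using Polynomial.induction_on' with
  | add p q hp hq => simpa only [map_add, mul_add] using hp.fun_add hq
  | monomial k c =>
    simp only [diffOp_monomial, Polynomial.X_mul_monomial, iteratedDeriv_succ]
    refine HasDerivAt.const_mul c (DifferentiableAt.hasDerivAt ?_)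
    have := contDiff_diffOp hf (Polynomial.monomial k 1)
    simp only [diffOp_monomial, one_mul] at this
    exact this.differentiable (by simp) y

theorem iteratedDeriv_coord_mul {f : ℝ → ℂ} (hf : ContDiff ℝ (⊤ : ℕ∞) f) (k : ℕ) (y : ℝ) :
    iteratedDeriv k (fun y : ℝ => (y : ℂ) * f y) y =
      y * iteratedDeriv k f y + k * iteratedDeriv (k - 1) f y := by
  induction k generalizing y with
  | zero => simp
  | succ k ih =>
    rw [iteratedDeriv_succ, funext ih]
    have h1 (k : ℕ) (y : ℝ) :
        HasDerivAt (iteratedDeriv k f) (iteratedDeriv (k + 1) f y) y := by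
      have := hasDerivAt_diffOp hf (Polynomial.monomial k 1) y
      simpa only [diffOp_monomial, Polynomial.X_mul_monomial, one_mul] using this
    have h2 : HasDerivAt (fun y : ℝ => (y : ℂ)) 1 y := Complex.ofRealCLM.hasDerivAt
    refine ((h2.mul (h1 k y)).add ((h1 (k - 1) y).const_mul (k : ℂ))).deriv.trans ?_
    rcases k with - | k
    · simp; ring
    · simp; ring

/-- This is the commutation relation [D, y] = 1 extended to polynomials in D; it is the source of
the derivation `derivD` below. -/
theorem diffOp_coord_mul {f : ℝ → ℂ} (hf : ContDiff ℝ (⊤ : ℕ∞) f) (P : ℂ[X]) (y : ℝ) :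
    diffOp (fun y : ℝ => (y : ℂ) * f y) y P =
      y * diffOp f y P + diffOp f y (Polynomial.derivative P) := by
  induction P using Polynomial.induction_on' with
  | add p q hp hq => simp only [map_add, hp, hq]; ring
  | monomial k c =>
    simp only [diffOp_monomial, Polynomial.derivative_monomial, iteratedDeriv_coord_mul hf]
    ring

theorem diffOp_add {f g : ℝ → ℂ} (hf : ContDiff ℝ (⊤ : ℕ∞) f) (hg : ContDiff ℝ (⊤ : ℕ∞) g)
    (P : ℂ[X]) (y : ℝ) : diffOp (f + g) y P = diffOp f y P + diffOp g y P := by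
  induction P using Polynomial.induction_on' with
  | add p q hp hq => simp only [map_add, hp, hq]; ring
  | monomial k c =>
    have hk : ((k : ℕ∞) : WithTop ℕ∞) ≤ ((⊤ : ℕ∞) : WithTop ℕ∞) := by
      exact_mod_cast (le_top : (k : ℕ∞) ≤ ⊤)
    simp only [diffOp_monomial]
    rw [iteratedDeriv_add (hf.of_le hk).contDiffAt (hg.of_le hk).contDiffAt]
    ring

theorem diffOp_const_mul (c : ℂ) (f : ℝ → ℂ)
    (P : ℂ[X]) (y : ℝ) : diffOp (fun y => c * f y) y P = c * diffOp f y P := by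
  induction P using Polynomial.induction_on' with
  | add p q hp hq => simp only [map_add, hp, hq]; ring
  | monomial k d =>
    simp only [diffOp_monomial]
    rw [iteratedDeriv_const_mul_field]
    ring

theorem diffOp_one (y : ℝ) (P : ℂ[X]) : diffOp (fun _ => 1) y P = P.coeff 0 := by
  induction P using Polynomial.induction_on' with
  | add p q hp hq => simp only [map_add, hp, hq, Polynomial.coeff_add]
  | monomial k d =>
    simp only [diffOp_monomial, iteratedDeriv_const, Polynomial.coeff_monomial]
    split_ifs <;> simp

/-! ### The derivation `∂/∂D` of `ℂ[D][[ħ]]` -/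

/-- `∂/∂D`, coefficientwise. -/
def derivD (f : ℂ[X]⟦X⟧) : ℂ[X]⟦X⟧ :=
  PowerSeries.mk fun n => Polynomial.derivative (PowerSeries.coeff n f)

theorem coeff_derivD (f : ℂ[X]⟦X⟧) (n : ℕ) :
    PowerSeries.coeff n (derivD f) = Polynomial.derivative (PowerSeries.coeff n f) := by
  simp [derivD]

theorem derivD_mul (f g : ℂ[X]⟦X⟧) : derivD (f * g) = derivD f * g + f * derivD g := by
  refine PowerSeries.ext fun n => ?_
  simp only [coeff_derivD, PowerSeries.coeff_mul, map_add, map_sum, Polynomial.derivative_mul,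
    Finset.sum_add_distrib]

theorem derivD_mul_pow (f g : ℂ[X]⟦X⟧) (m : ℕ) :
    derivD (f * g ^ m) = derivD f * g ^ m + (m : ℂ[X]⟦X⟧) * (f * derivD g * g ^ (m - 1)) := by
  induction m generalizing f with
  | zero => simp
  | succ m ih =>
    rw [pow_succ', ← mul_assoc, ih, derivD_mul]
    rcases m with - | m
    · simp
    · push_cast; ring

/-! ### The series `sec u`, `tan u / u` at `u = iħωD/2` -/

theorem derivative_cos : PowerSeries.derivative ℂ (PowerSeries.cos ℂ) = -PowerSeries.sin ℂ := by
  ext n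
  rw [PowerSeries.coeff_derivative]
  rw [map_neg]
  simp only [PowerSeries.cos, PowerSeries.sin, PowerSeries.coeff_mk, Nat.even_add_one,
    Nat.factorial_succ]
  have h0 : ((n : ℂ) + 1) ≠ 0 := by exact_mod_cast n.succ_ne_zero
  have h1 : ((n.factorial : ℕ) : ℂ) ≠ 0 := by exact_mod_cast n.factorial_ne_zero
  by_cases h : Even n
  · simp [h]
  · simp only [Nat.not_even_iff_odd] at h
    obtain ⟨k, rfl⟩ := h
    rw [show (2 * k + 1 + 1) / 2 = k + 1 by omega, show (2 * k + 1) / 2 = k by omega]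
    simp; push_cast at *; field_simp; ring

theorem derivative_sin : PowerSeries.derivative ℂ (PowerSeries.sin ℂ) = PowerSeries.cos ℂ := by
  ext n
  rw [PowerSeries.coeff_derivative]
  simp only [PowerSeries.cos, PowerSeries.sin, PowerSeries.coeff_mk, Nat.even_add_one,
    Nat.factorial_succ]
  have h0 : ((n : ℂ) + 1) ≠ 0 := by exact_mod_cast n.succ_ne_zero
  have h1 : ((n.factorial : ℕ) : ℂ) ≠ 0 := by exact_mod_cast n.factorial_ne_zero
  by_cases h : Even n
  · obtain ⟨k, rfl⟩ := h
    rw [show (k + k + 1) / 2 = k by omega, show (k + k) / 2 = k by omega]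
    have h2 : ((k : ℂ) + k + 1) ≠ 0 := by exact_mod_cast h0
    simp
    rw [show ((k : ℂ) + k + 1) = k * 2 + 1 by ring] at h2 ⊢
    field_simp
  · simp [h]

theorem cos_mul_secSeries : PowerSeries.cos ℂ * secSeries = 1 := by
  apply PowerSeries.mul_inv_cancel
  simp [PowerSeries.cos]

theorem derivative_secSeries :
    PowerSeries.derivative ℂ secSeries = secSeries * tanSeries := by
  rw [secSeries, PowerSeries.derivative_inv', derivative_cos, tanSeries, secSeries]; ring

theorem derivative_tanSeries : PowerSeries.derivative ℂ tanSeries = 1 + tanSeries ^ 2 := by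
  have h := cos_mul_secSeries
  rw [tanSeries, Derivation.leibniz, derivative_secSeries, derivative_sin, smul_eq_mul,
    smul_eq_mul, tanSeries]
  linear_combination h

theorem coeff_subst_argSeries (ω : ℂ) (f : ℂ⟦X⟧) (n : ℕ) :
    PowerSeries.coeff n (PowerSeries.subst (argSeries ω) f) =
      Polynomial.monomial n (PowerSeries.coeff n f * (Complex.I * ω / 2) ^ n) := by
  have h (d : ℕ) : PowerSeries.coeff n (argSeries ω ^ d) =
      if n = d then Polynomial.monomial n ((Complex.I * ω / 2) ^ n) else 0 := by
    rw [argSeries, mul_pow, ← map_pow, PowerSeries.coeff_C_mul, PowerSeries.coeff_X_pow]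
    split_ifs with hd
    · subst hd
      rw [mul_one, mul_pow, ← map_pow, Polynomial.C_mul_X_pow_eq_monomial]
    · simp
  rw [PowerSeries.coeff_subst' (hasSubst_argSeries ω), finsum_eq_single _ n]
  · rw [h, if_pos rfl, Polynomial.smul_monomial, smul_eq_mul]
  · intro d hd
    rw [h, if_neg (Ne.symm hd), smul_zero]

/-- `iħω/2`. -/
def halfFreq (ω : ℂ) : ℂ[X]⟦X⟧ :=
  PowerSeries.C (Polynomial.C (Complex.I * ω / 2)) * PowerSeries.X

theorem derivD_subst_argSeries (ω : ℂ) (f : ℂ⟦X⟧) :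
    derivD (PowerSeries.subst (argSeries ω) f) =
      halfFreq ω * PowerSeries.subst (argSeries ω) (PowerSeries.derivative ℂ f) := by
  refine PowerSeries.ext fun n => ?_
  rw [coeff_derivD, coeff_subst_argSeries, Polynomial.derivative_monomial, halfFreq,
    mul_assoc (PowerSeries.C _), PowerSeries.coeff_C_mul]
  rcases n with - | n
  · simp
  · rw [PowerSeries.coeff_succ_X_mul, coeff_subst_argSeries, PowerSeries.coeff_derivative,
      Polynomial.C_mul_monomial]
    simp only [Nat.add_sub_cancel]
    congr 1
    push_cast; ring

/-- `sec u`. -/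
def secArg (ω : ℂ) : ℂ[X]⟦X⟧ := PowerSeries.subst (argSeries ω) secSeries

/-- `D tan u / u`. -/
def tanArg (ω : ℂ) : ℂ[X]⟦X⟧ :=
  PowerSeries.C Polynomial.X * PowerSeries.subst (argSeries ω) tancSeries

/-- `D tan u / u - D`. -/
def tanArgSub (ω : ℂ) : ℂ[X]⟦X⟧ := tanArg ω - PowerSeries.C Polynomial.X

/-- Since u is `halfFreq ω` times D, tan u can be expressed through `tanArg` without dividing by ω.
All later identities are written this way, so that ω = 0 needs no separate case. -/
theorem halfFreq_mul_tanArg (ω : ℂ) :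
    halfFreq ω * tanArg ω = PowerSeries.subst (argSeries ω) tanSeries := by
  rw [← X_mul_tancSeries, PowerSeries.subst_mul (hasSubst_argSeries ω),
    PowerSeries.subst_X (hasSubst_argSeries ω), tanArg, halfFreq, argSeries, map_mul]
  ring

theorem derivD_secArg (ω : ℂ) :
    derivD (secArg ω) = halfFreq ω ^ 2 * (secArg ω * tanArg ω) := by
  rw [secArg, derivD_subst_argSeries, derivative_secSeries,
    PowerSeries.subst_mul (hasSubst_argSeries ω), ← halfFreq_mul_tanArg]
  ring

theorem derivD_tanArg (ω : ℂ) : derivD (tanArg ω) = 1 + (halfFreq ω * tanArg ω) ^ 2 := by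
  have h : derivD (tanArg ω) =
      PowerSeries.subst (argSeries ω) (PowerSeries.derivative ℂ tanSeries) := by
    refine PowerSeries.ext fun n => ?_
    rw [coeff_derivD, tanArg, PowerSeries.coeff_C_mul, coeff_subst_argSeries,
      coeff_subst_argSeries, Polynomial.X_mul_monomial, Polynomial.derivative_monomial,
      PowerSeries.coeff_derivative, tancSeries, PowerSeries.coeff_mk]
    simp only [Nat.add_sub_cancel]
    congr 1
    push_cast; ring
  rw [h, derivative_tanSeries, PowerSeries.subst_add (hasSubst_argSeries ω),
    PowerSeries.subst_pow (hasSubst_argSeries ω), halfFreq_mul_tanArg,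
    ← PowerSeries.coe_substAlgHom (hasSubst_argSeries ω), map_one]

/-- Here sec² u - 1 = tan² u: subtracting D removes the constant term, and what is left has the
factor ħ² contained in `halfFreq ω ^ 2`. -/
theorem derivD_tanArgSub (ω : ℂ) :
    derivD (tanArgSub ω) = halfFreq ω ^ 2 * tanArg ω ^ 2 := by
  have h : derivD (tanArgSub ω) = derivD (tanArg ω) - 1 := by
    refine PowerSeries.ext fun n => ?_
    simp only [tanArgSub, coeff_derivD, map_sub, PowerSeries.coeff_C, PowerSeries.coeff_one]
    split_ifs <;> simp
  rw [h, derivD_tanArg]; ring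

theorem halfFreq_sq (ω : ℂ) : halfFreq ω ^ 2 =
    PowerSeries.C (Polynomial.C (-(ω ^ 2 / 4))) * PowerSeries.X ^ 2 := by
  rw [halfFreq, mul_pow, ← map_pow, ← map_pow]
  congr 3
  linear_combination (ω ^ 2 / 4) * Complex.I_sq

theorem coeff_zero_tancSeries : PowerSeries.coeff 0 tancSeries = 1 := by
  have ha : Finset.HasAntidiagonal.antidiagonal 1 = {((0 : ℕ), (1 : ℕ)), (1, 0)} := rfl
  simp [tancSeries, tanSeries, secSeries, PowerSeries.coeff_mul, PowerSeries.sin,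
    PowerSeries.cos, ha]

theorem coeff_zero_secSeries : PowerSeries.coeff 0 secSeries = 1 := by
  simp [secSeries, PowerSeries.cos]

/-- The coefficient of `ħⁿ` is homogeneous of degree `n + d` in `D`. -/
def IsHomog (d : ℕ) (f : ℂ[X]⟦X⟧) : Prop :=
  ∀ n, ∃ c, PowerSeries.coeff n f = Polynomial.monomial (n + d) c

theorem IsHomog.mul {d e : ℕ} {f g : ℂ[X]⟦X⟧} (hf : IsHomog d f) (hg : IsHomog e g) :
    IsHomog (d + e) (f * g) := by
  choose a ha using hf
  choose b hb using hg
  intro n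
  refine ⟨∑ p ∈ Finset.HasAntidiagonal.antidiagonal n, a p.1 * b p.2, ?_⟩
  rw [PowerSeries.coeff_mul, map_sum]
  refine Finset.sum_congr rfl fun p hp => ?_
  rw [Finset.HasAntidiagonal.mem_antidiagonal] at hp
  rw [ha, hb, Polynomial.monomial_mul_monomial,
    show p.1 + d + (p.2 + e) = n + (d + e) by omega]

theorem isHomog_secArg (ω : ℂ) : IsHomog 0 (secArg ω) := fun n =>
  ⟨_, coeff_subst_argSeries ω secSeries n⟩

theorem isHomog_tanArgSub (ω : ℂ) : IsHomog 1 (tanArgSub ω) := fun n => by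
  rw [tanArgSub, map_sub, tanArg, PowerSeries.coeff_C_mul, coeff_subst_argSeries,
    Polynomial.X_mul_monomial, PowerSeries.coeff_C]
  split_ifs with h
  · subst h
    exact ⟨_, by rw [← Polynomial.monomial_one_one_eq_X, ← map_sub]⟩
  · exact ⟨_, by rw [sub_zero]⟩

/-- D enters only through ħD, apart from one extra factor D in each `tanArgSub`. The order in D is
thus at least the order in ħ, which annihilates constants beyond order 0 and polynomials beyond
their degree. -/
theorem isHomog_secArg_mul_pow (ω : ℂ) (m : ℕ) :
    IsHomog m (secArg ω * tanArgSub ω ^ m) := by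
  induction m with
  | zero => simpa using isHomog_secArg ω
  | succ m ih =>
    rw [pow_succ, ← mul_assoc]
    exact ih.mul (isHomog_tanArgSub ω)

/-- The series (tan u)/u starts with 1, so the term D cancels. Consequently only the terms m ≤ n of
the exponential reach order n in ħ, which justifies the finite sum in `expOp`. -/
theorem X_dvd_tanArgSub (ω : ℂ) : PowerSeries.X ∣ tanArgSub ω := by
  rw [PowerSeries.X_dvd_iff, ← PowerSeries.coeff_zero_eq_constantCoeff_apply, tanArgSub, map_sub,
    tanArg, PowerSeries.coeff_C_mul, coeff_subst_argSeries, coeff_zero_tancSeries]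
  simp

theorem coeff_mul_tanArgSub_pow (ω : ℂ) (ρ : ℂ[X]⟦X⟧) {n m : ℕ} (h : n < m) :
    PowerSeries.coeff n (ρ * tanArgSub ω ^ m) = 0 :=
  PowerSeries.X_pow_dvd_iff.1
    (((pow_dvd_pow_of_dvd (X_dvd_tanArgSub ω) m)).mul_left ρ) n h

/-! ### The operators `ρ exp[(2A/(iħω)) tan u - AD]` -/

/-- The coefficient of `ħⁿ` in `ρ exp[(2a/(iħω)) tan u - aD] f` at the point `a`. -/
def expOp (ω : ℂ) (n : ℕ) (ρ : ℂ[X]⟦X⟧) (f : ℝ → ℂ) (a : ℝ) : ℂ :=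
  ∑ m ∈ Finset.range (n + 1),
    (a : ℂ) ^ m / m.factorial * diffOp f a (PowerSeries.coeff n (ρ * tanArgSub ω ^ m))

theorem coeff_secExpSeries (ω a : ℂ) (n : ℕ) :
    PowerSeries.coeff n (secExpSeries ω a) = ∑ m ∈ Finset.range (n + 1),
      (a ^ m / m.factorial : ℂ) • PowerSeries.coeff n (secArg ω * tanArgSub ω ^ m) := by
  have hexp : tanTerm ω a - PowerSeries.C (Polynomial.C a * Polynomial.X) =
      PowerSeries.C (Polynomial.C a) * tanArgSub ω := by
    rw [tanTerm, tanArgSub, tanArg, map_mul]; ring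
  have hs : PowerSeries.HasSubst (PowerSeries.C (Polynomial.C a) * tanArgSub ω) := by
    apply PowerSeries.HasSubst.of_constantCoeff_zero'
    rw [← hexp]; exact constantCoeff_exponent ω a
  have hk (k : ℕ) (hkn : k ≤ n) : PowerSeries.coeff k (PowerSeries.subst
      (PowerSeries.C (Polynomial.C a) * tanArgSub ω) (PowerSeries.exp ℂ)) =
      ∑ m ∈ Finset.range (n + 1),
        (a ^ m / m.factorial : ℂ) • PowerSeries.coeff k (tanArgSub ω ^ m) := by
    have hm (m : ℕ) : PowerSeries.coeff m (PowerSeries.exp ℂ) •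
        PowerSeries.coeff k ((PowerSeries.C (Polynomial.C a) * tanArgSub ω) ^ m) =
        (a ^ m / m.factorial : ℂ) • PowerSeries.coeff k (tanArgSub ω ^ m) := by
      rw [mul_pow, ← map_pow, ← map_pow, PowerSeries.coeff_C_mul, PowerSeries.coeff_exp,
        ← Polynomial.smul_eq_C_mul, smul_smul]
      congr 1
      simp; ring
    rw [PowerSeries.coeff_subst' hs, finsum_congr hm]
    refine finsum_eq_sum_of_support_subset _ fun m hm => ?_
    simp only [Finset.coe_range, Set.mem_Iio]
    by_contra hmn
    refine hm ?_
    have := coeff_mul_tanArgSub_pow ω 1 (n := k) (m := m) (by omega)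
    rw [one_mul] at this
    simp only [this, smul_zero]
  rw [secExpSeries, hexp, PowerSeries.coeff_mul]
  simp only [PowerSeries.coeff_mul, Finset.smul_sum]
  rw [Finset.sum_comm]
  refine Finset.sum_congr rfl fun p hp => ?_
  rw [Finset.HasAntidiagonal.mem_antidiagonal] at hp
  rw [hk p.2 (by omega), Finset.mul_sum]
  refine Finset.sum_congr rfl fun m _ => ?_
  rw [mul_smul_comm]; rfl

theorem coeff_secExpFormula (ω : ℂ) (A : PhaseSpace → ℝ) (f : ℝ → ℂ) (n : ℕ) (z : PhaseSpace) :
    PowerSeries.coeff n (secExpFormula ω A f) z = expOp ω n (secArg ω) f (A z) := by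
  rw [secExpFormula, PowerSeries.coeff_mk, ← diffOp_apply, coeff_secExpSeries, map_sum, expOp]
  simp only [map_smul, smul_eq_mul]

theorem contDiff_expOp (ω : ℂ) (n : ℕ) (ρ : ℂ[X]⟦X⟧) {f : ℝ → ℂ}
    (hf : ContDiff ℝ (⊤ : ℕ∞) f) : ContDiff ℝ (⊤ : ℕ∞) (expOp ω n ρ f) := by
  refine ContDiff.sum fun m _ => ContDiff.mul ?_ (contDiff_diffOp hf _)
  exact (Complex.ofRealCLM.contDiff.pow m).div_const _

/-- By the product rule, the powers of a produce a factor `tanArgSub` and the function f a factor D;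
their sum is `tanArg`. -/
theorem hasDerivAt_expOp (ω : ℂ) (n : ℕ) (ρ : ℂ[X]⟦X⟧) {f : ℝ → ℂ}
    (hf : ContDiff ℝ (⊤ : ℕ∞) f) (a : ℝ) :
    HasDerivAt (expOp ω n ρ f) (expOp ω n (ρ * tanArg ω) f a) a := by
  have h1 (m : ℕ) : HasDerivAt (fun a : ℝ => (a : ℂ) ^ m / m.factorial)
      (m * (a : ℂ) ^ (m - 1) / m.factorial) a := by
    simpa using ((Complex.ofRealCLM.hasDerivAt (x := a)).pow m).div_const (m.factorial : ℂ)
  have h2 := HasDerivAt.fun_sum fun m (_ : m ∈ Finset.range (n + 1)) =>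
    (h1 m).fun_mul (hasDerivAt_diffOp hf (PowerSeries.coeff n (ρ * tanArgSub ω ^ m)) a)
  refine h2.congr_deriv ?_
  have h3 : ρ * tanArg ω = ρ * tanArgSub ω + PowerSeries.C Polynomial.X * ρ := by
    rw [tanArgSub]; ring
  rw [Finset.sum_add_distrib, Finset.sum_range_succ', expOp]
  simp only [h3, add_mul, map_add, mul_add, Finset.sum_add_distrib, mul_assoc (PowerSeries.C _),
    PowerSeries.coeff_C_mul]
  congr 1
  -- Shifting m by one leaves over the term m = n, with `tanArgSub ω ^ (n + 1)`; it has no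
  -- coefficient of order n.
  rw [Finset.sum_range_succ _ n, mul_assoc, ← pow_succ', coeff_mul_tanArgSub_pow ω ρ n.lt_succ_self,
    map_zero]
  simp only [Nat.cast_zero, zero_mul, zero_div, mul_zero]
  congr 1
  refine Finset.sum_congr rfl fun m _ => ?_
  rw [mul_assoc, ← pow_succ', Nat.factorial_succ, Nat.add_sub_cancel]
  have h0 : ((m + 1 : ℕ) : ℂ) ≠ 0 := by exact_mod_cast m.succ_ne_zero
  have h1 : ((m.factorial : ℕ) : ℂ) ≠ 0 := by exact_mod_cast m.factorial_ne_zero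
  congr 1
  push_cast at *
  field_simp

theorem expOp_C_mul (ω c : ℂ) (n : ℕ) (ρ : ℂ[X]⟦X⟧) (f : ℝ → ℂ) (a : ℝ) :
    expOp ω n (PowerSeries.C (Polynomial.C c) * ρ) f a = c * expOp ω n ρ f a := by
  simp only [expOp, mul_assoc (PowerSeries.C _), PowerSeries.coeff_C_mul, Finset.mul_sum,
    ← Polynomial.smul_eq_C_mul, map_smul, smul_eq_mul]
  exact Finset.sum_congr rfl fun m _ => by ring

theorem expOp_X_mul_zero (ω : ℂ) (ρ : ℂ[X]⟦X⟧) (f : ℝ → ℂ) (a : ℝ) :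
    expOp ω 0 (PowerSeries.X * ρ) f a = 0 := by
  simp [expOp]

theorem expOp_X_mul_succ (ω : ℂ) (n : ℕ) (ρ : ℂ[X]⟦X⟧) (f : ℝ → ℂ) (a : ℝ) :
    expOp ω (n + 1) (PowerSeries.X * ρ) f a = expOp ω n ρ f a := by
  rw [expOp, Finset.sum_range_succ, expOp]
  simp only [mul_assoc PowerSeries.X, PowerSeries.coeff_succ_X_mul]
  rw [coeff_mul_tanArgSub_pow ω ρ n.lt_succ_self, map_zero, mul_zero, add_zero]

/-- Moving y to the left of ρ exp(a(τ - D)) costs its D-derivative: one term differentiates ρ, the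
other differentiates the exponent and carries a factor a. -/
theorem expOp_coord_mul (ω : ℂ) (n : ℕ) (ρ : ℂ[X]⟦X⟧) {f : ℝ → ℂ}
    (hf : ContDiff ℝ (⊤ : ℕ∞) f) (a : ℝ) :
    expOp ω n ρ (fun y : ℝ => (y : ℂ) * f y) a = a * expOp ω n ρ f a +
      expOp ω n (derivD ρ) f a + a * expOp ω n (ρ * derivD (tanArgSub ω)) f a := by
  simp only [expOp, diffOp_coord_mul hf, ← coeff_derivD, derivD_mul_pow]
  have hdvd : PowerSeries.X ∣ derivD (tanArgSub ω) := by
    rw [derivD_tanArgSub, halfFreq_sq]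
    exact ⟨PowerSeries.C (Polynomial.C (-(ω ^ 2 / 4))) * PowerSeries.X * tanArg ω ^ 2, by ring⟩
  -- The reindexed sum lacks its top term m = n. It is zero because `derivD (tanArgSub ω)` supplies
  -- one more factor ħ besides the n already present.
  have hz : PowerSeries.coeff n (ρ * derivD (tanArgSub ω) * tanArgSub ω ^ n) = 0 := by
    have hX : (PowerSeries.X : ℂ[X]⟦X⟧) ^ (n + 1) ∣
        ρ * derivD (tanArgSub ω) * tanArgSub ω ^ n := ?_
    · exact PowerSeries.X_pow_dvd_iff.1 hX n n.lt_succ_self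
    rw [pow_succ', mul_assoc]
    exact (mul_dvd_mul hdvd (pow_dvd_pow_of_dvd (X_dvd_tanArgSub ω) n)).mul_left ρ
  have hcast (m : ℕ) (g : ℂ[X]⟦X⟧) (y : ℝ) : diffOp f y (PowerSeries.coeff n ((m : ℂ[X]⟦X⟧) * g)) =
      m * diffOp f y (PowerSeries.coeff n g) := by
    rw [show (m : ℂ[X]⟦X⟧) * g = m • g by simp, map_nsmul, map_nsmul]; simp
  simp only [map_add, hcast, mul_add, Finset.sum_add_distrib, Finset.mul_sum]
  rw [add_assoc]
  congr 1
  · exact Finset.sum_congr rfl fun m _ => by ring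
  congr 1
  rw [Finset.sum_range_succ', Finset.sum_range_succ _ n, hz, map_zero]
  simp only [Nat.cast_zero, zero_mul, mul_zero]
  congr 1
  refine Finset.sum_congr rfl fun m _ => ?_
  rw [Nat.factorial_succ, Nat.add_sub_cancel]
  have h0 : ((m + 1 : ℕ) : ℂ) ≠ 0 := by exact_mod_cast m.succ_ne_zero
  have h1 : ((m.factorial : ℕ) : ℂ) ≠ 0 := by exact_mod_cast m.factorial_ne_zero
  push_cast at *
  field_simp
  ring

/-- The symbol calculus of `y f(y)`: `F(y f) = A ⋆ F(f)`, in terms of the functions of `A`. -/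
theorem expOp_secArg_coord_mul (ω : ℂ) (n : ℕ) {f : ℝ → ℂ} (hf : ContDiff ℝ (⊤ : ℕ∞) f) (a : ℝ) :
    expOp ω (n + 2) (secArg ω) (fun y : ℝ => (y : ℂ) * f y) a =
      a * expOp ω (n + 2) (secArg ω) f a - ω ^ 2 / 4 *
        (expOp ω n (secArg ω * tanArg ω) f a +
          a * expOp ω n (secArg ω * tanArg ω * tanArg ω) f a) := by
  have h (ρ : ℂ[X]⟦X⟧) : expOp ω (n + 2) (halfFreq ω ^ 2 * ρ) f a =
      -(ω ^ 2 / 4) * expOp ω n ρ f a := by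
    rw [halfFreq_sq, mul_assoc, expOp_C_mul, pow_two PowerSeries.X, mul_assoc, expOp_X_mul_succ, expOp_X_mul_succ]
  rw [expOp_coord_mul ω _ _ hf, derivD_secArg, derivD_tanArgSub,
    show secArg ω * (halfFreq ω ^ 2 * tanArg ω ^ 2) =
      halfFreq ω ^ 2 * (secArg ω * tanArg ω * tanArg ω) by ring, h, h]
  ring

/-- Both correction terms contain `halfFreq ω ^ 2`, hence ħ², and are invisible in orders 0 and 1.
-/
theorem expOp_secArg_coord_mul_of_lt_two (ω : ℂ) {n : ℕ} (hn : n < 2) {f : ℝ → ℂ}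
    (hf : ContDiff ℝ (⊤ : ℕ∞) f) (a : ℝ) :
    expOp ω n (secArg ω) (fun y : ℝ => (y : ℂ) * f y) a = a * expOp ω n (secArg ω) f a := by
  have h (ρ : ℂ[X]⟦X⟧) : expOp ω n (halfFreq ω ^ 2 * ρ) f a = 0 := by
    rw [halfFreq_sq, mul_assoc, expOp_C_mul, pow_two PowerSeries.X, mul_assoc]
    interval_cases n
    · rw [expOp_X_mul_zero, mul_zero]
    · rw [expOp_X_mul_succ, expOp_X_mul_zero, mul_zero]
  rw [expOp_coord_mul ω _ _ hf, derivD_secArg, derivD_tanArgSub,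
    show secArg ω * (halfFreq ω ^ 2 * tanArg ω ^ 2) =
      halfFreq ω ^ 2 * (secArg ω * tanArg ω ^ 2) by ring, h, h]
  ring

theorem expOp_add (ω : ℂ) (n : ℕ) (ρ : ℂ[X]⟦X⟧) {f g : ℝ → ℂ} (hf : ContDiff ℝ (⊤ : ℕ∞) f)
    (hg : ContDiff ℝ (⊤ : ℕ∞) g) (a : ℝ) :
    expOp ω n ρ (f + g) a = expOp ω n ρ f a + expOp ω n ρ g a := by
  simp only [expOp, diffOp_add hf hg, mul_add, Finset.sum_add_distrib]

theorem expOp_const_mul (ω c : ℂ) (n : ℕ) (ρ : ℂ[X]⟦X⟧) (f : ℝ → ℂ) (a : ℝ) :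
    expOp ω n ρ (fun y => c * f y) a = c * expOp ω n ρ f a := by
  simp only [expOp, diffOp_const_mul, Finset.mul_sum]
  exact Finset.sum_congr rfl fun m _ => by ring

theorem expOp_secArg_one (ω : ℂ) (n : ℕ) (a : ℝ) :
    expOp ω n (secArg ω) (fun _ => 1) a = if n = 0 then 1 else 0 := by
  simp only [expOp, diffOp_one]
  rw [Finset.sum_eq_single_of_mem 0 (by simp)]
  · rw [pow_zero, pow_zero, mul_one, secArg, coeff_subst_argSeries, Polynomial.coeff_monomial]
    split_ifs with h
    · subst h; simp [coeff_zero_secSeries]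
    · simp
  · intro m _ hm
    obtain ⟨c, hc⟩ := isHomog_secArg_mul_pow ω m n
    rw [hc, Polynomial.coeff_monomial, if_neg (by omega), mul_zero]

/-! ### Partial derivatives and the brackets with a quadratic symbol -/

/-- The partial derivative `∂ᵢ C`. -/
def pderiv (i : Fin 2) (C : PhaseSpace → ℂ) (z : PhaseSpace) : ℂ :=
  fderiv ℝ C z (Pi.single i 1)

/-- The linear form `dA(z)ᵢ = (Q z)ᵢ`. -/
def symbolGrad (Q : Matrix (Fin 2) (Fin 2) ℝ) (i : Fin 2) (z : PhaseSpace) : ℂ :=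
  (Q i 0 * z 0 + Q i 1 * z 1 : ℝ)

theorem quadraticSymbol_eq {Q : Matrix (Fin 2) (Fin 2) ℝ} (hQ : Q.IsSymm) (z : PhaseSpace) :
    quadraticSymbol Q z =
      (Q 0 0 * z 0 ^ 2 + 2 * Q 0 1 * z 0 * z 1 + Q 1 1 * z 1 ^ 2) / 2 := by
  have h : Q 1 0 = Q 0 1 := hQ.apply 0 1
  simp only [quadraticSymbol, dotProduct, Matrix.mulVec, Fin.sum_univ_two, h]
  ring

theorem det_eq {Q : Matrix (Fin 2) (Fin 2) ℝ} (hQ : Q.IsSymm) :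
    Q.det = Q 0 0 * Q 1 1 - Q 0 1 ^ 2 := by
  have h : Q 1 0 = Q 0 1 := hQ.apply 0 1
  rw [Matrix.det_fin_two, h]; ring

/-- The coordinate `zᵢ` as a complex linear form. -/
def coordForm (i : Fin 2) : PhaseSpace →L[ℝ] ℂ :=
  Complex.ofRealCLM.comp (ContinuousLinearMap.proj i)

/-- The second derivative of the quadratic symbol. -/
def symbolHess (Q : Matrix (Fin 2) (Fin 2) ℝ) : PhaseSpace →L[ℝ] PhaseSpace →L[ℝ] ℂ :=
  ∑ i, (∑ j, Q i j • ContinuousLinearMap.proj (R := ℝ) (φ := fun _ : Fin 2 => ℝ) j).smulRight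
    (coordForm i)

theorem symbolHess_apply (Q : Matrix (Fin 2) (Fin 2) ℝ) (z v : PhaseSpace) :
    symbolHess Q z v = symbolGrad Q 0 z * v 0 + symbolGrad Q 1 z * v 1 := by
  simp [symbolHess, symbolGrad, coordForm, Fin.sum_univ_two]

theorem hasFDerivAt_coord (i : Fin 2) (z : PhaseSpace) :
    HasFDerivAt (fun z : PhaseSpace => (z i : ℂ)) (coordForm i) z :=
  (coordForm i).hasFDerivAt

theorem hasFDerivAt_quadraticSymbol {Q : Matrix (Fin 2) (Fin 2) ℝ} (hQ : Q.IsSymm)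
    (z : PhaseSpace) :
    HasFDerivAt (fun z => (quadraticSymbol Q z : ℂ)) (symbolHess Q z) z := by
  have h0 := hasFDerivAt_coord 0 z
  have h1 := hasFDerivAt_coord 1 z
  have h := ((((h0.mul h0).const_mul (Q 0 0 : ℂ)).add
    ((h0.mul h1).const_mul (2 * Q 0 1 : ℂ))).add ((h1.mul h1).const_mul (Q 1 1 : ℂ))).mul_const
      (1 / 2 : ℂ)
  have hs : Q 1 0 = Q 0 1 := hQ.apply 0 1
  have e : (fun z => (quadraticSymbol Q z : ℂ)) = fun z : PhaseSpace =>
      ((Q 0 0 : ℂ) * ((z 0 : ℂ) * z 0) + (2 * Q 0 1 : ℂ) * (z 0 * z 1) +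
        (Q 1 1 : ℂ) * (z 1 * z 1)) * (1 / 2 : ℂ) := by
    funext z
    rw [quadraticSymbol_eq hQ]; push_cast; ring
  rw [e]
  refine h.congr_fderiv ?_
  ext v
  simp only [symbolHess_apply, symbolGrad, coordForm, hs]
  simp
  ring

theorem contDiff_quadraticSymbol (Q : Matrix (Fin 2) (Fin 2) ℝ) :
    ContDiff ℝ (⊤ : ℕ∞) (quadraticSymbol Q) := by
  unfold quadraticSymbol
  simp only [dotProduct, Matrix.mulVec]
  fun_prop

theorem contDiff_pderiv {C : PhaseSpace → ℂ} (hC : ContDiff ℝ (⊤ : ℕ∞) C) (i : Fin 2) :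
    ContDiff ℝ (⊤ : ℕ∞) (pderiv i C) :=
  (hC.fderiv_right (m := (⊤ : ℕ∞)) (by simp)).clm_apply contDiff_const

theorem pderiv_add {C D : PhaseSpace → ℂ} (hC : ContDiff ℝ (⊤ : ℕ∞) C)
    (hD : ContDiff ℝ (⊤ : ℕ∞) D) (i : Fin 2) : pderiv i (C + D) = pderiv i C + pderiv i D := by
  funext z
  simp only [pderiv, Pi.add_apply]
  rw [fderiv_add (hC.differentiable (by simp) z) (hD.differentiable (by simp) z)]
  rfl

theorem pderiv_sub {C D : PhaseSpace → ℂ} (hC : ContDiff ℝ (⊤ : ℕ∞) C)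
    (hD : ContDiff ℝ (⊤ : ℕ∞) D) (i : Fin 2) : pderiv i (C - D) = pderiv i C - pderiv i D := by
  funext z
  simp only [pderiv, Pi.sub_apply]
  rw [fderiv_sub (hC.differentiable (by simp) z) (hD.differentiable (by simp) z)]
  rfl

theorem pderiv_mul {C D : PhaseSpace → ℂ} (hC : ContDiff ℝ (⊤ : ℕ∞) C)
    (hD : ContDiff ℝ (⊤ : ℕ∞) D) (i : Fin 2) :
    pderiv i (C * D) = pderiv i C * D + C * pderiv i D := by
  funext z
  simp only [pderiv, Pi.add_apply, Pi.mul_apply]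
  rw [fderiv_mul (hC.differentiable (by simp) z) (hD.differentiable (by simp) z)]
  simp; ring

theorem hasFDerivAt_comp_quadraticSymbol {Q : Matrix (Fin 2) (Fin 2) ℝ} (hQ : Q.IsSymm)
    {s : ℝ → ℂ} {s' : ℂ} {z : PhaseSpace} (hs : HasDerivAt s s' (quadraticSymbol Q z)) :
    HasFDerivAt (fun z => s (quadraticSymbol Q z)) (s' • symbolHess Q z) z := by
  have h1 : HasFDerivAt (quadraticSymbol Q) (Complex.reCLM.comp (symbolHess Q z)) z := by
    exact Complex.reCLM.hasFDerivAt.comp z (hasFDerivAt_quadraticSymbol hQ z)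
  refine (hs.hasFDerivAt.comp z h1).congr_fderiv ?_
  ext v
  have : ((symbolHess Q z v).re : ℂ) = symbolHess Q z v := by
    rw [symbolHess_apply, symbolGrad, symbolGrad]
    norm_cast
  simp only [ContinuousLinearMap.coe_comp, Function.comp_apply, Complex.reCLM_apply]
  rw [smul_apply, ← this]
  simp [mul_comm]

theorem pderiv_comp_quadraticSymbol {Q : Matrix (Fin 2) (Fin 2) ℝ} (hQ : Q.IsSymm)
    {s s' : ℝ → ℂ} (hs : ∀ a, HasDerivAt s (s' a) a) (i : Fin 2) :
    pderiv i (fun z => s (quadraticSymbol Q z)) =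
      (fun z => s' (quadraticSymbol Q z)) * symbolGrad Q i := by
  funext z
  rw [pderiv, (hasFDerivAt_comp_quadraticSymbol hQ (hs _)).fderiv, smul_apply,
    symbolHess_apply]
  fin_cases i <;> simp

theorem hasFDerivAt_symbolGrad (Q : Matrix (Fin 2) (Fin 2) ℝ) (i : Fin 2) (z : PhaseSpace) :
    HasFDerivAt (symbolGrad Q i) ((Q i 0 : ℂ) • coordForm 0 + (Q i 1 : ℂ) • coordForm 1) z := by
  have h := ((hasFDerivAt_coord 0 z).const_mul (Q i 0 : ℂ)).add
    ((hasFDerivAt_coord 1 z).const_mul (Q i 1 : ℂ))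
  refine h.congr_of_eventuallyEq (Filter.Eventually.of_forall fun z => ?_)
  simp [symbolGrad]

theorem contDiff_symbolGrad (Q : Matrix (Fin 2) (Fin 2) ℝ) (i : Fin 2) :
    ContDiff ℝ (⊤ : ℕ∞) (symbolGrad Q i) := by
  unfold symbolGrad
  exact Complex.ofRealCLM.contDiff.comp (f := fun z : PhaseSpace => Q i 0 * z 0 + Q i 1 * z 1)
    (by fun_prop)

theorem pderiv_symbolGrad (Q : Matrix (Fin 2) (Fin 2) ℝ) (i j : Fin 2) :
    pderiv j (symbolGrad Q i) = fun _ => (Q i j : ℂ) := by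
  funext z
  rw [pderiv, (hasFDerivAt_symbolGrad Q i z).fderiv]
  fin_cases j <;> simp [coordForm]

theorem pderiv_quadraticSymbol {Q : Matrix (Fin 2) (Fin 2) ℝ} (hQ : Q.IsSymm) (i : Fin 2) :
    pderiv i (fun z => (quadraticSymbol Q z : ℂ)) = symbolGrad Q i := by
  funext z
  rw [pderiv, (hasFDerivAt_quadraticSymbol hQ z).fderiv, symbolHess_apply]
  fin_cases i <;> simp

theorem partialDeriv_one (μ : Fin 1 → Fin 2) (C : PhaseSpace → ℂ) (z : PhaseSpace) :
    partialDeriv μ C z = pderiv (μ 0) C z := by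
  rw [partialDeriv, iteratedFDeriv_one_apply, pderiv]

theorem partialDeriv_two (μ : Fin 2 → Fin 2) {C : PhaseSpace → ℂ} (hC : ContDiff ℝ (⊤ : ℕ∞) C)
    (z : PhaseSpace) : partialDeriv μ C z = pderiv (μ 0) (pderiv (μ 1) C) z := by
  rw [partialDeriv, iteratedFDeriv_two_apply, pderiv]
  have h : DifferentiableAt ℝ (fderiv ℝ C) z :=
    (hC.fderiv_right (m := (⊤ : ℕ∞)) (by simp)).differentiable (by simp) z
  change _ = fderiv ℝ (fun y => fderiv ℝ C y (Pi.single (μ 1) 1)) z _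
  rw [fderiv_clm_apply h (differentiableAt_const _)]
  simp

theorem bracket_zero (C D : PhaseSpace → ℂ) : bracket 0 C D = C * D := by
  funext z
  simp [bracket, partialDeriv]

theorem bracket_one (C D : PhaseSpace → ℂ) (z : PhaseSpace) : bracket 1 C D z =
    pderiv 0 C z * pderiv 1 D z - pderiv 1 C z * pderiv 0 D z := by
  simp only [bracket, ← (Equiv.funUnique (Fin 1) (Fin 2)).symm.sum_comp, Fin.sum_univ_two,
    partialDeriv_one, poissonTensor]
  simp
  ring

theorem bracket_two {C D : PhaseSpace → ℂ} (hC : ContDiff ℝ (⊤ : ℕ∞) C)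
    (hD : ContDiff ℝ (⊤ : ℕ∞) D) (z : PhaseSpace) : bracket 2 C D z =
      pderiv 0 (pderiv 0 C) z * pderiv 1 (pderiv 1 D) z -
      pderiv 0 (pderiv 1 C) z * pderiv 1 (pderiv 0 D) z -
      pderiv 1 (pderiv 0 C) z * pderiv 0 (pderiv 1 D) z +
      pderiv 1 (pderiv 1 C) z * pderiv 0 (pderiv 0 D) z := by
  simp only [bracket, ← (finTwoArrowEquiv (Fin 2)).symm.sum_comp, Fintype.sum_prod_type,
    Fin.sum_univ_two, partialDeriv_two _ hC, partialDeriv_two _ hD, poissonTensor]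
  simp [Fin.prod_univ_two]
  ring

/-! ### Left Moyal multiplication by `A - a` -/

/-- The symbol `A - a`. -/
def shiftedSymbol (Q : Matrix (Fin 2) (Fin 2) ℝ) (a : ℝ) (z : PhaseSpace) : ℂ :=
  (quadraticSymbol Q z : ℂ) - a

theorem contDiff_shiftedSymbol (Q : Matrix (Fin 2) (Fin 2) ℝ) (a : ℝ) :
    ContDiff ℝ (⊤ : ℕ∞) (shiftedSymbol Q a) :=
  (Complex.ofRealCLM.contDiff.comp (contDiff_quadraticSymbol Q)).sub contDiff_const

theorem fderiv_shiftedSymbol {Q : Matrix (Fin 2) (Fin 2) ℝ} (hQ : Q.IsSymm) (a : ℝ) :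
    fderiv ℝ (shiftedSymbol Q a) = symbolHess Q := by
  funext z
  exact ((hasFDerivAt_quadraticSymbol hQ z).sub_const (a : ℂ)).fderiv

theorem pderiv_shiftedSymbol {Q : Matrix (Fin 2) (Fin 2) ℝ} (hQ : Q.IsSymm) (a : ℝ) (i : Fin 2) :
    pderiv i (shiftedSymbol Q a) = symbolGrad Q i := by
  rw [← pderiv_quadraticSymbol hQ]
  funext z
  rw [pderiv, pderiv, fderiv_shiftedSymbol hQ, (hasFDerivAt_quadraticSymbol hQ z).fderiv]

/-- The third derivative of a quadratic function is zero; the Moyal product with A - a therefore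
stops at ħ², which is the shape of `starShifted`. -/
theorem bracket_shiftedSymbol_of_three_le {Q : Matrix (Fin 2) (Fin 2) ℝ} (hQ : Q.IsSymm) (a : ℝ)
    (k : ℕ) (D : PhaseSpace → ℂ) : bracket (k + 3) (shiftedSymbol Q a) D = 0 := by
  have h : fderiv ℝ (fderiv ℝ (fderiv ℝ (shiftedSymbol Q a))) = 0 := by
    rw [fderiv_shiftedSymbol hQ]
    have : fderiv ℝ (symbolHess Q) = fun _ => symbolHess Q := by
      funext z; exact (symbolHess Q).fderiv
    rw [this]
    funext z
    exact fderiv_const_apply _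
  have h2 (z : PhaseSpace) : iteratedFDeriv ℝ (k + 3) (shiftedSymbol Q a) z = 0 := by
    -- Three derivatives are peeled off under the norm, which avoids handling the currying
    -- isomorphisms.
    rw [← norm_eq_zero, show k + 3 = (k + 2) + 1 from rfl, ← norm_iteratedFDeriv_fderiv,
      ← norm_iteratedFDeriv_fderiv, ← norm_iteratedFDeriv_fderiv, h, norm_eq_zero]
    exact congrFun iteratedFDeriv_fun_zero z
  funext z
  simp [bracket, partialDeriv, h2]

/-- `{A, C}₁`. -/
def poissonBracket (Q : Matrix (Fin 2) (Fin 2) ℝ) (C : PhaseSpace → ℂ) : PhaseSpace → ℂ :=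
  symbolGrad Q 0 * pderiv 1 C - symbolGrad Q 1 * pderiv 0 C

/-- `{A, C}₂`. -/
def secondBracket (Q : Matrix (Fin 2) (Fin 2) ℝ) (C : PhaseSpace → ℂ) : PhaseSpace → ℂ :=
  (fun _ : PhaseSpace => (Q 0 0 : ℂ)) * pderiv 1 (pderiv 1 C) - (fun _ : PhaseSpace => (Q 0 1 : ℂ)) * pderiv 1 (pderiv 0 C) -
    (fun _ : PhaseSpace => (Q 0 1 : ℂ)) * pderiv 0 (pderiv 1 C) + (fun _ : PhaseSpace => (Q 1 1 : ℂ)) * pderiv 0 (pderiv 0 C)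

/-- The coefficients of `(A - a) ⋆ C`. -/
def starShifted (Q : Matrix (Fin 2) (Fin 2) ℝ) (a : ℝ) (c : ℕ → PhaseSpace → ℂ) :
    ℕ → PhaseSpace → ℂ
  | 0 => shiftedSymbol Q a * c 0
  | 1 => shiftedSymbol Q a * c 1 + (fun _ : PhaseSpace => (Complex.I / 2 : ℂ)) * poissonBracket Q (c 0)
  | n + 2 => shiftedSymbol Q a * c (n + 2) +
      (fun _ : PhaseSpace => (Complex.I / 2 : ℂ)) * poissonBracket Q (c (n + 1)) +
      (fun _ : PhaseSpace => (-(1 / 8) : ℂ)) * secondBracket Q (c n)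

theorem coeff_moyal_C (q : PhaseSpace → ℂ) (C : FormalSymbol) (n : ℕ) :
    PowerSeries.coeff n (moyal (PowerSeries.C q) C) = ∑ k ∈ Finset.range (n + 1),
      ((1 / (k.factorial : ℂ)) * (Complex.I / 2) ^ k) •
        bracket k q (PowerSeries.coeff (n - k) C) := by
  have h0 (k : ℕ) (D : PhaseSpace → ℂ) : bracket k 0 D = 0 := by
    funext z
    have h2 : iteratedFDeriv ℝ k (0 : PhaseSpace → ℂ) z = 0 := congrFun iteratedFDeriv_fun_zero z
    simp [bracket, partialDeriv, h2]
  rw [moyal, PowerSeries.coeff_mk]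
  refine Finset.sum_congr rfl fun k _ => ?_
  rw [Finset.sum_eq_single_of_mem (0, n - k)]
  · simp
  · simp [Finset.HasAntidiagonal.mem_antidiagonal]
  · rintro ⟨i, j⟩ hij hne
    rw [Finset.HasAntidiagonal.mem_antidiagonal] at hij
    have hi : i ≠ 0 := by
      rintro rfl
      exact hne (by simpa using hij)
    simp only [PowerSeries.coeff_C, if_neg hi, h0, smul_zero]

theorem coeff_moyal_shiftedSymbol {Q : Matrix (Fin 2) (Fin 2) ℝ} (hQ : Q.IsSymm) (a : ℝ)
    {C : FormalSymbol} (hC : IsSmoothSymbol C) (n : ℕ) :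
    PowerSeries.coeff n (moyal (PowerSeries.C (shiftedSymbol Q a)) C) =
      starShifted Q a (fun n => PowerSeries.coeff n C) n := by
  have hs : Q 1 0 = Q 0 1 := hQ.apply 0 1
  have h1 (D : PhaseSpace → ℂ) : bracket 1 (shiftedSymbol Q a) D = poissonBracket Q D := by
    funext z
    rw [bracket_one, pderiv_shiftedSymbol hQ, pderiv_shiftedSymbol hQ]; rfl
  have h2 (n : ℕ) : bracket 2 (shiftedSymbol Q a) (PowerSeries.coeff n C) =
      secondBracket Q (PowerSeries.coeff n C) := by
    funext z
    rw [bracket_two (contDiff_shiftedSymbol Q a) (hC n)]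
    simp only [pderiv_shiftedSymbol hQ, pderiv_symbolGrad, secondBracket, hs]
    rfl
  rw [coeff_moyal_C]
  rcases n with - | - | n
  · simp [starShifted, bracket_zero]
  · rw [Finset.sum_range_succ, Finset.sum_range_one, bracket_zero, h1]
    funext z
    simp [starShifted]
  · rw [Finset.sum_range_succ', Finset.sum_range_succ', Finset.sum_range_succ', bracket_zero,
      h1, h2, Finset.sum_eq_zero]
    · funext z
      simp [starShifted, div_pow]
      ring
    · intro k _
      rw [bracket_shiftedSymbol_of_three_le hQ, smul_zero]

theorem starShifted_sub {Q : Matrix (Fin 2) (Fin 2) ℝ} (a : ℝ) {c d : ℕ → PhaseSpace → ℂ}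
    (hc : ∀ n, ContDiff ℝ (⊤ : ℕ∞) (c n)) (hd : ∀ n, ContDiff ℝ (⊤ : ℕ∞) (d n)) (n : ℕ) :
    starShifted Q a (fun n => c n - d n) n = starShifted Q a c n - starShifted Q a d n := by
  have h1 (n : ℕ) : poissonBracket Q (c n - d n) =
      poissonBracket Q (c n) - poissonBracket Q (d n) := by
    simp only [poissonBracket, pderiv_sub (hc n) (hd n)]; ring
  have h2 (n : ℕ) : secondBracket Q (c n - d n) =
      secondBracket Q (c n) - secondBracket Q (d n) := by
    simp only [secondBracket, pderiv_sub (hc n) (hd n),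
      pderiv_sub (contDiff_pderiv (hc n) _) (contDiff_pderiv (hd n) _)]
    ring
  rcases n with - | - | n <;> simp only [starShifted, h1, h2] <;> ring

/-- The gradients of A and of s(A) are parallel. -/
theorem poissonBracket_comp {Q : Matrix (Fin 2) (Fin 2) ℝ} (hQ : Q.IsSymm)
    {s s' : ℝ → ℂ} (hs : ∀ a, HasDerivAt s (s' a) a) :
    poissonBracket Q (fun z => s (quadraticSymbol Q z)) = 0 := by
  rw [poissonBracket, pderiv_comp_quadraticSymbol hQ hs, pderiv_comp_quadraticSymbol hQ hs]
  ring

/-- The Hessian of s(A) is s'(A) Q + s''(A) dA ⊗ dA. Contracted with the cofactor matrix of Q, the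
first term gives 2 det Q, and the second gives det Q · zᵀQz = 2 det Q · A. -/
theorem secondBracket_comp {Q : Matrix (Fin 2) (Fin 2) ℝ} (hQ : Q.IsSymm)
    {s s' s'' : ℝ → ℂ} (hs' : ContDiff ℝ (⊤ : ℕ∞) s') (h1 : ∀ a, HasDerivAt s (s' a) a)
    (h2 : ∀ a, HasDerivAt s' (s'' a) a) (z : PhaseSpace) :
    secondBracket Q (fun z => s (quadraticSymbol Q z)) z =
      2 * Q.det * (s' (quadraticSymbol Q z) + quadraticSymbol Q z * s'' (quadraticSymbol Q z)) := by
  have hs : Q 1 0 = Q 0 1 := hQ.apply 0 1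
  have hc : ContDiff ℝ (⊤ : ℕ∞) (fun z => s' (quadraticSymbol Q z)) :=
    hs'.comp (contDiff_quadraticSymbol Q)
  simp only [secondBracket, pderiv_comp_quadraticSymbol hQ h1,
    pderiv_mul hc (contDiff_symbolGrad Q _), pderiv_comp_quadraticSymbol hQ h2, pderiv_symbolGrad]
  simp only [Pi.add_apply, Pi.sub_apply, Pi.mul_apply, symbolGrad, det_eq hQ, hs]
  rw [quadraticSymbol_eq hQ]
  push_cast
  ring

/-! ### Order of vanishing at a point -/

/-- `C` is smooth and vanishes to order `m` at `z₀`. -/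
def VanishesAt (z₀ : PhaseSpace) : ℕ → (PhaseSpace → ℂ) → Prop
  | 0, C => ContDiff ℝ (⊤ : ℕ∞) C
  | m + 1, C => ContDiff ℝ (⊤ : ℕ∞) C ∧ C z₀ = 0 ∧ ∀ i, VanishesAt z₀ m (pderiv i C)

namespace VanishesAt

variable {z₀ : PhaseSpace} {m n : ℕ} {C D g : PhaseSpace → ℂ}

theorem of_succ (h : VanishesAt z₀ (m + 1) C) : VanishesAt z₀ m C := by
  induction m generalizing C with
  | zero => exact h.1
  | succ m ih => exact ⟨h.1, h.2.1, fun i => ih (h.2.2 i)⟩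

theorem mono (h : VanishesAt z₀ m C) (hn : n ≤ m) : VanishesAt z₀ n C := by
  induction m with
  | zero => rwa [Nat.le_zero.1 hn]
  | succ m ih =>
    rcases hn.eq_or_lt with rfl | hn
    · exact h
    · exact ih h.of_succ (Nat.lt_succ_iff.1 hn)

theorem pderiv (h : VanishesAt z₀ m C) (i : Fin 2) :
    VanishesAt z₀ (m - 1) (QuadSymbol.pderiv i C) := by
  cases m with
  | zero => exact contDiff_pderiv h i
  | succ m => exact h.2.2 i

theorem add (hC : VanishesAt z₀ m C) (hD : VanishesAt z₀ m D) : VanishesAt z₀ m (C + D) := by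
  induction m generalizing C D with
  | zero => exact ContDiff.add hC hD
  | succ m ih =>
    refine ⟨hC.1.add hD.1, by simp [hC.2.1, hD.2.1], fun i => ?_⟩
    rw [pderiv_add hC.1 hD.1]
    exact ih (hC.2.2 i) (hD.2.2 i)

theorem mul_left (hg : ContDiff ℝ (⊤ : ℕ∞) g) (hC : VanishesAt z₀ m C) :
    VanishesAt z₀ m (g * C) := by
  induction m generalizing C g with
  | zero => exact ContDiff.mul hg hC
  | succ m ih =>
    refine ⟨hg.mul hC.1, by simp [hC.2.1], fun i => ?_⟩
    rw [pderiv_mul hg hC.1]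
    exact (ih (contDiff_pderiv hg i) hC.of_succ).add (ih hg (hC.2.2 i))

theorem sub (hC : VanishesAt z₀ m C) (hD : VanishesAt z₀ m D) : VanishesAt z₀ m (C - D) := by
  have h : C - D = C + (fun _ => -1) * D := by funext z; simp [sub_eq_add_neg]
  rw [h]
  exact hC.add (mul_left contDiff_const hD)

theorem mul_left_of_eq_zero (hg : ContDiff ℝ (⊤ : ℕ∞) g) (h0 : g z₀ = 0)
    (hC : VanishesAt z₀ m C) : VanishesAt z₀ (m + 1) (g * C) := by
  induction m generalizing C with
  | zero =>
    exact ⟨ContDiff.mul hg hC, by simp [h0], fun i => contDiff_pderiv (ContDiff.mul hg hC) i⟩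
  | succ m ih =>
    refine ⟨hg.mul hC.1, by simp [h0], fun i => ?_⟩
    rw [pderiv_mul hg hC.1]
    exact (mul_left (contDiff_pderiv hg i) hC).add (ih (hC.2.2 i))

theorem poissonBracket (Q : Matrix (Fin 2) (Fin 2) ℝ) (hC : VanishesAt z₀ m C) :
    VanishesAt z₀ (m - 1) (QuadSymbol.poissonBracket Q C) :=
  (mul_left (contDiff_symbolGrad Q 0) (hC.pderiv 1)).sub
    (mul_left (contDiff_symbolGrad Q 1) (hC.pderiv 0))

theorem secondBracket (Q : Matrix (Fin 2) (Fin 2) ℝ) (hC : VanishesAt z₀ m C) :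
    VanishesAt z₀ (m - 2) (QuadSymbol.secondBracket Q C) :=
  (((mul_left contDiff_const ((hC.pderiv 1).pderiv 1)).sub
    (mul_left contDiff_const ((hC.pderiv 0).pderiv 1))).sub
    (mul_left contDiff_const ((hC.pderiv 1).pderiv 0))).add
    (mul_left contDiff_const ((hC.pderiv 0).pderiv 0))

end VanishesAt

/-- In the coefficient of ħⁿ, the factor A - a adds one order to M - 2n. The first bracket loses one
order but starts from index n - 1, which has two more; the second loses two and starts from four
more. Each term thus reaches at least M + 1 - 2n. The subtraction is truncated at 0, where only
smoothness is claimed. -/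
theorem vanishesAt_starShifted (Q : Matrix (Fin 2) (Fin 2) ℝ) (z₀ : PhaseSpace) (M : ℕ)
    {c : ℕ → PhaseSpace → ℂ} (hc : ∀ n, VanishesAt z₀ (M - 2 * n) (c n)) (n : ℕ) :
    VanishesAt z₀ (M + 1 - 2 * n) (starShifted Q (quadraticSymbol Q z₀) c n) := by
  have h0 : shiftedSymbol Q (quadraticSymbol Q z₀) z₀ = 0 := by simp [shiftedSymbol]
  have h1 (n : ℕ) : VanishesAt z₀ (M + 1 - 2 * n)
      (shiftedSymbol Q (quadraticSymbol Q z₀) * c n) :=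
    (VanishesAt.mul_left_of_eq_zero (contDiff_shiftedSymbol Q _) h0 (hc n)).mono (by omega)
  have h2 (n : ℕ) : VanishesAt z₀ (M + 1 - 2 * (n + 1))
      ((fun _ : PhaseSpace => (Complex.I / 2 : ℂ)) * poissonBracket Q (c n)) :=
    (VanishesAt.mul_left contDiff_const ((hc n).poissonBracket Q)).mono (by omega)
  have h3 (n : ℕ) : VanishesAt z₀ (M + 1 - 2 * (n + 2))
      ((fun _ : PhaseSpace => (-(1 / 8) : ℂ)) * secondBracket Q (c n)) :=
    (VanishesAt.mul_left contDiff_const ((hc n).secondBracket Q)).mono (by omega)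
  rcases n with - | - | n
  · exact h1 0
  · exact (h1 1).add (h2 0)
  · exact ((h1 (n + 2)).add (h2 (n + 1))).add (h3 n)

/-! ### The formal symbol of `f(Â)` -/

/-- The two second-order computations meet here: -1/8 times the bracket 2 det Q (G' + A G'') equals
-ω²/4 times (G' + A G''). -/
theorem coeff_secExpFormula_sub_mul {Q : Matrix (Fin 2) (Fin 2) ℝ} (hQ : Q.IsSymm) {ω : ℂ}
    (hω : ω ^ 2 = (Q.det : ℂ)) (a : ℝ) {f : ℝ → ℂ} (hf : ContDiff ℝ (⊤ : ℕ∞) f) (n : ℕ) :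
    PowerSeries.coeff n (secExpFormula ω (quadraticSymbol Q) fun y => ((y : ℂ) - a) * f y) =
      starShifted Q a
        (fun n => PowerSeries.coeff n (secExpFormula ω (quadraticSymbol Q) f)) n := by
  have hy : ContDiff ℝ (⊤ : ℕ∞) fun y : ℝ => (y : ℂ) * f y := Complex.ofRealCLM.contDiff.mul hf
  have he : (fun y : ℝ => ((y : ℂ) - a) * f y) =
      (fun y : ℝ => (y : ℂ) * f y) + fun y => (-a : ℂ) * f y := by
    funext y; simp only [Pi.add_apply]; ring
  have hF (n : ℕ) (f : ℝ → ℂ) : PowerSeries.coeff n (secExpFormula ω (quadraticSymbol Q) f) =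
      fun z => expOp ω n (secArg ω) f (quadraticSymbol Q z) :=
    funext fun z => coeff_secExpFormula ω _ f n z
  have hp (n : ℕ) := poissonBracket_comp hQ (hasDerivAt_expOp ω n (secArg ω) hf)
  have hs (n : ℕ) := secondBracket_comp hQ (contDiff_expOp ω n (secArg ω * tanArg ω) hf)
    (hasDerivAt_expOp ω n (secArg ω) hf) (hasDerivAt_expOp ω n _ hf)
  rw [he]
  simp only [hF]
  funext z
  rw [expOp_add ω n _ hy (contDiff_const.mul hf), expOp_const_mul]
  rcases n with - | - | n
  · rw [expOp_secArg_coord_mul_of_lt_two ω (by norm_num) hf]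
    simp only [starShifted, Pi.mul_apply, shiftedSymbol]; ring
  · rw [expOp_secArg_coord_mul_of_lt_two ω (by norm_num) hf]
    simp only [starShifted, Pi.mul_apply, Pi.add_apply, shiftedSymbol, hp, Pi.zero_apply]; ring
  · rw [expOp_secArg_coord_mul ω n hf]
    simp only [starShifted, Pi.mul_apply, Pi.add_apply, shiftedSymbol, hp, hs, Pi.zero_apply, hω]
    ring

theorem isSmoothSymbol_secExpFormula (ω : ℂ) (Q : Matrix (Fin 2) (Fin 2) ℝ) {f : ℝ → ℂ}
    (hf : ContDiff ℝ (⊤ : ℕ∞) f) : IsSmoothSymbol (secExpFormula ω (quadraticSymbol Q) f) := by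
  intro n
  rw [show PowerSeries.coeff n (secExpFormula ω (quadraticSymbol Q) f) =
      fun z => expOp ω n (secArg ω) f (quadraticSymbol Q z) from
    funext fun z => coeff_secExpFormula ω _ f n z]
  exact (contDiff_expOp ω n _ hf).comp (contDiff_quadraticSymbol Q)

theorem IsFunctionalCalculus.eq_secExpFormula {Q : Matrix (Fin 2) (Fin 2) ℝ} (hQ : Q.IsSymm)
    {ω : ℂ} (hω : ω ^ 2 = (Q.det : ℂ)) {𝒜 : Subalgebra ℂ (ℝ → ℂ)} {Φ : 𝒜 →ₗ[ℂ] FormalSymbol}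
    (h𝒜 : IsSmoothFunctionAlgebra 𝒜) (hΦ : IsFunctionalCalculus 𝒜 (quadraticSymbol Q) Φ)
    (f : 𝒜) : Φ f = secExpFormula ω (quadraticSymbol Q) f := by
  refine PowerSeries.ext fun n => funext fun z₀ => ?_
  have key (M : ℕ) : ∀ (f : 𝒜) (n : ℕ), VanishesAt z₀ (M - 2 * n)
      (PowerSeries.coeff n (Φ f) -
        PowerSeries.coeff n (secExpFormula ω (quadraticSymbol Q) f)) := by
    induction M with
    | zero =>
      intro f n
      rw [Nat.zero_sub]
      exact (hΦ.smooth f n).sub (isSmoothSymbol_secExpFormula ω Q (h𝒜.contDiff f f.2) n)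
    | succ M ih =>
      intro f n
      -- The base point of the quotient is the value A(z₀), so that the symbol A - a vanishes at z₀.
      -- The induction is on M for all f at once, because f is replaced by its quotient g.
      obtain ⟨g, hg, hfg⟩ := h𝒜.exists_quotient f f.2 (quadraticSymbol Q z₀)
      set a := quadraticSymbol Q z₀ with ha
      have hgs := h𝒜.contDiff g hg
      let y : 𝒜 := ⟨_, h𝒜.coord_mem⟩
      let g' : 𝒜 := ⟨g, hg⟩
      have hf : f = (f : ℝ → ℂ) a • (1 : 𝒜) + (y - (a : ℂ) • (1 : 𝒜)) * g' := by
        ext x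
        simp [y, g', hfg x]
      have hy : Φ (y - (a : ℂ) • (1 : 𝒜)) = PowerSeries.C (shiftedSymbol Q a) := by
        rw [map_sub, map_smul, hΦ.map_one, hΦ.map_coord y fun _ => rfl]
        refine PowerSeries.ext fun n => ?_
        rw [map_sub, PowerSeries.coeff_smul, PowerSeries.coeff_C, PowerSeries.coeff_C,
          PowerSeries.coeff_one]
        split_ifs
        · funext z; simp [shiftedSymbol]
        · simp
      have h1 : PowerSeries.coeff n (Φ f) = (f : ℝ → ℂ) a • PowerSeries.coeff n (1 : FormalSymbol) +
          starShifted Q a (fun n => PowerSeries.coeff n (Φ g')) n := by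
        conv_lhs => rw [hf]
        rw [map_add, map_smul, hΦ.map_one, hΦ.map_mul, hy, map_add, PowerSeries.coeff_smul,
          coeff_moyal_shiftedSymbol hQ a (hΦ.smooth g')]
      have h2 : PowerSeries.coeff n (secExpFormula ω (quadraticSymbol Q) f) =
          (f : ℝ → ℂ) a • PowerSeries.coeff n (1 : FormalSymbol) + starShifted Q a
            (fun n => PowerSeries.coeff n (secExpFormula ω (quadraticSymbol Q) g)) n := by
        rw [← coeff_secExpFormula_sub_mul hQ hω a hgs]
        have hfe : (f : ℝ → ℂ) = (fun _ => (f : ℝ → ℂ) a * 1) + fun y : ℝ => ((y : ℂ) - a) * g y := by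
          funext x
          simp [hfg x]
        have hgs' : ContDiff ℝ (⊤ : ℕ∞) fun y : ℝ => ((y : ℂ) - a) * g y :=
          (Complex.ofRealCLM.contDiff.sub contDiff_const).mul hgs
        funext z
        rw [Pi.add_apply, coeff_secExpFormula, coeff_secExpFormula]
        conv_lhs => rw [hfe]
        rw [expOp_add ω n _ contDiff_const hgs', expOp_const_mul, expOp_secArg_one,
          PowerSeries.coeff_one]
        congr 1
        split_ifs <;> simp
      rw [h1, h2, add_sub_add_left_eq_sub, ← starShifted_sub a (hΦ.smooth g')
        (isSmoothSymbol_secExpFormula ω Q hgs)]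
      exact vanishesAt_starShifted Q z₀ M (ih g') n
  -- This is the least M for which vanishing to order M - 2n includes the value at z₀.
  have := (key (2 * n + 1) f n)
  rw [show 2 * n + 1 - 2 * n = 0 + 1 by omega] at this
  exact sub_eq_zero.1 this.2.1

/-! ### Weyl operators for a number ħ > 0. -/

open MeasureTheory Filter Topology Set

/-! ### Position and momentum on Schwartz functions -/

/-- Multiplication by the coordinate. -/
def opX : 𝓢(ℝ, ℂ) →ₗ[ℂ] 𝓢(ℝ, ℂ) := SchwartzMap.smulLeftCLM ℂ (Complex.ofReal)

/-- `-iħ d/dx`. -/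
def opP (h : ℝ) : 𝓢(ℝ, ℂ) →ₗ[ℂ] 𝓢(ℝ, ℂ) :=
  (-Complex.I * h) • (SchwartzMap.derivCLM ℂ ℂ : 𝓢(ℝ, ℂ) →ₗ[ℂ] 𝓢(ℝ, ℂ))

theorem opX_apply (φ : 𝓢(ℝ, ℂ)) (x : ℝ) : opX φ x = x * φ x :=
  SchwartzMap.smulLeftCLM_apply_apply (F := ℂ) Function.Complex.hasTemperateGrowth_ofReal φ x

theorem opP_apply (h : ℝ) (φ : 𝓢(ℝ, ℂ)) (x : ℝ) : opP h φ x = -Complex.I * h * deriv φ x := rfl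

theorem exists_norm_le (φ : 𝓢(ℝ, ℂ)) : ∃ M, ∀ x, ‖φ x‖ ≤ M :=
  ⟨_, SchwartzMap.norm_le_seminorm ℝ φ⟩

theorem exists_norm_le_div (φ : 𝓢(ℝ, ℂ)) : ∃ C, 0 ≤ C ∧ ∀ x, ‖φ x‖ ≤ C / (1 + x ^ 2) := by
  obtain ⟨M, hM⟩ := exists_norm_le φ
  obtain ⟨N, hN⟩ := exists_norm_le (opX (opX φ))
  refine ⟨M + N, add_nonneg ((norm_nonneg _).trans (hM 0)) ((norm_nonneg _).trans (hN 0)),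
    fun x => ?_⟩
  rw [le_div_iff₀ (by positivity)]
  have := hN x
  rw [opX_apply, opX_apply, norm_mul, norm_mul, Complex.norm_real, Real.norm_eq_abs, ← mul_assoc,
    abs_mul_abs_self] at this
  nlinarith [hM x]

/-! ### The integrand of the Wigner function -/

/-- The integrand of the Wigner function. -/
def wignerIntegrand (h x p : ℝ) (φ ψ : ℝ → ℂ) (s : ℝ) : ℂ :=
  Complex.exp (-(Complex.I * s * p / h)) * φ (x + s / 2) * (starRingEnd ℂ) (ψ (x - s / 2))

theorem wigner_eq (h : ℝ) (φ ψ : 𝓢(ℝ, ℂ)) (z : PhaseSpace) :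
    wigner h φ ψ z =
      (1 / (2 * Real.pi * h) : ℂ) * ∫ s, wignerIntegrand h (z 0) (z 1) φ ψ s := rfl

theorem norm_exp_phase (h p s : ℝ) : ‖Complex.exp (-(Complex.I * s * p / h))‖ = 1 := by
  rw [show -(Complex.I * s * p / h) = ((-(s * p / h) : ℝ) : ℂ) * Complex.I by push_cast; ring]
  exact Complex.norm_exp_ofReal_mul_I _

theorem norm_wignerIntegrand (h x p : ℝ) (φ ψ : ℝ → ℂ) (s : ℝ) :
    ‖wignerIntegrand h x p φ ψ s‖ = ‖φ (x + s / 2)‖ * ‖ψ (x - s / 2)‖ := by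
  rw [wignerIntegrand, norm_mul, norm_mul, norm_exp_phase, one_mul, RCLike.norm_conj]

theorem continuous_wignerIntegrand (h : ℝ) {φ ψ : ℝ → ℂ} (hφ : Continuous φ) (hψ : Continuous ψ) :
    Continuous fun q : ℝ × ℝ × ℝ => wignerIntegrand h q.1 q.2.1 φ ψ q.2.2 := by
  unfold wignerIntegrand
  refine ((Complex.continuous_exp.comp ?_).mul (hφ.comp ?_)).mul
    (Complex.continuous_conj.comp (hψ.comp ?_)) <;> fun_prop

theorem continuous_wignerIntegrand_right (h x p : ℝ) {φ ψ : ℝ → ℂ} (hφ : Continuous φ)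
    (hψ : Continuous ψ) : Continuous (wignerIntegrand h x p φ ψ) :=
  (continuous_wignerIntegrand h hφ hψ).comp
    (g := fun q : ℝ × ℝ × ℝ => wignerIntegrand h q.1 q.2.1 φ ψ q.2.2)
    (f := fun s => (x, p, s)) (by fun_prop)

theorem integrable_comp_sub_half (f : ℝ → ℝ) (hf : Integrable f) (x : ℝ) :
    Integrable fun s => f (x - s / 2) := by
  have h1 : Integrable fun s => f (s - (-x)) := hf.comp_sub_right (-x)
  have h2 := h1.comp_mul_right' (R := -(1 / 2)) (by norm_num)
  refine h2.congr (Filter.Eventually.of_forall fun s => ?_)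
  simp only
  congr 1
  ring

theorem integral_comp_sub_half (f : ℝ → ℝ) (x : ℝ) :
    ∫ s, f (x - s / 2) = 2 * ∫ s, f s := by
  have h1 := Measure.integral_comp_mul_right (fun s => f (s + x)) (-(1 / 2))
  have h2 : ∀ s, s * -(1 / 2) + x = x - s / 2 := fun s => by ring
  simp only [h2] at h1
  rw [h1, integral_add_right_eq_self]
  norm_num

theorem integrable_wignerIntegrand (h x p : ℝ) (φ ψ : 𝓢(ℝ, ℂ)) :
    Integrable (wignerIntegrand h x p φ ψ) := by
  obtain ⟨M, hM⟩ := exists_norm_le φ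
  refine ((integrable_comp_sub_half (fun y => ‖ψ y‖) ψ.integrable.norm x).const_mul M).mono'
    (continuous_wignerIntegrand_right h x p φ.continuous ψ.continuous).aestronglyMeasurable
    (Filter.Eventually.of_forall fun s => ?_)
  rw [norm_wignerIntegrand]
  exact mul_le_mul_of_nonneg_right (hM _) (norm_nonneg _)

theorem norm_wigner_le {h : ℝ} (hh : 0 < h) (ψ : 𝓢(ℝ, ℂ)) : ∃ C, 0 ≤ C ∧
    ∀ (φ : 𝓢(ℝ, ℂ)) (M : ℝ), (∀ x, ‖φ x‖ ≤ M) → ∀ z, ‖wigner h φ ψ z‖ ≤ C * M := by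
  refine ⟨1 / (2 * Real.pi * h) * (2 * ∫ s, ‖ψ s‖), by positivity, fun φ M hM z => ?_⟩
  rw [wigner_eq, norm_mul]
  have h1 : ‖(1 / (2 * Real.pi * h) : ℂ)‖ = 1 / (2 * Real.pi * h) := by
    rw [show (1 / (2 * Real.pi * h) : ℂ) = ((1 / (2 * Real.pi * h) : ℝ) : ℂ) by push_cast; rfl,
      Complex.norm_real, Real.norm_of_nonneg (by positivity)]
  rw [h1, mul_assoc (1 / (2 * Real.pi * h))]
  refine mul_le_mul_of_nonneg_left ?_ (by positivity)
  rw [← integral_comp_sub_half (fun y => ‖ψ y‖) (z 0), ← integral_mul_const]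
  refine norm_integral_le_of_norm_le
    ((integrable_comp_sub_half (fun y => ‖ψ y‖) ψ.integrable.norm (z 0)).mul_const M)
    (Filter.Eventually.of_forall fun s => ?_)
  rw [norm_wignerIntegrand, mul_comm]
  exact mul_le_mul_of_nonneg_left (hM _) (norm_nonneg _)

theorem wigner_add_left (h : ℝ) (φ φ' ψ : 𝓢(ℝ, ℂ)) (z : PhaseSpace) :
    wigner h (φ + φ') ψ z = wigner h φ ψ z + wigner h φ' ψ z := by
  simp only [wigner_eq]
  rw [← mul_add, ← integral_add (integrable_wignerIntegrand ..) (integrable_wignerIntegrand ..)]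
  congr 1
  refine integral_congr_ae (Filter.Eventually.of_forall fun s => ?_)
  simp only [wignerIntegrand, add_apply]; ring

theorem wigner_smul_left (h : ℝ) (c : ℂ) (φ ψ : 𝓢(ℝ, ℂ)) (z : PhaseSpace) :
    wigner h (c • φ) ψ z = c * wigner h φ ψ z := by
  simp only [wigner_eq]
  rw [mul_left_comm c, ← integral_const_mul c]
  congr 1
  refine integral_congr_ae (Filter.Eventually.of_forall fun s => ?_)
  simp only [wignerIntegrand, smul_apply, smul_eq_mul]; ring

/-! ### Position and momentum act on Wigner functions -/

theorem coord_zero_mul_wigner (h : ℝ) (φ ψ : 𝓢(ℝ, ℂ)) (z : PhaseSpace) :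
    (z 0 : ℂ) * wigner h φ ψ z = (wigner h (opX φ) ψ z + wigner h φ (opX ψ) z) / 2 := by
  simp only [wigner_eq]
  rw [← mul_add, ← integral_add (integrable_wignerIntegrand ..) (integrable_wignerIntegrand ..),
    mul_left_comm, mul_div_assoc, ← integral_const_mul, ← integral_div]
  congr 1
  refine integral_congr_ae (Filter.Eventually.of_forall fun s => ?_)
  simp only [wignerIntegrand, opX_apply, map_mul, Complex.conj_ofReal]
  push_cast; ring

theorem hasDerivAt_exp_phase (h p s : ℝ) :
    HasDerivAt (fun s : ℝ => Complex.exp (-(Complex.I * s * p / h)))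
      (-(Complex.I * p / h) * Complex.exp (-(Complex.I * s * p / h))) s := by
  have h1 : HasDerivAt (fun s : ℝ => -(Complex.I * s * p / h)) (-(Complex.I * 1 * p / h)) s :=
    (((Complex.ofRealCLM.hasDerivAt.const_mul _).mul_const _).div_const _).fun_neg
  convert h1.cexp using 1
  ring

theorem hasDerivAt_conj_comp {f : ℝ → ℂ} {f' : ℂ} {x : ℝ} (hf : HasDerivAt f f' x) :
    HasDerivAt (fun x => (starRingEnd ℂ) (f x)) ((starRingEnd ℂ) f') x :=
  (Complex.conjCLE.hasFDerivAt (x := f x)).comp_hasDerivAt x hf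

/-- The factor p comes from the s-derivative of the phase; integration by parts in s moves that
derivative to φ(x + s/2) and to the conjugate of ψ(x - s/2), with half weights. -/
theorem coord_one_mul_wigner {h : ℝ} (hh : 0 < h) (φ ψ : 𝓢(ℝ, ℂ)) (z : PhaseSpace) :
    (z 1 : ℂ) * wigner h φ ψ z = (wigner h (opP h φ) ψ z + wigner h φ (opP h ψ) z) / 2 := by
  set x := z 0 with hx
  set p := z 1 with hp
  have hhc : (h : ℂ) ≠ 0 := by exact_mod_cast hh.ne'
  let F : ℝ → ℂ := fun s => φ (x + s / 2) * (starRingEnd ℂ) (ψ (x - s / 2))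
  let F' : ℝ → ℂ := fun s => deriv φ (x + s / 2) * (1 / 2) * (starRingEnd ℂ) (ψ (x - s / 2)) +
    φ (x + s / 2) * (starRingEnd ℂ) (deriv ψ (x - s / 2) * (-(1 / 2)))
  have hF (s : ℝ) : HasDerivAt F (F' s) s := by
    have h1 : HasDerivAt (fun s : ℝ => x + s / 2) (1 / 2) s :=
      ((hasDerivAt_id s).div_const 2).const_add x
    have h2 : HasDerivAt (fun s : ℝ => x - s / 2) (-(1 / 2)) s :=
      ((hasDerivAt_id s).div_const 2).const_sub x
    have h3 := (φ.hasDerivAt (x + s / 2)).scomp s h1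
    have h4 := (ψ.hasDerivAt (x - s / 2)).scomp s h2
    refine (h3.fun_mul (hasDerivAt_conj_comp h4)).congr_deriv ?_
    simp [F', mul_comm]
  have hI (φ ψ : 𝓢(ℝ, ℂ)) := integrable_wignerIntegrand h x p φ ψ
  have e1 (s : ℝ) : Complex.exp (-(Complex.I * s * p / h)) * F' s = (Complex.I / (2 * h)) *
      (wignerIntegrand h x p (opP h φ) ψ s + wignerIntegrand h x p φ (opP h ψ) s) := by
    simp only [wignerIntegrand, opP_apply, F', map_mul, map_neg, Complex.conj_I,
      Complex.conj_ofReal, map_div₀, map_one, map_ofNat]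
    have hk : Complex.I / (2 * h) * (Complex.I * h) = -1 / 2 := by
      field_simp; exact Complex.I_sq
    linear_combination (deriv φ (x + s / 2) * (starRingEnd ℂ) (ψ (x - s / 2)) -
      φ (x + s / 2) * (starRingEnd ℂ) (deriv ψ (x - s / 2))) *
      Complex.exp (-(Complex.I * s * p / h)) * hk
  have e2 (s : ℝ) : -(Complex.I * p / h) * Complex.exp (-(Complex.I * s * p / h)) * F s =
      -(Complex.I * p / h) * wignerIntegrand h x p φ ψ s := by
    simp only [wignerIntegrand, F]; ring
  have key := integral_mul_deriv_eq_deriv_mul_of_integrable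
    (u := fun s : ℝ => Complex.exp (-(Complex.I * s * p / h))) (v := F) (v' := F')
    (fun s _ => hasDerivAt_exp_phase h p s) (fun s _ => hF s)
    ((((hI (opP h φ) ψ).add (hI φ (opP h ψ))).const_mul (Complex.I / (2 * h))).congr
      (Filter.Eventually.of_forall fun s => (e1 s).symm))
    (((hI φ ψ).const_mul (-(Complex.I * p / h))).congr
      (Filter.Eventually.of_forall fun s => (e2 s).symm))
    ((hI φ ψ).congr (Filter.Eventually.of_forall fun s => by
      simp only [wignerIntegrand, F, Pi.mul_apply]; ring))
  simp only [e1, e2] at key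
  rw [integral_const_mul, integral_const_mul, integral_add (hI _ _) (hI _ _)] at key
  simp only [wigner_eq, ← hx, ← hp]
  have hI0 := Complex.I_ne_zero
  have : (∫ s, wignerIntegrand h x p (opP h φ) ψ s) + ∫ s, wignerIntegrand h x p φ (opP h ψ) s =
      2 * p * ∫ s, wignerIntegrand h x p φ ψ s := by
    have h2 : (Complex.I / (2 * h) : ℂ) ≠ 0 :=
      div_ne_zero hI0 (mul_ne_zero two_ne_zero hhc)
    apply mul_left_cancel₀ h2
    rw [key]; field_simp
  rw [← mul_add, this]; ring

/-- The p-derivative of the phase produces s = (x + s/2) - (x - s/2), a difference of positions in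
the arguments of φ and ψ. -/
theorem hasLineDerivAt_wigner_one (h : ℝ) (φ ψ : 𝓢(ℝ, ℂ)) (z : PhaseSpace) :
    HasLineDerivAt ℝ (wigner h φ ψ)
      (-(Complex.I / h) * (wigner h (opX φ) ψ z - wigner h φ (opX ψ) z)) z (Pi.single 1 1) := by
  have hI (p : ℝ) (φ ψ : 𝓢(ℝ, ℂ)) := integrable_wignerIntegrand h (z 0) p φ ψ
  have e (p s : ℝ) : -(Complex.I / h) * (s * wignerIntegrand h (z 0) p φ ψ s) = -(Complex.I / h) *
      (wignerIntegrand h (z 0) p (opX φ) ψ s - wignerIntegrand h (z 0) p φ (opX ψ) s) := by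
    simp only [wignerIntegrand, opX_apply, map_mul, Complex.conj_ofReal]
    push_cast; ring
  have hd (p s : ℝ) : HasDerivAt (fun p => wignerIntegrand h (z 0) p φ ψ s)
      (-(Complex.I / h) * (s * wignerIntegrand h (z 0) p φ ψ s)) p := by
    have h1 := ((hasDerivAt_exp_phase h s p).mul_const (φ (z 0 + s / 2))).mul_const
      ((starRingEnd ℂ) (ψ (z 0 - s / 2)))
    have h2 : (fun p => wignerIntegrand h (z 0) p φ ψ s) = fun p : ℝ =>
        Complex.exp (-(Complex.I * p * s / h)) * φ (z 0 + s / 2) *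
          (starRingEnd ℂ) (ψ (z 0 - s / 2)) := by
      funext p; rw [wignerIntegrand, mul_right_comm Complex.I]
    rw [h2]
    refine h1.congr_deriv ?_
    rw [wignerIntegrand, mul_right_comm Complex.I]; ring
  have key := hasDerivAt_integral_of_dominated_loc_of_deriv_le (μ := volume)
    (F := fun p s => wignerIntegrand h (z 0) p φ ψ s) (x₀ := z 1)
    (bound := fun s => ‖-(Complex.I / h) * (s * wignerIntegrand h (z 0) 0 φ ψ s)‖)
    (F' := fun p s => -(Complex.I / h) * (s * wignerIntegrand h (z 0) p φ ψ s))
    Filter.univ_mem (Filter.Eventually.of_forall fun p => (hI p φ ψ).aestronglyMeasurable)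
    (hI _ φ ψ) ?_ (Filter.Eventually.of_forall fun s p _ => ?_) ?_
    (Filter.Eventually.of_forall fun s p _ => hd p s)
  · rw [HasLineDerivAt]
    have h1 := (key.2.const_mul (1 / (2 * Real.pi * h) : ℂ))
    have h2 : HasDerivAt (fun t : ℝ => z 1 + t) 1 0 := (hasDerivAt_id 0).const_add _
    rw [← add_zero (z 1)] at h1
    have h3 := h1.scomp 0 h2
    rw [one_smul] at h3
    refine (h3.congr_of_eventuallyEq (Filter.Eventually.of_forall fun t => ?_)).congr_deriv ?_
    · simp [wigner_eq]
    · simp only [e, wigner_eq, add_zero]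
      rw [integral_const_mul, integral_sub (hI _ _ _) (hI _ _ _)]
      ring
  · simp only [e]
    exact (((hI _ _ _).sub (hI _ _ _)).const_mul _).aestronglyMeasurable
  · simp only [norm_mul, norm_wignerIntegrand, le_refl]
  · refine Integrable.norm ?_
    simp only [e]
    exact ((hI _ _ _).sub (hI _ _ _)).const_mul _

theorem hasLineDerivAt_wigner_zero {h : ℝ} (hh : 0 < h) (φ ψ : 𝓢(ℝ, ℂ)) (z : PhaseSpace) :
    HasLineDerivAt ℝ (wigner h φ ψ)
      ((Complex.I / h) * (wigner h (opP h φ) ψ z - wigner h φ (opP h ψ) z)) z (Pi.single 0 1) := by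
  have hhc : (h : ℂ) ≠ 0 := by exact_mod_cast hh.ne'
  have hI (φ ψ : 𝓢(ℝ, ℂ)) := integrable_wignerIntegrand h (z 0) (z 1) φ ψ
  let G : ℝ → ℝ → ℂ := fun x s => Complex.exp (-(Complex.I * s * z 1 / h)) *
    (deriv φ (x + s / 2) * (starRingEnd ℂ) (ψ (x - s / 2)) +
      φ (x + s / 2) * (starRingEnd ℂ) (deriv ψ (x - s / 2)))
  have e (s : ℝ) : G (z 0) s = (Complex.I / h) * (wignerIntegrand h (z 0) (z 1) (opP h φ) ψ s -
      wignerIntegrand h (z 0) (z 1) φ (opP h ψ) s) := by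
    have hk : Complex.I / h * (Complex.I * h) = -1 := by field_simp; exact Complex.I_sq
    simp only [G, wignerIntegrand, opP_apply, map_mul, map_neg, Complex.conj_I,
      Complex.conj_ofReal]
    linear_combination (deriv φ (z 0 + s / 2) * (starRingEnd ℂ) (ψ (z 0 - s / 2)) +
      φ (z 0 + s / 2) * (starRingEnd ℂ) (deriv ψ (z 0 - s / 2))) *
      Complex.exp (-(Complex.I * s * z 1 / h)) * hk
  have hd (x s : ℝ) : HasDerivAt (fun x => wignerIntegrand h x (z 1) φ ψ s) (G x s) x := by
    have h3 := (φ.hasDerivAt (x + s / 2)).comp_add_const x (s / 2)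
    have h4 := (ψ.hasDerivAt (x - s / 2)).comp_sub_const x (s / 2)
    simp only [wignerIntegrand, mul_assoc (Complex.exp _)]
    exact (h3.fun_mul (hasDerivAt_conj_comp h4)).const_mul _
  obtain ⟨M, hM⟩ := exists_norm_le φ
  obtain ⟨M', hM'⟩ := exists_norm_le (SchwartzMap.derivCLM ℂ ℂ φ)
  obtain ⟨C, hC0, hC⟩ := exists_norm_le_div ψ
  obtain ⟨C', hC0', hC'⟩ := exists_norm_le_div (SchwartzMap.derivCLM ℂ ℂ ψ)
  have hM0 : 0 ≤ M := (norm_nonneg _).trans (hM 0)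
  have hM0' : 0 ≤ M' := (norm_nonneg _).trans (hM' 0)
  -- For |e| < 1 one has 1 + (y - e)² ≤ 3(1 + y²); this makes the majorant independent of x in the
  -- unit ball.
  have hloc {D x s : ℝ} (hD : 0 ≤ D) (hx : x ∈ Metric.ball (z 0) 1) :
      D / (1 + (x - s / 2) ^ 2) ≤ 3 * D * (1 + (z 0 - s / 2) ^ 2)⁻¹ := by
    rw [Metric.mem_ball, Real.dist_eq, abs_lt] at hx
    rw [← div_eq_mul_inv, div_le_div_iff₀ (by positivity) (by positivity), mul_comm 3 D, mul_assoc]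
    refine mul_le_mul_of_nonneg_left ?_ hD
    nlinarith [sq_nonneg (x - s / 2 + (x - z 0)), hx.1, hx.2]
  have key := hasDerivAt_integral_of_dominated_loc_of_deriv_le (μ := volume)
    (F := fun x s => wignerIntegrand h x (z 1) φ ψ s) (x₀ := z 0)
    (bound := fun s => (3 * (M' * C) + 3 * (M * C')) * (1 + (z 0 - s / 2) ^ 2)⁻¹)
    (F' := G) (Metric.ball_mem_nhds (z 0) one_pos)
    (Filter.Eventually.of_forall fun x => (integrable_wignerIntegrand h x _ φ ψ).aestronglyMeasurable)
    (hI φ ψ) ?_ (Filter.Eventually.of_forall fun s x hx => ?_) ?_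
    (Filter.Eventually.of_forall fun s x _ => hd x s)
  · rw [HasLineDerivAt]
    have h1 := (key.2.const_mul (1 / (2 * Real.pi * h) : ℂ))
    have h2 : HasDerivAt (fun t : ℝ => z 0 + t) 1 0 := (hasDerivAt_id 0).const_add _
    rw [← add_zero (z 0)] at h1
    have h3 := h1.scomp 0 h2
    rw [one_smul] at h3
    refine (h3.congr_of_eventuallyEq (Filter.Eventually.of_forall fun t => ?_)).congr_deriv ?_
    · simp [wigner_eq]
    · simp only [add_zero, e, wigner_eq]
      rw [integral_const_mul, integral_sub (hI _ _) (hI _ _)]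
      ring
  · rw [funext e]
    exact (((hI _ _).sub (hI _ _)).const_mul _).aestronglyMeasurable
  · simp only [G]
    rw [norm_mul, norm_exp_phase, one_mul]
    refine (norm_add_le _ _).trans ?_
    rw [norm_mul, norm_mul, RCLike.norm_conj, RCLike.norm_conj, add_mul]
    refine add_le_add ?_ ?_
    · refine (mul_le_mul (hM' _) (hC _) (norm_nonneg _) hM0').trans ?_
      rw [← mul_div_assoc]
      exact hloc (mul_nonneg hM0' hC0) hx
    · refine (mul_le_mul (hM _) (hC' _) (norm_nonneg _) hM0).trans ?_
      rw [← mul_div_assoc]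
      exact hloc (mul_nonneg hM0 hC0') hx
  · exact (integrable_comp_sub_half (fun y => (1 + y ^ 2)⁻¹) integrable_inv_one_add_sq _).const_mul _

theorem stronglyMeasurable_wigner (h : ℝ) (φ ψ : 𝓢(ℝ, ℂ)) :
    StronglyMeasurable (wigner h φ ψ) := by
  have h1 : Continuous fun q : PhaseSpace × ℝ => wignerIntegrand h (q.1 0) (q.1 1) φ ψ q.2 :=
    (continuous_wignerIntegrand h φ.continuous ψ.continuous).comp
      (f := fun q : PhaseSpace × ℝ => (q.1 0, q.1 1, q.2)) (by fun_prop)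
  exact (StronglyMeasurable.integral_prod_right (ν := volume)
    (f := fun (z : PhaseSpace) s => wignerIntegrand h (z 0) (z 1) φ ψ s)
    h1.stronglyMeasurable).const_mul _

/-! ### Decay and integrability -/

/-- Each coordinate is traded for an operator on φ or on ψ. The constant depends on ψ only, and φ
enters through sup norms alone; the estimates on analytic vectors need this uniformity when φ is
replaced by its iterates under the generator. -/
theorem norm_coord_pow_mul_wigner_le {h : ℝ} (hh : 0 < h) (i j : ℕ) (ψ : 𝓢(ℝ, ℂ)) :
    ∃ C, 0 ≤ C ∧ ∀ (φ : 𝓢(ℝ, ℂ)) (M : ℝ),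
      (∀ i' ≤ i, ∀ j' ≤ j, ∀ x, ‖((opP h ^ j') ((opX ^ i') φ)) x‖ ≤ M) →
        ∀ z : PhaseSpace, ‖(z 0 : ℂ) ^ i * (z 1 : ℂ) ^ j * wigner h φ ψ z‖ ≤ C * M := by
  induction i generalizing ψ with
  | zero =>
    induction j generalizing ψ with
    | zero =>
      obtain ⟨C, hC, H⟩ := norm_wigner_le hh ψ
      refine ⟨C, hC, fun φ M hM z => ?_⟩
      simpa using H φ M (fun x => by simpa using hM 0 le_rfl 0 le_rfl x) z
    | succ j ih =>
      obtain ⟨C, hC, H⟩ := ih ψ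
      obtain ⟨C', hC', H'⟩ := ih (opP h ψ)
      refine ⟨(C + C') / 2, by positivity, fun φ M hM z => ?_⟩
      have h1 := H (opP h φ) M (fun i' hi j' hj x => by
        obtain rfl := Nat.le_zero.1 hi
        have := hM 0 le_rfl (j' + 1) (by omega) x
        rwa [pow_succ] at this) z
      have h2 := H' φ M (fun i' hi j' hj x => hM i' hi j' (by omega) x) z
      rw [pow_succ (z 1 : ℂ), ← mul_assoc, mul_assoc (_ * _) (z 1 : ℂ), coord_one_mul_wigner hh,
        mul_div_assoc', norm_div, mul_add]
      refine (div_le_div_of_nonneg_right (norm_add_le _ _) (norm_nonneg _)).trans ?_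
      rw [Complex.norm_ofNat]
      linarith
  | succ i ih =>
    obtain ⟨C, hC, H⟩ := ih ψ
    obtain ⟨C', hC', H'⟩ := ih (opX ψ)
    refine ⟨(C + C') / 2, by positivity, fun φ M hM z => ?_⟩
    have h1 := H (opX φ) M (fun i' hi j' hj x => by
      have := hM (i' + 1) (by omega) j' hj x
      rwa [pow_succ] at this) z
    have h2 := H' φ M (fun i' hi j' hj x => hM i' (by omega) j' hj x) z
    have e : (z 0 : ℂ) ^ (i + 1) * (z 1 : ℂ) ^ j * wigner h φ ψ z =
        (z 0 : ℂ) ^ i * (z 1 : ℂ) ^ j * (z 0 * wigner h φ ψ z) := by ring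
    rw [e, coord_zero_mul_wigner, mul_div_assoc', norm_div, mul_add]
    refine (div_le_div_of_nonneg_right (norm_add_le _ _) (norm_nonneg _)).trans ?_
    rw [Complex.norm_ofNat]
    linarith

/-- `(1 + x²)(1 + p²)`. -/
def weight (z : PhaseSpace) : ℝ := (1 + z 0 ^ 2) * (1 + z 1 ^ 2)

theorem one_le_weight (z : PhaseSpace) : 1 ≤ weight z := by
  unfold weight
  nlinarith [sq_nonneg (z 0), sq_nonneg (z 1), mul_nonneg (sq_nonneg (z 0)) (sq_nonneg (z 1))]

theorem integrable_inv_weight : Integrable fun z => (weight z)⁻¹ := by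
  have h1 : Integrable (fun q : ℝ × ℝ => (1 + q.1 ^ 2)⁻¹ * (1 + q.2 ^ 2)⁻¹) :=
    integrable_inv_one_add_sq.mul_prod integrable_inv_one_add_sq
  have h2 := (volume_preserving_finTwoArrow ℝ).integrable_comp_of_integrable h1
  refine h2.congr (Filter.Eventually.of_forall fun z => ?_)
  simp [weight, mul_comm]

theorem norm_weight_mul_wigner_le {h : ℝ} (hh : 0 < h) (ψ : 𝓢(ℝ, ℂ)) :
    ∃ C, 0 ≤ C ∧ ∀ (φ : 𝓢(ℝ, ℂ)) (M : ℝ),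
      (∀ i ≤ 2, ∀ j ≤ 2, ∀ x, ‖((opP h ^ j) ((opX ^ i) φ)) x‖ ≤ M) →
        ∀ z : PhaseSpace, weight z * ‖wigner h φ ψ z‖ ≤ C * M := by
  choose C hC H using fun q : ℕ × ℕ => norm_coord_pow_mul_wigner_le hh q.1 q.2 ψ
  refine ⟨C (0, 0) + C (0, 2) + C (2, 0) + C (2, 2), add_nonneg (add_nonneg (add_nonneg (hC _)
    (hC _)) (hC _)) (hC _), fun φ M hM z => ?_⟩
  have key (i j : ℕ) (hi : i ≤ 2) (hj : j ≤ 2) :=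
    H (i, j) φ M (fun i' hi' j' hj' => hM i' (hi'.trans hi) j' (hj'.trans hj)) z
  have h0 := key 0 0 (by norm_num) (by norm_num)
  have h1 := key 0 2 (by norm_num) (by norm_num)
  have h2 := key 2 0 (by norm_num) (by norm_num)
  have h3 := key 2 2 (by norm_num) (by norm_num)
  simp only [norm_mul, norm_pow, Complex.norm_real, Real.norm_eq_abs, sq_abs, pow_zero, one_mul,
    mul_one] at h0 h1 h2 h3
  unfold weight
  nlinarith

theorem exists_norm_mul_coord_mul_wigner_le {h : ℝ} (hh : 0 < h) (i : Fin 2)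
    {u : PhaseSpace → ℝ} (hu : ∀ z, 0 ≤ u z)
    (H : ∀ φ ψ : 𝓢(ℝ, ℂ), ∃ C, ∀ z, u z * ‖wigner h φ ψ z‖ ≤ C) (φ ψ : 𝓢(ℝ, ℂ)) :
    ∃ C, ∀ z, u z * |z i| * ‖wigner h φ ψ z‖ ≤ C := by
  have key : ∀ φ₁ ψ₁ : 𝓢(ℝ, ℂ), (∀ z, (z i : ℂ) * wigner h φ ψ z =
      (wigner h φ₁ ψ z + wigner h φ ψ₁ z) / 2) → ∃ C, ∀ z, u z * |z i| * ‖wigner h φ ψ z‖ ≤ C := by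
    intro φ₁ ψ₁ e
    obtain ⟨C₁, h₁⟩ := H φ₁ ψ
    obtain ⟨C₂, h₂⟩ := H φ ψ₁
    refine ⟨(C₁ + C₂) / 2, fun z => ?_⟩
    rw [mul_assoc, ← Real.norm_eq_abs, ← Complex.norm_real, ← norm_mul, e, norm_div,
      Complex.norm_ofNat]
    have := mul_le_mul_of_nonneg_left (norm_add_le (wigner h φ₁ ψ z) (wigner h φ ψ₁ z)) (hu z)
    have := h₁ z
    have := h₂ z
    rw [mul_div_assoc']
    linarith
  fin_cases i
  · exact key _ _ (coord_zero_mul_wigner h φ ψ)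
  · exact key _ _ (coord_one_mul_wigner hh φ ψ)

/-- Expanding the weight as 1 + x² + p² + x²p², each monomial is absorbed one coordinate at a time,
at the price of changing φ and ψ. -/
theorem exists_norm_weight_pow_mul_wigner_le {h : ℝ} (hh : 0 < h) (N : ℕ) (φ ψ : 𝓢(ℝ, ℂ)) :
    ∃ C, ∀ z : PhaseSpace, weight z ^ N * ‖wigner h φ ψ z‖ ≤ C := by
  induction N generalizing φ ψ with
  | zero =>
    obtain ⟨M, hM⟩ := exists_norm_le φ
    obtain ⟨C, hC, H⟩ := norm_wigner_le hh ψ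
    exact ⟨C * M, fun z => by simpa using H φ M hM z⟩
  | succ N ih =>
    have hw (z : PhaseSpace) : 0 ≤ weight z ^ N := pow_nonneg (zero_le_one.trans (one_le_weight z)) N
    have h1 (i : Fin 2) := exists_norm_mul_coord_mul_wigner_le hh i
      (fun z => mul_nonneg (hw z) (abs_nonneg _)) (exists_norm_mul_coord_mul_wigner_le hh i hw ih)
    have h2 := exists_norm_mul_coord_mul_wigner_le hh 1
      (fun z => mul_nonneg (mul_nonneg (mul_nonneg (hw z) (abs_nonneg _)) (abs_nonneg _))
        (abs_nonneg _)) (exists_norm_mul_coord_mul_wigner_le hh 1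
      (fun z => mul_nonneg (mul_nonneg (hw z) (abs_nonneg _)) (abs_nonneg _)) (h1 0))
    obtain ⟨C₀, H₀⟩ := ih φ ψ
    obtain ⟨C₁, H₁⟩ := h1 0 φ ψ
    obtain ⟨C₂, H₂⟩ := h1 1 φ ψ
    obtain ⟨C₃, H₃⟩ := h2 φ ψ
    refine ⟨C₀ + C₁ + C₂ + C₃, fun z => ?_⟩
    refine le_trans (le_of_eq ?_) (add_le_add (add_le_add (add_le_add (H₀ z) (H₁ z)) (H₂ z)) (H₃ z))
    have e (x : ℝ) : |x| * |x| = x ^ 2 := by rw [abs_mul_abs_self, pow_two]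
    have e1 : weight z = 1 + z 0 ^ 2 + z 1 ^ 2 + z 0 ^ 2 * z 1 ^ 2 := by unfold weight; ring
    rw [pow_succ]
    nth_rewrite 2 [e1]
    rw [← e, ← e]
    ring

/-- Continuous functions of polynomial growth on the phase space. -/
structure PolyGrowth (B : PhaseSpace → ℂ) : Prop where
  continuous : Continuous B
  bound : ∃ C N, ∀ z, ‖B z‖ ≤ C * weight z ^ (N : ℕ)

namespace PolyGrowth

variable {B B' : PhaseSpace → ℂ}

theorem of_norm_le {C : ℝ} (hB : Continuous B) (h : ∀ z, ‖B z‖ ≤ C) : PolyGrowth B :=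
  ⟨hB, C, 0, fun z => by simpa using h z⟩

theorem const (c : ℂ) : PolyGrowth fun _ => c := of_norm_le continuous_const fun _ => le_rfl

theorem mul (hB : PolyGrowth B) (hB' : PolyGrowth B') : PolyGrowth fun z => B z * B' z := by
  obtain ⟨C, N, h⟩ := hB.bound
  obtain ⟨C', N', h'⟩ := hB'.bound
  refine ⟨hB.continuous.mul hB'.continuous, C * C', N + N', fun z => ?_⟩
  rw [norm_mul, pow_add, mul_mul_mul_comm]
  exact mul_le_mul (h z) (h' z) (norm_nonneg _) ((norm_nonneg _).trans (h z))

theorem add (hB : PolyGrowth B) (hB' : PolyGrowth B') : PolyGrowth fun z => B z + B' z := by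
  obtain ⟨C, N, h⟩ := hB.bound
  obtain ⟨C', N', h'⟩ := hB'.bound
  refine ⟨hB.continuous.add hB'.continuous, |C| + |C'|, max N N', fun z => ?_⟩
  refine (norm_add_le _ _).trans ?_
  rw [add_mul]
  exact add_le_add
    ((h z).trans (mul_le_mul (le_abs_self C) (pow_le_pow_right₀ (one_le_weight z) (le_max_left _ _))
      (pow_nonneg (zero_le_one.trans (one_le_weight z)) _) (abs_nonneg _)))
    ((h' z).trans (mul_le_mul (le_abs_self C')
      (pow_le_pow_right₀ (one_le_weight z) (le_max_right _ _))
      (pow_nonneg (zero_le_one.trans (one_le_weight z)) _) (abs_nonneg _)))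

theorem coord (i : Fin 2) : PolyGrowth fun z => (z i : ℂ) := by
  refine ⟨Complex.continuous_ofReal.comp (continuous_apply i), 1, 1, fun z => ?_⟩
  rw [Complex.norm_real, Real.norm_eq_abs, one_mul, pow_one, weight]
  have h0 := sq_nonneg (z 0)
  have h1 := sq_nonneg (z 1)
  have h2 := mul_nonneg h0 h1
  have h3 : |z i| ≤ 1 + z i ^ 2 := by nlinarith [sq_nonneg (|z i| - 1), sq_abs (z i)]
  fin_cases i <;> simp at h3 ⊢ <;> nlinarith

theorem pow (hB : PolyGrowth B) (n : ℕ) : PolyGrowth fun z => B z ^ n := by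
  induction n with
  | zero => simpa using const 1
  | succ n ih => simpa only [pow_succ] using ih.mul hB

theorem sum {ι : Type*} {s : Finset ι} {B : ι → PhaseSpace → ℂ} (h : ∀ i ∈ s, PolyGrowth (B i)) :
    PolyGrowth fun z => ∑ i ∈ s, B i z := by
  classical
  induction s using Finset.induction_on with
  | empty => simpa using const 0
  | insert i s hi ih =>
    simp only [Finset.sum_insert hi]
    exact (h i (by simp)).add (ih fun j hj => h j (by simp [hj]))

theorem integrable_mul_wigner (hB : PolyGrowth B) {h : ℝ} (hh : 0 < h) (φ ψ : 𝓢(ℝ, ℂ)) :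
    Integrable fun z => B z * wigner h φ ψ z := by
  obtain ⟨C, N, H⟩ := hB.bound
  obtain ⟨C', H'⟩ := exists_norm_weight_pow_mul_wigner_le hh (N + 1) φ ψ
  refine (integrable_inv_weight.const_mul (|C| * C')).mono'
    (hB.continuous.aestronglyMeasurable.mul (stronglyMeasurable_wigner h φ ψ).aestronglyMeasurable)
    (Filter.Eventually.of_forall fun z => ?_)
  have hw : 0 < weight z := one_pos.trans_le (one_le_weight z)
  rw [norm_mul, ← div_eq_mul_inv, le_div_iff₀ hw]
  calc ‖B z‖ * ‖wigner h φ ψ z‖ * weight z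
      ≤ |C| * weight z ^ N * ‖wigner h φ ψ z‖ * weight z := by
        have := (H z).trans (mul_le_mul_of_nonneg_right (le_abs_self C) (pow_nonneg hw.le N))
        gcongr
    _ = |C| * (weight z ^ (N + 1) * ‖wigner h φ ψ z‖) := by ring
    _ ≤ |C| * C' := mul_le_mul_of_nonneg_left (H' z) (abs_nonneg C)

end PolyGrowth

theorem integral_inv_weight_nonneg : 0 ≤ ∫ z, (weight z)⁻¹ :=
  integral_nonneg fun z => inv_nonneg.2 (zero_le_one.trans (one_le_weight z))

/-! ### Integration by parts -/

/-- W(Xφ, ψ) is the half-sum xW plus the half-difference (iħ/2) ∂_p W, and the derivative is then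
moved to B. The new symbol is the right Moyal product B ⋆ x. -/
theorem PolyGrowth.integral_mul_wigner_opX {B B' : PhaseSpace → ℂ} (hB : PolyGrowth B)
    (hB' : PolyGrowth B') (hd : ∀ z, HasLineDerivAt ℝ B (B' z) z (Pi.single 1 1)) {h : ℝ}
    (hh : 0 < h) (φ ψ : 𝓢(ℝ, ℂ)) : ∫ z, B z * wigner h (opX φ) ψ z =
      ∫ z, (z 0 * B z - Complex.I * h / 2 * B' z) * wigner h φ ψ z := by
  have hhc : (h : ℂ) ≠ 0 := by exact_mod_cast hh.ne'
  have i1 := hB.integrable_mul_wigner hh (opX φ) ψ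
  have i2 := hB.integrable_mul_wigner hh φ (opX ψ)
  have i3 := hB'.integrable_mul_wigner hh φ ψ
  have e (z : PhaseSpace) :
      B z * (-(Complex.I / h) * (wigner h (opX φ) ψ z - wigner h φ (opX ψ) z)) =
      -(Complex.I / h) * (B z * wigner h (opX φ) ψ z - B z * wigner h φ (opX ψ) z) := by ring
  have key := integral_bilinear_hasLineDerivAt_right_eq_neg_left_of_integrable (μ := volume)
    (B := ContinuousLinearMap.mul ℝ ℂ) (f := B) (f' := B') (g := wigner h φ ψ)
    (g' := fun z => -(Complex.I / h) * (wigner h (opX φ) ψ z - wigner h φ (opX ψ) z))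
    i3 (by simpa only [ContinuousLinearMap.mul_apply', e, Pi.sub_apply] using (i1.sub i2).const_mul _)
    (hB.integrable_mul_wigner hh φ ψ) (fun z _ => hd z)
    (fun z _ => hasLineDerivAt_wigner_one h φ ψ z)
  simp only [ContinuousLinearMap.mul_apply', e] at key
  rw [integral_const_mul, integral_sub i1 i2] at key
  have e2 (z : PhaseSpace) : (z 0 * B z - Complex.I * h / 2 * B' z) * wigner h φ ψ z =
      (1 / 2) * (B z * wigner h (opX φ) ψ z + B z * wigner h φ (opX ψ) z) -
        Complex.I * h / 2 * (B' z * wigner h φ ψ z) := by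
    linear_combination B z * coord_zero_mul_wigner h φ ψ z
  simp only [e2]
  rw [integral_sub ((i1.fun_add i2).const_mul _) (i3.const_mul _), integral_const_mul,
    integral_const_mul, integral_add i1 i2]
  have hk : Complex.I * h / 2 * (Complex.I / h) = -1 / 2 := by
    field_simp; exact Complex.I_sq
  linear_combination (Complex.I * h / 2) * key +
    ((∫ z, B z * wigner h (opX φ) ψ z) - ∫ z, B z * wigner h φ (opX ψ) z) * hk

theorem PolyGrowth.integral_mul_wigner_opP {B B' : PhaseSpace → ℂ} (hB : PolyGrowth B)
    (hB' : PolyGrowth B') (hd : ∀ z, HasLineDerivAt ℝ B (B' z) z (Pi.single 0 1)) {h : ℝ}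
    (hh : 0 < h) (φ ψ : 𝓢(ℝ, ℂ)) : ∫ z, B z * wigner h (opP h φ) ψ z =
      ∫ z, (z 1 * B z + Complex.I * h / 2 * B' z) * wigner h φ ψ z := by
  have hhc : (h : ℂ) ≠ 0 := by exact_mod_cast hh.ne'
  have i1 := hB.integrable_mul_wigner hh (opP h φ) ψ
  have i2 := hB.integrable_mul_wigner hh φ (opP h ψ)
  have i3 := hB'.integrable_mul_wigner hh φ ψ
  have e (z : PhaseSpace) :
      B z * ((Complex.I / h) * (wigner h (opP h φ) ψ z - wigner h φ (opP h ψ) z)) =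
      (Complex.I / h) * (B z * wigner h (opP h φ) ψ z - B z * wigner h φ (opP h ψ) z) := by ring
  have key := integral_bilinear_hasLineDerivAt_right_eq_neg_left_of_integrable (μ := volume)
    (B := ContinuousLinearMap.mul ℝ ℂ) (f := B) (f' := B') (g := wigner h φ ψ)
    (g' := fun z => (Complex.I / h) * (wigner h (opP h φ) ψ z - wigner h φ (opP h ψ) z))
    i3 (by simpa only [ContinuousLinearMap.mul_apply', e, Pi.sub_apply] using (i1.sub i2).const_mul _)
    (hB.integrable_mul_wigner hh φ ψ) (fun z _ => hd z)
    (fun z _ => hasLineDerivAt_wigner_zero hh φ ψ z)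
  simp only [ContinuousLinearMap.mul_apply', e] at key
  rw [integral_const_mul, integral_sub i1 i2] at key
  have e2 (z : PhaseSpace) : (z 1 * B z + Complex.I * h / 2 * B' z) * wigner h φ ψ z =
      (1 / 2) * (B z * wigner h (opP h φ) ψ z + B z * wigner h φ (opP h ψ) z) +
        Complex.I * h / 2 * (B' z * wigner h φ ψ z) := by
    linear_combination B z * coord_one_mul_wigner hh φ ψ z
  simp only [e2]
  rw [integral_add ((i1.fun_add i2).const_mul _) (i3.const_mul _), integral_const_mul,
    integral_const_mul, integral_add i1 i2]
  have hk : Complex.I * h / 2 * (Complex.I / h) = -1 / 2 := by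
    field_simp; exact Complex.I_sq
  linear_combination -(Complex.I * h / 2) * key +
    ((∫ z, B z * wigner h (opP h φ) ψ z) - ∫ z, B z * wigner h φ (opP h ψ) z) * hk

/-! ### The symbol of the identity -/

/-- In the variable p/(2πħ), the Wigner function is up to a constant the Fourier transform in s of
φ(x + s/2) times the conjugate of ψ(x - s/2). Its integral is given by Fourier inversion at s = 0.
-/
theorem integral_wigner_momentum {h : ℝ} (hh : 0 < h) (φ ψ : 𝓢(ℝ, ℂ)) (x : ℝ) :
    ∫ p : ℝ, wigner h φ ψ ![x, p] = φ x * (starRingEnd ℂ) (ψ x) := by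
  have hc : (2 * Real.pi * h : ℝ) ≠ 0 := by positivity
  -- Taking p = 0 removes the phase, which the Fourier transform will supply.
  let F : ℝ → ℂ := wignerIntegrand h x 0 φ ψ
  have hFI : Integrable F := integrable_wignerIntegrand h x 0 φ ψ
  have hFc : Continuous F := continuous_wignerIntegrand_right h x 0 φ.continuous ψ.continuous
  have e (ξ : ℝ) : FourierTransform.fourier F ξ =
      (2 * Real.pi * h : ℝ) * wigner h φ ψ ![x, ξ * (2 * Real.pi * h)] := by
    have hcc : (2 * Real.pi * h : ℂ) ≠ 0 := by exact_mod_cast hc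
    have hhc : (h : ℂ) ≠ 0 := by exact_mod_cast hh.ne'
    rw [wigner_eq, ← mul_assoc]
    push_cast
    rw [mul_one_div_cancel hcc, one_mul, Real.fourier_real_eq_integral_exp_smul]
    refine integral_congr_ae (Filter.Eventually.of_forall fun s => ?_)
    simp only [F, wignerIntegrand, smul_eq_mul]
    rw [← mul_assoc, ← mul_assoc, ← Complex.exp_add]
    congr 3
    push_cast
    field_simp
    ring
  have hWI : Integrable fun p : ℝ => wigner h φ ψ ![x, p] := by
    obtain ⟨C, hC⟩ := exists_norm_weight_pow_mul_wigner_le hh 1 φ ψ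
    refine (integrable_inv_one_add_sq.const_mul C).mono'
      ((stronglyMeasurable_wigner h φ ψ).comp_measurable (by fun_prop)).aestronglyMeasurable
      (Filter.Eventually.of_forall fun p => ?_)
    have h1 := hC ![x, p]
    simp only [pow_one, weight, Matrix.cons_val_zero, Matrix.cons_val_one] at h1
    rw [← div_eq_mul_inv, le_div_iff₀ (by positivity)]
    nlinarith [norm_nonneg (wigner h φ ψ ![x, p]), sq_nonneg x, sq_nonneg p,
      mul_nonneg (norm_nonneg (wigner h φ ψ ![x, p])) (mul_nonneg (sq_nonneg x)
        (by positivity : 0 ≤ 1 + p ^ 2))]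
  have hFF : Integrable (FourierTransform.fourier F) := by
    rw [funext e]
    exact (hWI.comp_mul_right' hc).const_mul _
  have h1 := hFI.fourierInv_fourier_eq hFF (v := 0) hFc.continuousAt
  rw [Real.fourierInv_eq] at h1
  simp only [inner_zero_right, AddChar.map_zero_eq_one, one_smul, e] at h1
  rw [integral_const_mul, Measure.integral_comp_mul_right (fun p => wigner h φ ψ ![x, p])] at h1
  rw [abs_of_pos (by positivity), Complex.real_smul, ← mul_assoc, ← Complex.ofReal_mul,
    mul_inv_cancel₀ hc, Complex.ofReal_one, one_mul] at h1
  rw [h1]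
  simp [F, wignerIntegrand]

theorem integral_wigner {h : ℝ} (hh : 0 < h) (φ ψ : 𝓢(ℝ, ℂ)) :
    ∫ z, wigner h φ ψ z = inner ℂ (ψ.toLp 2 : L2) (φ.toLp 2 : L2) := by
  have hWI : Integrable (wigner h φ ψ) := by
    simpa using (PolyGrowth.const 1).integrable_mul_wigner hh φ ψ
  have hp := (volume_preserving_finTwoArrow ℝ).symm
  refine Eq.trans ?_ (SchwartzMap.inner_toL2_toL2_eq ψ φ).symm
  rw [← hp.integral_comp' (wigner h φ ψ)]
  have h2 : Integrable (fun q => wigner h φ ψ (MeasurableEquiv.finTwoArrow.symm q))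
      (volume.prod volume) := hp.integrable_comp_of_integrable hWI
  rw [Measure.volume_eq_prod, integral_prod _ h2]
  refine integral_congr_ae (Filter.Eventually.of_forall fun x => ?_)
  simp only [RCLike.inner_apply]
  rw [← integral_wigner_momentum hh φ ψ x]
  rfl

/-! ### Schwartz functions as elements of `L²(ℝ)` -/

theorem toLp_add (φ φ' : 𝓢(ℝ, ℂ)) :
    ((φ + φ').toLp 2 volume : L2) = φ.toLp 2 volume + φ'.toLp 2 volume :=
  map_add (SchwartzMap.toLpCLM ℂ ℂ 2 volume) φ φ'

theorem toLp_sub (φ φ' : 𝓢(ℝ, ℂ)) :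
    ((φ - φ').toLp 2 volume : L2) = φ.toLp 2 volume - φ'.toLp 2 volume :=
  map_sub (SchwartzMap.toLpCLM ℂ ℂ 2 volume) φ φ'

theorem toLp_smul (c : ℂ) (φ : 𝓢(ℝ, ℂ)) :
    ((c • φ).toLp 2 volume : L2) = c • φ.toLp 2 volume :=
  map_smul (SchwartzMap.toLpCLM ℂ ℂ 2 volume) c φ

theorem eq_of_toLp_eq {φ φ' : 𝓢(ℝ, ℂ)} (h : (φ.toLp 2 volume : L2) = φ'.toLp 2 volume) : φ = φ' :=
  SchwartzMap.injective_toLp 2 volume h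

/-! ### The quadratic operator -/

/-- The operator with Weyl symbol `A`: `½ (Q₀₀ X² + Q₀₁ (XP + PX) + Q₁₁ P²)`. -/
def quadraticOp (Q : Matrix (Fin 2) (Fin 2) ℝ) (h : ℝ) : 𝓢(ℝ, ℂ) →ₗ[ℂ] 𝓢(ℝ, ℂ) :=
  (Q 0 0 / 2 : ℂ) • (opX * opX : Module.End ℂ 𝓢(ℝ, ℂ)) +
    (Q 0 1 / 2 : ℂ) • (opX * opP h + opP h * opX : Module.End ℂ 𝓢(ℝ, ℂ)) +
    (Q 1 1 / 2 : ℂ) • (opP h * opP h : Module.End ℂ 𝓢(ℝ, ℂ))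

theorem quadraticOp_apply (Q : Matrix (Fin 2) (Fin 2) ℝ) (h : ℝ) (φ : 𝓢(ℝ, ℂ)) :
    quadraticOp Q h φ = (Q 0 0 / 2 : ℂ) • opX (opX φ) +
      (Q 0 1 / 2 : ℂ) • (opX (opP h φ) + opP h (opX φ)) + (Q 1 1 / 2 : ℂ) • opP h (opP h φ) := rfl

theorem PolyGrowth.symbolGrad (Q : Matrix (Fin 2) (Fin 2) ℝ) (i : Fin 2) :
    PolyGrowth (symbolGrad Q i) := by
  have : QuadSymbol.symbolGrad Q i = fun z => (Q i 0 : ℂ) * z 0 + (Q i 1 : ℂ) * z 1 := by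
    funext z; simp [QuadSymbol.symbolGrad]
  rw [this]
  exact ((const _).mul (coord 0)).add ((const _).mul (coord 1))

theorem PolyGrowth.quadraticSymbol {Q : Matrix (Fin 2) (Fin 2) ℝ} (hQ : Q.IsSymm) :
    PolyGrowth fun z => (quadraticSymbol Q z : ℂ) := by
  have : (fun z => (QuadSymbol.quadraticSymbol Q z : ℂ)) = fun z =>
      ((Q 0 0 / 2 : ℂ) * (z 0 * z 0) + (Q 0 1 : ℂ) * (z 0 * z 1)) + (Q 1 1 / 2 : ℂ) * (z 1 * z 1) := by
    funext z; rw [quadraticSymbol_eq hQ]; push_cast; ring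
  rw [this]
  exact (((const _).mul ((coord 0).mul (coord 0))).add
    ((const _).mul ((coord 0).mul (coord 1)))).add ((const _).mul ((coord 1).mul (coord 1)))

/-- Integration by parts: `∫ B W(Âφ, ψ) = ∫ (A ⋆ B) W(φ, ψ)` for a symbol `B = b₀` which is a
function of `A`, with first and second derivatives `b₁`, `b₂`. -/
theorem integral_mul_wigner_quadraticOp {Q : Matrix (Fin 2) (Fin 2) ℝ} (hQ : Q.IsSymm)
    {b₀ b₁ b₂ : PhaseSpace → ℂ} (h₀ : PolyGrowth b₀) (h₁ : PolyGrowth b₁) (h₂ : PolyGrowth b₂)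
    (d₀ : ∀ z, HasFDerivAt b₀ (b₁ z • symbolHess Q z) z)
    (d₁ : ∀ z, HasFDerivAt b₁ (b₂ z • symbolHess Q z) z) {h : ℝ} (hh : 0 < h) (φ ψ : 𝓢(ℝ, ℂ)) :
    ∫ z, b₀ z * wigner h (quadraticOp Q h φ) ψ z =
      ∫ z, (quadraticSymbol Q z * b₀ z - h ^ 2 / 4 * Q.det *
        (b₁ z + quadraticSymbol Q z * b₂ z)) * wigner h φ ψ z := by
  have hs : Q 1 0 = Q 0 1 := hQ.apply 0 1
  have g₀ := PolyGrowth.symbolGrad Q 0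
  have g₁ := PolyGrowth.symbolGrad Q 1
  have c₀ := PolyGrowth.coord 0
  have c₁ := PolyGrowth.coord 1
  have k := PolyGrowth.const (Complex.I * h / 2)
  have k' := PolyGrowth.const (-(Complex.I * h / 2))
  have l₀ (i : Fin 2) (z : PhaseSpace) :
      HasLineDerivAt ℝ b₀ (b₁ z * symbolGrad Q i z) z (Pi.single i 1) := by
    refine ((d₀ z).hasLineDerivAt _).congr_deriv ?_
    rw [smul_apply, symbolHess_apply]
    fin_cases i <;> simp
  -- These are b₀ ⋆ x and b₀ ⋆ p, the symbols after one operator has been moved off φ. Below, `Bxx`,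
  -- `Bxp`, `Bpx` and `Bpp` are their partial derivatives, the last letter naming the variable.
  let Bx : PhaseSpace → ℂ := fun z => z 0 * b₀ z + -(Complex.I * h / 2) * (b₁ z * symbolGrad Q 1 z)
  let Bp : PhaseSpace → ℂ := fun z => z 1 * b₀ z + (Complex.I * h / 2) * (b₁ z * symbolGrad Q 0 z)
  have hBx : PolyGrowth Bx := (c₀.mul h₀).add (k'.mul (h₁.mul g₁))
  have hBp : PolyGrowth Bp := (c₁.mul h₀).add (k.mul (h₁.mul g₀))
  have fBx (z : PhaseSpace) := ((hasFDerivAt_coord 0 z).mul (d₀ z)).add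
    (((d₁ z).mul (hasFDerivAt_symbolGrad Q 1 z)).const_mul (-(Complex.I * h / 2)))
  have fBp (z : PhaseSpace) := ((hasFDerivAt_coord 1 z).mul (d₀ z)).add
    (((d₁ z).mul (hasFDerivAt_symbolGrad Q 0 z)).const_mul (Complex.I * h / 2))
  let Bxx : PhaseSpace → ℂ := fun z => (z 0 * (b₁ z * symbolGrad Q 0 z) + b₀ z) +
    -(Complex.I * h / 2) * (b₁ z * Q 1 0 + symbolGrad Q 1 z * (b₂ z * symbolGrad Q 0 z))
  let Bxp : PhaseSpace → ℂ := fun z => z 0 * (b₁ z * symbolGrad Q 1 z) +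
    -(Complex.I * h / 2) * (b₁ z * Q 1 1 + symbolGrad Q 1 z * (b₂ z * symbolGrad Q 1 z))
  let Bpx : PhaseSpace → ℂ := fun z => z 1 * (b₁ z * symbolGrad Q 0 z) +
    (Complex.I * h / 2) * (b₁ z * Q 0 0 + symbolGrad Q 0 z * (b₂ z * symbolGrad Q 0 z))
  let Bpp : PhaseSpace → ℂ := fun z => (z 1 * (b₁ z * symbolGrad Q 1 z) + b₀ z) +
    (Complex.I * h / 2) * (b₁ z * Q 0 1 + symbolGrad Q 0 z * (b₂ z * symbolGrad Q 1 z))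
  have hBxx : PolyGrowth Bxx := ((c₀.mul (h₁.mul g₀)).add h₀).add
    (k'.mul ((h₁.mul (.const _)).add (g₁.mul (h₂.mul g₀))))
  have hBxp : PolyGrowth Bxp := (c₀.mul (h₁.mul g₁)).add
    (k'.mul ((h₁.mul (.const _)).add (g₁.mul (h₂.mul g₁))))
  have hBpx : PolyGrowth Bpx := (c₁.mul (h₁.mul g₀)).add
    (k.mul ((h₁.mul (.const _)).add (g₀.mul (h₂.mul g₀))))
  have hBpp : PolyGrowth Bpp := ((c₁.mul (h₁.mul g₁)).add h₀).add
    (k.mul ((h₁.mul (.const _)).add (g₀.mul (h₂.mul g₁))))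
  have lBxx (z : PhaseSpace) : HasLineDerivAt ℝ Bx (Bxx z) z (Pi.single 0 1) :=
    ((fBx z).hasLineDerivAt _).congr_deriv (by simp [symbolHess_apply, coordForm, Bxx]; try ring)
  have lBxp (z : PhaseSpace) : HasLineDerivAt ℝ Bx (Bxp z) z (Pi.single 1 1) :=
    ((fBx z).hasLineDerivAt _).congr_deriv (by simp [symbolHess_apply, coordForm, Bxp]; try ring)
  have lBpx (z : PhaseSpace) : HasLineDerivAt ℝ Bp (Bpx z) z (Pi.single 0 1) :=
    ((fBp z).hasLineDerivAt _).congr_deriv (by simp [symbolHess_apply, coordForm, Bpx]; try ring)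
  have lBpp (z : PhaseSpace) : HasLineDerivAt ℝ Bp (Bpp z) z (Pi.single 1 1) :=
    ((fBp z).hasLineDerivAt _).congr_deriv (by simp [symbolHess_apply, coordForm, Bpp]; try ring)
  have sX (φ : 𝓢(ℝ, ℂ)) : ∫ z, b₀ z * wigner h (opX φ) ψ z = ∫ z, Bx z * wigner h φ ψ z := by
    rw [h₀.integral_mul_wigner_opX (h₁.mul g₁) (l₀ 1) hh]
    exact integral_congr_ae (Filter.Eventually.of_forall fun z => by simp only [Bx]; ring)
  have sP (φ : 𝓢(ℝ, ℂ)) : ∫ z, b₀ z * wigner h (opP h φ) ψ z = ∫ z, Bp z * wigner h φ ψ z := by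
    rw [h₀.integral_mul_wigner_opP (h₁.mul g₀) (l₀ 0) hh]
  have e (z : PhaseSpace) : b₀ z * wigner h (quadraticOp Q h φ) ψ z =
      (Q 0 0 / 2 : ℂ) * (b₀ z * wigner h (opX (opX φ)) ψ z) +
        (Q 0 1 / 2 : ℂ) * (b₀ z * wigner h (opX (opP h φ)) ψ z) +
        (Q 0 1 / 2 : ℂ) * (b₀ z * wigner h (opP h (opX φ)) ψ z) +
        (Q 1 1 / 2 : ℂ) * (b₀ z * wigner h (opP h (opP h φ)) ψ z) := by
    simp only [quadraticOp_apply, wigner_add_left, wigner_smul_left]; ring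
  have hI (φ : 𝓢(ℝ, ℂ)) (c : ℂ) := (h₀.integrable_mul_wigner hh φ ψ).const_mul c
  have j₁ := ((c₀.mul hBx).add (k'.mul hBxp)).integrable_mul_wigner hh φ ψ
  have j₂ := ((c₁.mul hBx).add (k.mul hBxx)).integrable_mul_wigner hh φ ψ
  have j₃ := ((c₀.mul hBp).add (k'.mul hBpp)).integrable_mul_wigner hh φ ψ
  have j₄ := ((c₁.mul hBp).add (k.mul hBpx)).integrable_mul_wigner hh φ ψ
  simp only [e]
  rw [integral_add (((hI _ _).fun_add (hI _ _)).fun_add (hI _ _)) (hI _ _),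
    integral_add ((hI _ _).fun_add (hI _ _)) (hI _ _), integral_add (hI _ _) (hI _ _),
    integral_const_mul, integral_const_mul, integral_const_mul, integral_const_mul, sX, sX, sP, sP,
    hBx.integral_mul_wigner_opX hBxp lBxp hh, hBx.integral_mul_wigner_opP hBxx lBxx hh,
    hBp.integral_mul_wigner_opX hBpp lBpp hh, hBp.integral_mul_wigner_opP hBpx lBpx hh]
  simp only [sub_eq_add_neg, ← neg_mul]
  rw [← integral_const_mul, ← integral_const_mul, ← integral_const_mul, ← integral_const_mul,
    ← integral_add (j₁.const_mul _) (j₂.const_mul _),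
    ← integral_add ((j₁.const_mul _).fun_add (j₂.const_mul _)) (j₃.const_mul _),
    ← integral_add (((j₁.const_mul _).fun_add (j₂.const_mul _)).fun_add (j₃.const_mul _))
      (j₄.const_mul _)]
  refine integral_congr_ae (Filter.Eventually.of_forall fun z => ?_)
  -- The remaining identity is pointwise; its terms of first order in ħ cancel, since a function of
  -- A Poisson-commutes with A.
  simp only [Bx, Bp, Bxx, Bxp, Bpx, Bpp, det_eq hQ, symbolGrad, hs]
  rw [quadraticSymbol_eq hQ]
  have hI2 : Complex.I ^ 2 = -1 := Complex.I_sq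
  push_cast
  ring_nf
  simp only [hI2]
  ring

/-- Integration by parts with B = 1 shows that `quadraticOp` has symbol A. A symbol fixes all
pairings with Schwartz functions, and the difference of the two images is itself a Schwartz function
to pair with. -/
theorem eq_quadraticOp_of_hasWeylSymbol {Q : Matrix (Fin 2) (Fin 2) ℝ} (hQ : Q.IsSymm) {h : ℝ}
    (hh : 0 < h) {H : 𝓢(ℝ, ℂ) →ₗ[ℂ] 𝓢(ℝ, ℂ)}
    (hH : HasWeylSymbol h (fun φ => (H φ).toLp 2) fun z => (quadraticSymbol Q z : ℂ)) :
    H = quadraticOp Q h := by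
  ext1 φ
  have key (ψ : 𝓢(ℝ, ℂ)) : inner ℂ (ψ.toLp 2 : L2) ((H φ).toLp 2 : L2) =
      inner ℂ (ψ.toLp 2 : L2) ((quadraticOp Q h φ).toLp 2 : L2) := by
    have h0 (z : PhaseSpace) : HasFDerivAt (fun _ : PhaseSpace => (0 : ℂ))
        ((0 : ℂ) • symbolHess Q z) z := 
      (hasFDerivAt_const (0 : ℂ) z).congr_fderiv (zero_smul ℂ (symbolHess Q z)).symm
    have h1 (z : PhaseSpace) : HasFDerivAt (fun _ : PhaseSpace => (1 : ℂ))
        ((0 : ℂ) • symbolHess Q z) z := 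
      (hasFDerivAt_const (1 : ℂ) z).congr_fderiv (zero_smul ℂ (symbolHess Q z)).symm
    have := integral_mul_wigner_quadraticOp hQ (.const 1) (.const 0) (.const 0) h1 h0 hh φ ψ
    rw [(hH φ ψ).2, ← integral_wigner hh]
    simpa using this.symm
  refine eq_of_toLp_eq (sub_eq_zero.1 ?_)
  rw [← inner_self_eq_zero (𝕜 := ℂ)]
  nth_rewrite 1 [← toLp_sub]
  rw [inner_sub_right, key, sub_self]

/-! ### Polynomials of the quadratic operator -/

theorem hasDerivAt_polynomial_eval (f : ℂ[X]) (y : ℝ) :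
    HasDerivAt (fun y : ℝ => f.eval (y : ℂ)) ((Polynomial.derivative f).eval (y : ℂ)) y :=
  (f.hasDerivAt (y : ℂ)).comp_ofReal

theorem contDiff_polynomial_eval (f : ℂ[X]) :
    ContDiff ℝ (⊤ : ℕ∞) fun y : ℝ => f.eval (y : ℂ) := by
  have h1 : ContDiff ℂ (⊤ : ℕ∞) fun y : ℂ => f.eval y := by
    simpa using f.contDiff_aeval (𝕜 := ℂ) ((⊤ : ℕ∞) : WithTop ℕ∞)
  exact (h1.restrict_scalars ℝ).comp Complex.ofRealCLM.contDiff

theorem iteratedDeriv_polynomial_eval (f : ℂ[X]) (k : ℕ) :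
    iteratedDeriv k (fun y : ℝ => f.eval (y : ℂ)) =
      fun y : ℝ => (Polynomial.derivative^[k] f).eval (y : ℂ) := by
  induction k with
  | zero => simp
  | succ k ih =>
    rw [iteratedDeriv_succ, ih, Function.iterate_succ_apply']
    exact funext fun y => (hasDerivAt_polynomial_eval _ y).deriv

theorem PolyGrowth.polynomial_eval {B : PhaseSpace → ℂ} (hB : PolyGrowth B) (f : ℂ[X]) :
    PolyGrowth fun z => f.eval (B z) := by
  simp only [Polynomial.eval_eq_sum_range]
  exact sum fun i _ => (const _).mul (hB.pow i)

theorem PolyGrowth.expOp_polynomial {Q : Matrix (Fin 2) (Fin 2) ℝ} (hQ : Q.IsSymm) (ω : ℂ) (n : ℕ)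
    (ρ : ℂ[X]⟦X⟧) (f : ℂ[X]) : PolyGrowth fun z =>
      expOp ω n ρ (fun y : ℝ => f.eval (y : ℂ)) (QuadSymbol.quadraticSymbol Q z) := by
  have h1 (P : ℂ[X]) : PolyGrowth fun z =>
      diffOp (fun y : ℝ => f.eval (y : ℂ)) (QuadSymbol.quadraticSymbol Q z) P := by
    induction P using Polynomial.induction_on' with
    | add p q hp hq => simpa only [map_add] using hp.add hq
    | monomial k c =>
      simp only [diffOp_monomial, iteratedDeriv_polynomial_eval]
      exact (const c).mul ((PolyGrowth.quadraticSymbol hQ).polynomial_eval _)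
  unfold expOp
  refine sum fun m _ => mul ?_ (h1 _)
  simp only [div_eq_mul_inv]
  exact ((PolyGrowth.quadraticSymbol hQ).pow m).mul (const _)

theorem expOp_secArg_polynomial_eq_zero (ω : ℂ) {n : ℕ} {f : ℂ[X]} (hn : f.natDegree < n) (a : ℝ) :
    expOp ω n (secArg ω) (fun y : ℝ => f.eval (y : ℂ)) a = 0 := by
  refine Finset.sum_eq_zero fun m _ => ?_
  obtain ⟨c, hc⟩ := isHomog_secArg_mul_pow ω m n
  rw [hc, diffOp_monomial, iteratedDeriv_polynomial_eval,
    Polynomial.iterate_derivative_eq_zero (by omega)]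
  simp

theorem HasWeylSymbol.add {h : ℝ} {T T' : 𝓢(ℝ, ℂ) → L2} {B B' : PhaseSpace → ℂ}
    (hT : HasWeylSymbol h T B) (hT' : HasWeylSymbol h T' B') :
    HasWeylSymbol h (fun φ => T φ + T' φ) fun z => B z + B' z := by
  intro φ ψ
  simp only [add_mul]
  refine ⟨(hT φ ψ).1.add (hT' φ ψ).1, ?_⟩
  rw [inner_add_right, (hT φ ψ).2, (hT' φ ψ).2, integral_add (hT φ ψ).1 (hT' φ ψ).1]

theorem hasWeylSymbol_smul_id {h : ℝ} (hh : 0 < h) (c : ℂ) :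
    HasWeylSymbol h (fun φ => (c • φ : 𝓢(ℝ, ℂ)).toLp 2) fun _ => c := by
  intro φ ψ
  refine ⟨(PolyGrowth.const c).integrable_mul_wigner hh φ ψ, ?_⟩
  simp only [toLp_smul]
  rw [inner_smul_right, integral_const_mul, integral_wigner hh]

/-- The symbol of `f(Â)`, truncated at order `N` in `ħ`. -/
def polySymbol (Q : Matrix (Fin 2) (Fin 2) ℝ) (ω : ℂ) (h : ℝ) (N : ℕ) (f : ℂ[X]) (z : PhaseSpace) :
    ℂ :=
  ∑ n ∈ Finset.range N, (h : ℂ) ^ n *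
    expOp ω n (secArg ω) (fun y : ℝ => f.eval (y : ℂ)) (quadraticSymbol Q z)

theorem polySymbol_of_natDegree_lt (Q : Matrix (Fin 2) (Fin 2) ℝ) (ω : ℂ) (h : ℝ) {N : ℕ}
    {f : ℂ[X]} (hN : f.natDegree < N) :
    polySymbol Q ω h N f = polySymbol Q ω h (f.natDegree + 1) f := by
  funext z
  refine (Finset.sum_subset (Finset.range_mono hN) fun n _ hn => ?_).symm
  rw [Finset.mem_range, not_lt] at hn
  rw [expOp_secArg_polynomial_eq_zero ω (by omega), mul_zero]

/-- The truncation grows by two because the second bracket raises the order in ħ by two; the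
superfluous terms are dropped afterwards by degree. -/
theorem hasWeylSymbol_X_mul {Q : Matrix (Fin 2) (Fin 2) ℝ} (hQ : Q.IsSymm) {ω : ℂ}
    (hω : ω ^ 2 = (Q.det : ℂ)) {h : ℝ} (hh : 0 < h) {f : ℂ[X]} {N : ℕ} (hN : f.natDegree < N)
    (hf : HasWeylSymbol h
      (fun φ => ((Polynomial.aeval (quadraticOp Q h) f : Module.End ℂ 𝓢(ℝ, ℂ)) φ).toLp 2)
      (polySymbol Q ω h N f)) :
    HasWeylSymbol h (fun φ =>
        ((Polynomial.aeval (quadraticOp Q h) (Polynomial.X * f) : Module.End ℂ 𝓢(ℝ, ℂ)) φ).toLp 2)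
      (polySymbol Q ω h (N + 2) (Polynomial.X * f)) := by
  -- With ρ left free, the family is closed under differentiation in A: each derivative multiplies ρ
  -- by `tanArg ω`.
  let s (ρ : ℂ[X]⟦X⟧) (z : PhaseSpace) : ℂ := ∑ n ∈ Finset.range N, (h : ℂ) ^ n *
    expOp ω n ρ (fun y : ℝ => f.eval (y : ℂ)) (quadraticSymbol Q z)
  have hs (ρ : ℂ[X]⟦X⟧) : PolyGrowth (s ρ) :=
    .sum fun n _ => (PolyGrowth.const _).mul (.expOp_polynomial hQ ω n ρ f)
  have ds (ρ : ℂ[X]⟦X⟧) (z : PhaseSpace) :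
      HasFDerivAt (s ρ) (s (ρ * tanArg ω) z • symbolHess Q z) z :=
    hasFDerivAt_comp_quadraticSymbol hQ (HasDerivAt.fun_sum fun n _ =>
      (hasDerivAt_expOp ω n ρ (contDiff_polynomial_eval f) (quadraticSymbol Q z)).const_mul
        ((h : ℂ) ^ n))
  have e : polySymbol Q ω h (N + 2) (Polynomial.X * f) = fun z =>
      quadraticSymbol Q z * s (secArg ω) z - h ^ 2 / 4 * Q.det *
        (s (secArg ω * tanArg ω) z + quadraticSymbol Q z *
          s (secArg ω * tanArg ω * tanArg ω) z) := by
    funext z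
    have hc := contDiff_polynomial_eval f
    have h1 : s (secArg ω) z = ∑ n ∈ Finset.range (N + 2), (h : ℂ) ^ n *
        expOp ω n (secArg ω) (fun y : ℝ => f.eval (y : ℂ)) (quadraticSymbol Q z) := by
      refine Finset.sum_subset (Finset.range_mono (by omega)) fun n _ hn => ?_
      rw [Finset.mem_range, not_lt] at hn
      rw [expOp_secArg_polynomial_eq_zero ω (by omega), mul_zero]
    rw [h1, polySymbol]
    simp only [Polynomial.eval_mul, Polynomial.eval_X]
    rw [Finset.sum_range_succ', Finset.sum_range_succ', Finset.sum_range_succ' _ (N + 1),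
      Finset.sum_range_succ' _ N,
      expOp_secArg_coord_mul_of_lt_two ω (by norm_num) hc,
      expOp_secArg_coord_mul_of_lt_two ω (by norm_num) hc]
    have h2 (n : ℕ) : (h : ℂ) ^ (n + 1 + 1) * expOp ω (n + 1 + 1) (secArg ω)
        (fun y : ℝ => (y : ℂ) * f.eval (y : ℂ)) (quadraticSymbol Q z) =
        quadraticSymbol Q z * ((h : ℂ) ^ (n + 1 + 1) * expOp ω (n + 1 + 1) (secArg ω)
          (fun y : ℝ => f.eval (y : ℂ)) (quadraticSymbol Q z)) -
        h ^ 2 / 4 * Q.det * ((h : ℂ) ^ n * expOp ω n (secArg ω * tanArg ω)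
          (fun y : ℝ => f.eval (y : ℂ)) (quadraticSymbol Q z) + quadraticSymbol Q z *
          ((h : ℂ) ^ n * expOp ω n (secArg ω * tanArg ω * tanArg ω)
            (fun y : ℝ => f.eval (y : ℂ)) (quadraticSymbol Q z))) := by
      rw [expOp_secArg_coord_mul ω _ hc, ← hω]
      ring
    simp only [h2, s]
    rw [Finset.sum_sub_distrib, ← Finset.mul_sum, ← Finset.mul_sum, Finset.sum_add_distrib,
      ← Finset.mul_sum]
    ring
  intro φ ψ
  rw [e]
  refine ⟨PolyGrowth.integrable_mul_wigner ?_ hh φ ψ, ?_⟩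
  · simp only [sub_eq_add_neg, ← neg_mul]
    exact ((PolyGrowth.quadraticSymbol hQ).mul (hs _)).add ((PolyGrowth.const _).mul
      ((hs _).add ((PolyGrowth.quadraticSymbol hQ).mul (hs _))))
  · rw [← integral_mul_wigner_quadraticOp hQ (hs _) (hs _) (hs _) (ds _) (ds _) hh,
      -- The product is read as f(Â)Â, so that the hypothesis on f applies to the vector Âφ.
      mul_comm, map_mul, Polynomial.aeval_X]
    exact (hf (quadraticOp Q h φ) ψ).2

theorem hasWeylSymbol_aeval_quadraticOp {Q : Matrix (Fin 2) (Fin 2) ℝ} (hQ : Q.IsSymm) {ω : ℂ}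
    (hω : ω ^ 2 = (Q.det : ℂ)) {h : ℝ} (hh : 0 < h) (f : ℂ[X]) : HasWeylSymbol h
      (fun φ => ((Polynomial.aeval (quadraticOp Q h) f : Module.End ℂ 𝓢(ℝ, ℂ)) φ).toLp 2)
      (polySymbol Q ω h (f.natDegree + 1) f) := by
  have hC (c : ℂ) : HasWeylSymbol h (fun φ => ((Polynomial.aeval (quadraticOp Q h)
      (Polynomial.C c) : Module.End ℂ 𝓢(ℝ, ℂ)) φ).toLp 2)
      (polySymbol Q ω h ((Polynomial.C c).natDegree + 1) (Polynomial.C c)) := by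
    have e1 : polySymbol Q ω h ((Polynomial.C c).natDegree + 1) (Polynomial.C c) = fun _ => c := by
      funext z
      have := expOp_const_mul ω c 0 (secArg ω) (fun _ => 1) (quadraticSymbol Q z)
      simp only [mul_one] at this
      simp [polySymbol, this, expOp_secArg_one]
    rw [e1]
    simpa only [Polynomial.aeval_C, Module.algebraMap_end_apply] using hasWeylSymbol_smul_id hh c
  induction f using Polynomial.induction_on with
  | C c => exact hC c
  | add p q hp hq =>
    let N := max p.natDegree q.natDegree + 1
    have hpN : p.natDegree < N := Nat.lt_succ_of_le (le_max_left _ _)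
    have hqN : q.natDegree < N := Nat.lt_succ_of_le (le_max_right _ _)
    rw [← polySymbol_of_natDegree_lt Q ω h hpN] at hp
    rw [← polySymbol_of_natDegree_lt Q ω h hqN] at hq
    rw [← polySymbol_of_natDegree_lt Q ω h (N := N)
      (Nat.lt_succ_of_le (Polynomial.natDegree_add_le p q))]
    have e : polySymbol Q ω h N (p + q) = fun z => polySymbol Q ω h N p z +
        polySymbol Q ω h N q z := by
      funext z
      simp only [polySymbol, ← Finset.sum_add_distrib, ← mul_add]
      refine Finset.sum_congr rfl fun n _ => ?_
      rw [← expOp_add ω n _ (contDiff_polynomial_eval p) (contDiff_polynomial_eval q)]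
      congr 2
      funext y
      simp
    rw [e]
    convert hp.add hq using 2 with φ
    rw [map_add, LinearMap.add_apply, toLp_add]
  | monomial n c ih =>
    rw [show Polynomial.C c * Polynomial.X ^ (n + 1) =
      Polynomial.X * (Polynomial.C c * Polynomial.X ^ n) by ring]
    have := hasWeylSymbol_X_mul hQ hω hh (Nat.lt_succ_self _) ih
    rwa [polySymbol_of_natDegree_lt] at this
    have := Polynomial.natDegree_mul_le (p := (Polynomial.X : ℂ[X]))
      (q := Polynomial.C c * Polynomial.X ^ n)
    rw [Polynomial.natDegree_X] at this
    omega

/-! ### The evolution symbol at complex times -/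

/-- `tan(Tω/2) / ω` at a complex time `T`, with its limit `T/2` at `ω = 0`. -/
def complexTanQuotient (ω T : ℂ) : ℂ := if ω = 0 then T / 2 else Complex.tan (T * ω / 2) / ω

/-- `sec(Tω/2) exp[(2A/(iħω)) tan(Tω/2)]` at a complex time `T`. -/
def complexEvolutionSymbol (h : ℝ) (ω : ℂ) (A : PhaseSpace → ℝ) (T : ℂ) (z : PhaseSpace) : ℂ :=
  (Complex.cos (T * ω / 2))⁻¹ *
    Complex.exp (2 * (A z : ℂ) / (Complex.I * h) * complexTanQuotient ω T)

theorem evolutionSymbol_eq (h : ℝ) (ω : ℂ) (A : PhaseSpace → ℝ) (t : ℝ) :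
    evolutionSymbol h ω A t = complexEvolutionSymbol h ω A t := rfl

theorem complexEvolutionSymbol_zero (h : ℝ) (ω : ℂ) (A : PhaseSpace → ℝ) (z : PhaseSpace) :
    complexEvolutionSymbol h ω A 0 z = 1 := by
  have : complexTanQuotient ω 0 = 0 := by
    unfold complexTanQuotient; split_ifs <;> simp
  simp [complexEvolutionSymbol, this]

theorem mul_complexTanQuotient (ω T : ℂ) :
    ω * complexTanQuotient ω T = Complex.tan (T * ω / 2) := by
  unfold complexTanQuotient
  split_ifs with h
  · simp [h]
  · field_simp

theorem inv_cos_sq_eq {ω T : ℂ} (hc : Complex.cos (T * ω / 2) ≠ 0) :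
    1 / Complex.cos (T * ω / 2) ^ 2 = 1 + ω ^ 2 * complexTanQuotient ω T ^ 2 := by
  rw [← mul_pow, mul_complexTanQuotient, Complex.tan_eq_sin_div_cos]
  field_simp
  linear_combination - Complex.sin_sq_add_cos_sq (T * ω / 2)

theorem hasDerivAt_complexTanQuotient {ω T : ℂ} (hc : Complex.cos (T * ω / 2) ≠ 0) :
    HasDerivAt (complexTanQuotient ω) ((1 + ω ^ 2 * complexTanQuotient ω T ^ 2) / 2) T := by
  rw [← inv_cos_sq_eq hc]
  by_cases h : ω = 0
  · have : complexTanQuotient ω = fun T => T / 2 := by funext T; simp [complexTanQuotient, h]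
    rw [this]
    exact ((hasDerivAt_id T).div_const 2).congr_deriv (by simp [h])
  · have : complexTanQuotient ω = fun T => Complex.tan (T * ω / 2) / ω := by
      funext T; simp [complexTanQuotient, h]
    rw [this]
    have h1 : HasDerivAt (fun T : ℂ => T * ω / 2) (ω / 2) T := by
      simpa using ((hasDerivAt_id T).mul_const ω).div_const 2
    refine (((Complex.hasDerivAt_tan hc).comp T h1).div_const ω).congr_deriv ?_
    field_simp

theorem hasDerivAt_inv_cos {ω T : ℂ} (hc : Complex.cos (T * ω / 2) ≠ 0) :
    HasDerivAt (fun T => (Complex.cos (T * ω / 2))⁻¹)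
      ((Complex.cos (T * ω / 2))⁻¹ * (ω ^ 2 * complexTanQuotient ω T / 2)) T := by
  have h1 : HasDerivAt (fun T : ℂ => T * ω / 2) (ω / 2) T := by
    simpa using ((hasDerivAt_id T).mul_const ω).div_const 2
  refine (h1.ccos.fun_inv hc).congr_deriv ?_
  have := mul_complexTanQuotient ω T
  rw [Complex.tan_eq_sin_div_cos, eq_div_iff hc] at this
  field_simp
  linear_combination (-ω) * this

/-- The symbol `-(i/ħ) A ⋆ B` for `B` the evolution symbol. -/
theorem hasDerivAt_complexEvolutionSymbol (h : ℝ) {ω T : ℂ} (A : PhaseSpace → ℝ) (z : PhaseSpace)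
    (hc : Complex.cos (T * ω / 2) ≠ 0) :
    HasDerivAt (fun T => complexEvolutionSymbol h ω A T z)
      (complexEvolutionSymbol h ω A T z * (ω ^ 2 * complexTanQuotient ω T / 2 +
        A z / (Complex.I * h) * (1 + ω ^ 2 * complexTanQuotient ω T ^ 2))) T := by
  refine ((hasDerivAt_inv_cos hc).fun_mul
    ((hasDerivAt_complexTanQuotient hc).const_mul (2 * (A z : ℂ) / (Complex.I * h))).cexp).congr_deriv
    ?_
  unfold complexEvolutionSymbol
  ring

/-- Complex times at which the evolution symbol is defined and bounded. -/
structure IsRegularTime (ω : ℂ) (A : PhaseSpace → ℝ) (T : ℂ) : Prop where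
  cos_ne_zero : Complex.cos (T * ω / 2) ≠ 0
  mul_im_nonpos : ∀ z, A z * (complexTanQuotient ω T).im ≤ 0

theorem IsRegularTime.norm_complexEvolutionSymbol_le {ω T : ℂ} {A : PhaseSpace → ℝ}
    (hT : IsRegularTime ω A T) {h : ℝ} (hh : 0 < h) (z : PhaseSpace) :
    ‖complexEvolutionSymbol h ω A T z‖ ≤ ‖(Complex.cos (T * ω / 2))⁻¹‖ := by
  rw [complexEvolutionSymbol, norm_mul]
  refine mul_le_of_le_one_right (norm_nonneg _) ?_
  rw [Complex.norm_exp, Real.exp_le_one_iff]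
  -- The real part of the exponent is (2/ħ) A times the imaginary part of the tangent quotient.
  have e : 2 * (A z : ℂ) / (Complex.I * h) * complexTanQuotient ω T =
      ((2 / h : ℝ) : ℂ) * (((A z : ℝ) : ℂ) * (-Complex.I * complexTanQuotient ω T)) := by
    rw [div_mul_eq_div_div, Complex.div_I]
    push_cast; ring
  rw [e, Complex.re_ofReal_mul, Complex.re_ofReal_mul]
  have : (-Complex.I * complexTanQuotient ω T).re = (complexTanQuotient ω T).im := by simp
  rw [this]
  exact mul_nonpos_of_nonneg_of_nonpos (by positivity) (hT.mul_im_nonpos z)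

/-- As ω² is real, conjugation fixes ω or changes its sign, and tan(Tω/2)/ω is even in ω. The
quotient is therefore real at real times, and the exponential there has modulus 1. -/
theorem complexTanQuotient_conj {ω : ℂ} {d : ℝ} (hω : ω ^ 2 = d) (T : ℂ) :
    complexTanQuotient ω ((starRingEnd ℂ) T) = (starRingEnd ℂ) (complexTanQuotient ω T) := by
  have hs : (starRingEnd ℂ) ω ^ 2 = ω ^ 2 := by rw [← map_pow, hω, Complex.conj_ofReal]
  have hcase : (starRingEnd ℂ) ω = ω ∨ (starRingEnd ℂ) ω = -ω := sq_eq_sq_iff_eq_or_eq_neg.1 hs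
  unfold complexTanQuotient
  split_ifs with h
  · rw [map_div₀, map_ofNat]
  · rw [map_div₀, ← Complex.tan_conj, map_div₀, map_mul, map_ofNat]
    rcases hcase with h1 | h1 <;> rw [h1]
    rw [mul_neg, neg_div, Complex.tan_neg, neg_div_neg_eq]

theorem isRegularTime_ofReal {ω : ℂ} {d : ℝ} (hω : ω ^ 2 = d) (A : PhaseSpace → ℝ) {t : ℝ}
    (hc : Complex.cos (t * ω / 2) ≠ 0) : IsRegularTime ω A t := by
  refine ⟨hc, fun z => ?_⟩
  have := complexTanQuotient_conj hω (t : ℂ)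
  rw [Complex.conj_ofReal] at this
  rw [Complex.conj_eq_iff_im.1 this.symm, mul_zero]

/-- This gives the sign of Im tan w, which is that of Im w, and shows that the cosine has no zeros
off the real axis. -/
theorem sin_mul_conj_cos_im (w : ℂ) :
    (Complex.sin w * (starRingEnd ℂ) (Complex.cos w)).im = Real.sinh w.im * Real.cosh w.im := by
  have hs : Complex.sin w = (Real.sin w.re * Real.cosh w.im : ℝ) +
      (Real.cos w.re * Real.sinh w.im : ℝ) * Complex.I := by
    rw [Complex.sin_eq]; push_cast; rfl
  have hc : Complex.cos w = (Real.cos w.re * Real.cosh w.im : ℝ) +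
      (-(Real.sin w.re * Real.sinh w.im) : ℝ) * Complex.I := by
    rw [Complex.cos_eq]; push_cast; ring
  have e1 := congrArg Complex.re hs
  have e2 := congrArg Complex.im hs
  have e3 := congrArg Complex.re hc
  have e4 := congrArg Complex.im hc
  simp only [Complex.add_re, Complex.add_im, Complex.re_ofReal_mul, Complex.im_ofReal_mul,
    Complex.ofReal_re, Complex.ofReal_im, Complex.I_re, Complex.I_im, mul_zero, mul_one, add_zero,
    zero_add] at e1 e2 e3 e4
  rw [Complex.mul_im, Complex.conj_re, Complex.conj_im, e1, e2, e3, e4]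
  linear_combination Real.sinh w.im * Real.cosh w.im * Real.sin_sq_add_cos_sq w.re

theorem cos_ne_zero_of_im_ne_zero {w : ℂ} (hw : w.im ≠ 0) : Complex.cos w ≠ 0 := by
  intro h
  have := sin_mul_conj_cos_im w
  rw [h, map_zero, mul_zero, Complex.zero_im, eq_comm, mul_eq_zero] at this
  exact this.elim (fun h => hw (Real.sinh_eq_zero.1 h)) (Real.cosh_pos _).ne'

theorem tan_im_eq (w : ℂ) :
    (Complex.tan w).im = Real.sinh w.im * Real.cosh w.im / Complex.normSq (Complex.cos w) := by
  rw [← sin_mul_conj_cos_im, Complex.tan_eq_sin_div_cos, div_eq_mul_inv, Complex.inv_def,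
    ← mul_assoc, Complex.im_mul_ofReal, div_eq_mul_inv]

/-- For a definite symbol, the times in one of the half-planes bounded by the real axis are
regular. -/
theorem isRegularTime_of_im_ne_zero {ω : ℂ} {d : ℝ} (hd : 0 < d) (hω : ω ^ 2 = d)
    {A : PhaseSpace → ℝ} {T : ℂ} (hT : T.im ≠ 0) (hA : ∀ z, A z * T.im ≤ 0) :
    IsRegularTime ω A T := by
  obtain ⟨r, rfl⟩ : ∃ r : ℝ, (r : ℂ) = ω := by
    have h1 : ω ^ 2 = ((√d : ℝ) : ℂ) ^ 2 := by
      rw [hω, ← Complex.ofReal_pow, Real.sq_sqrt hd.le]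
    rcases sq_eq_sq_iff_eq_or_eq_neg.1 h1 with h | h
    · exact ⟨√d, h.symm⟩
    · exact ⟨-√d, by rw [h]; push_cast; rfl⟩
  have hr : r ≠ 0 := by
    rintro rfl
    norm_num at hω
    exact hd.ne (by exact_mod_cast hω)
  have him : (T * r / 2).im = T.im * r / 2 := by
    rw [show T * r / 2 = T * ((r / 2 : ℝ) : ℂ) by push_cast; ring, Complex.im_mul_ofReal]; ring
  have hne : (T * r / 2).im ≠ 0 := by rw [him]; positivity
  refine ⟨cos_ne_zero_of_im_ne_zero hne, fun z => ?_⟩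
  have hq : (complexTanQuotient r T).im = (Complex.tan (T * r / 2)).im / r := by
    rw [complexTanQuotient, if_neg (by exact_mod_cast hr), Complex.div_ofReal_im]
  have hs : ∃ c, 0 ≤ c ∧ Real.sinh (T.im * r / 2) = c * (T.im * r) := by
    rcases lt_or_gt_of_ne (mul_ne_zero hT hr) with h | h
    · refine ⟨Real.sinh (T.im * r / 2) / (T.im * r), div_nonneg_of_nonpos
        (Real.sinh_nonpos_iff.2 (by linarith)) h.le, by field_simp⟩
    · refine ⟨Real.sinh (T.im * r / 2) / (T.im * r), div_nonneg
        (Real.sinh_nonneg_iff.2 (by linarith)) h.le, by field_simp⟩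
  obtain ⟨c, hc, hs⟩ := hs
  rw [hq, tan_im_eq, him, hs]
  have e : A z * (c * (T.im * r) * Real.cosh (T.im * r / 2) /
      Complex.normSq (Complex.cos (T * r / 2)) / r) = (A z * T.im) *
      (c * Real.cosh (T.im * r / 2) / Complex.normSq (Complex.cos (T * r / 2))) := by
    field_simp
  rw [e]
  exact mul_nonpos_of_nonpos_of_nonneg (hA z) (div_nonneg (mul_nonneg hc (Real.cosh_pos _).le)
    (Complex.normSq_nonneg _))

/-- A quadratic symbol with positive determinant is definite. -/
theorem exists_sign_mul_quadraticSymbol {Q : Matrix (Fin 2) (Fin 2) ℝ} (hQ : Q.IsSymm)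
    (hd : 0 < Q.det) : ∃ σ : ℝ, |σ| = 1 ∧ ∀ z, 0 ≤ quadraticSymbol Q z * σ := by
  have hdet := det_eq hQ
  have hne : Q 0 0 ≠ 0 := by rintro h; rw [hdet, h] at hd; nlinarith [sq_nonneg (Q 0 1)]
  have key (z : PhaseSpace) : 0 ≤ Q 0 0 * quadraticSymbol Q z := by
    rw [quadraticSymbol_eq hQ]
    rw [hdet] at hd
    nlinarith [sq_nonneg (Q 0 0 * z 0 + Q 0 1 * z 1), mul_nonneg hd.le (sq_nonneg (z 1))]
  rcases lt_or_gt_of_ne hne with h | h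
  · exact ⟨-1, by simp, fun z => by nlinarith [key z]⟩
  · exact ⟨1, by simp, fun z => by nlinarith [key z]⟩

/-! ### Weyl forms -/

/-- `⟨ψ, T φ⟩` for the operator `T` with Weyl symbol `B`. -/
def weylForm (h : ℝ) (B : PhaseSpace → ℂ) (φ ψ : 𝓢(ℝ, ℂ)) : ℂ := ∫ z, B z * wigner h φ ψ z

theorem weylForm_one {h : ℝ} (hh : 0 < h) (φ ψ : 𝓢(ℝ, ℂ)) :
    weylForm h (fun _ => 1) φ ψ = inner ℂ (ψ.toLp 2 volume : L2) (φ.toLp 2 volume : L2) := by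
  simp only [weylForm, one_mul]
  exact integral_wigner hh φ ψ

theorem weylForm_smul_left (h : ℝ) (B : PhaseSpace → ℂ) (c : ℂ) (φ ψ : 𝓢(ℝ, ℂ)) :
    weylForm h B (c • φ) ψ = c * weylForm h B φ ψ := by
  rw [weylForm, weylForm, ← integral_const_mul]
  simp only [wigner_smul_left, mul_left_comm]

/-- A common bound for `‖Pʲ Xⁱ φ‖_∞`, `i, j ≤ 2`. -/
def IsSchwartzBound (h : ℝ) (φ : 𝓢(ℝ, ℂ)) (M : ℝ) : Prop :=
  ∀ i ≤ 2, ∀ j ≤ 2, ∀ x, ‖((opP h ^ j) ((opX ^ i) φ)) x‖ ≤ M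

theorem IsSchwartzBound.smul {h M : ℝ} {φ : 𝓢(ℝ, ℂ)} (hφ : IsSchwartzBound h φ M) (c : ℂ) :
    IsSchwartzBound h (c • φ) (‖c‖ * M) := by
  intro i hi j hj x
  rw [map_smul, map_smul, smul_apply, norm_smul]
  exact mul_le_mul_of_nonneg_left (hφ i hi j hj x) (norm_nonneg c)

/-- One constant serves all bounded symbols and all φ. The second moments in `IsSchwartzBound` are
exactly what makes W(φ, ψ) dominated by the integrable inverse weight. -/
theorem norm_weylForm_le {h : ℝ} (hh : 0 < h) (ψ : 𝓢(ℝ, ℂ)) : ∃ C, 0 ≤ C ∧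
    ∀ (B : PhaseSpace → ℂ) (b : ℝ), (∀ z, ‖B z‖ ≤ b) → ∀ (φ : 𝓢(ℝ, ℂ)) (M : ℝ),
      IsSchwartzBound h φ M → ‖weylForm h B φ ψ‖ ≤ C * b * M := by
  obtain ⟨C, hC, H⟩ := norm_weight_mul_wigner_le hh ψ
  refine ⟨C * ∫ z, (weight z)⁻¹, mul_nonneg hC integral_inv_weight_nonneg,
    fun B b hb φ M hM => ?_⟩
  have hb0 : 0 ≤ b := (norm_nonneg _).trans (hb 0)
  have e : C * (∫ z, (weight z)⁻¹) * b * M = ∫ z, b * (C * M) * (weight z)⁻¹ := by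
    rw [integral_const_mul]; ring
  rw [e]
  refine norm_integral_le_of_norm_le (integrable_inv_weight.const_mul _)
    (Filter.Eventually.of_forall fun z => ?_)
  have hw : 0 < weight z := one_pos.trans_le (one_le_weight z)
  rw [norm_mul, mul_assoc]
  refine mul_le_mul (hb z) ?_ (norm_nonneg _) hb0
  rw [← div_eq_mul_inv, le_div_iff₀ hw, mul_comm]
  exact H φ M hM z

/-! ### Differentiation under the integral sign on a convex set of parameters -/

/-- One-sided derivatives at the end points matter: segments of regular times may start on the
boundary of the half-plane of regular times. The mean value inequality bounds the slopes, and
dominated convergence does the rest. -/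
theorem hasDerivWithinAt_integral_of_dominated {α : Type*} [MeasurableSpace α] {μ : Measure α}
    {F F' : ℝ → α → ℂ} {bound : α → ℝ} {s : Set ℝ} (hs : Convex ℝ s)
    (hF : ∀ θ ∈ s, Integrable (F θ) μ) (hbound : Integrable bound μ)
    (hd : ∀ a, ∀ θ ∈ s, HasDerivWithinAt (fun θ => F θ a) (F' θ a) s θ)
    (hb : ∀ a, ∀ θ ∈ s, ‖F' θ a‖ ≤ bound a) {θ : ℝ} (hθ : θ ∈ s) :
    HasDerivWithinAt (fun θ => ∫ a, F θ a ∂μ) (∫ a, F' θ a ∂μ) s θ := by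
  rw [hasDerivWithinAt_iff_tendsto_slope]
  have h1 : ∀ᶠ y in 𝓝[s \ {θ}] θ, y ∈ s \ {θ} := self_mem_nhdsWithin
  have key := tendsto_integral_filter_of_dominated_convergence (μ := μ)
    (F := fun y a => slope (fun θ => F θ a) θ y) (f := F' θ) bound (l := 𝓝[s \ {θ}] θ)
    (h1.mono fun y hy => (((hF y hy.1).sub (hF θ hθ)).const_mul _).aestronglyMeasurable)
    (h1.mono fun y hy => Eventually.of_forall fun a => ?_) hbound
    (Eventually.of_forall fun a => hasDerivWithinAt_iff_tendsto_slope.1 (hd a θ hθ))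
  · refine key.congr' (h1.mono fun y hy => ?_)
    simp only [slope_def_module]
    rw [integral_smul, integral_sub (hF y hy.1) (hF θ hθ)]
  · have h2 := hs.norm_image_sub_le_of_norm_hasDerivWithin_le (hd a) (hb a) hθ hy.1
    have h3 : 0 < ‖y - θ‖ := norm_pos_iff.2 (sub_ne_zero.2 hy.2)
    rw [slope_def_module, norm_smul, norm_inv, inv_mul_le_iff₀ h3, mul_comm]
    exact h2

/-! ### The Schrödinger equation for the evolution symbol -/

/-- `-(i/ħ) Â`. -/
def generator (Q : Matrix (Fin 2) (Fin 2) ℝ) (h : ℝ) : 𝓢(ℝ, ℂ) →ₗ[ℂ] 𝓢(ℝ, ℂ) :=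
  (-Complex.I / (h : ℂ)) • quadraticOp Q h

variable {Q : Matrix (Fin 2) (Fin 2) ℝ} {ω : ℂ} {h : ℝ}

theorem hasFDerivAt_complexEvolutionSymbol (hQ : Q.IsSymm) (h : ℝ) (ω T : ℂ) (z : PhaseSpace) :
    HasFDerivAt (complexEvolutionSymbol h ω (quadraticSymbol Q) T)
      ((2 / (Complex.I * h) * complexTanQuotient ω T *
        complexEvolutionSymbol h ω (quadraticSymbol Q) T z) • symbolHess Q z) z := by
  have h1 (y : ℝ) : HasDerivAt (fun y : ℝ => (Complex.cos (T * ω / 2))⁻¹ *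
      Complex.exp (2 * (y : ℂ) / (Complex.I * h) * complexTanQuotient ω T))
      (2 / (Complex.I * h) * complexTanQuotient ω T * ((Complex.cos (T * ω / 2))⁻¹ *
      Complex.exp (2 * (y : ℂ) / (Complex.I * h) * complexTanQuotient ω T))) y := by
    have h2 : HasDerivAt (fun y : ℝ => 2 * (y : ℂ) / (Complex.I * h) * complexTanQuotient ω T)
        (2 * 1 / (Complex.I * h) * complexTanQuotient ω T) y :=
      ((Complex.ofRealCLM.hasDerivAt.const_mul 2).div_const _).mul_const _
    exact (h2.cexp.const_mul _).congr_deriv (by ring)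
  exact hasFDerivAt_comp_quadraticSymbol hQ (h1 _)

theorem continuous_complexEvolutionSymbol (hQ : Q.IsSymm) (h : ℝ) (ω T : ℂ) :
    Continuous (complexEvolutionSymbol h ω (quadraticSymbol Q) T) :=
  continuous_iff_continuousAt.2 fun z =>
    (hasFDerivAt_complexEvolutionSymbol hQ h ω T z).continuousAt

theorem IsRegularTime.polyGrowth (hQ : Q.IsSymm) (hh : 0 < h) {T : ℂ}
    (hT : IsRegularTime ω (quadraticSymbol Q) T) :
    PolyGrowth (complexEvolutionSymbol h ω (quadraticSymbol Q) T) :=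
  .of_norm_le (continuous_complexEvolutionSymbol hQ h ω T) (hT.norm_complexEvolutionSymbol_le hh)

/-- Differentiating the symbol in A only multiplies it by a constant, so the Moyal product is
explicit; the integrand is precisely its time derivative from `hasDerivAt_complexEvolutionSymbol`.
-/
theorem weylForm_evolution_generator (hQ : Q.IsSymm) (hω : ω ^ 2 = (Q.det : ℂ)) (hh : 0 < h)
    {T : ℂ} (hT : IsRegularTime ω (quadraticSymbol Q) T) (φ ψ : 𝓢(ℝ, ℂ)) :
    weylForm h (complexEvolutionSymbol h ω (quadraticSymbol Q) T) (generator Q h φ) ψ =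
      ∫ z, complexEvolutionSymbol h ω (quadraticSymbol Q) T z *
        (ω ^ 2 * complexTanQuotient ω T / 2 + quadraticSymbol Q z / (Complex.I * h) *
          (1 + ω ^ 2 * complexTanQuotient ω T ^ 2)) * wigner h φ ψ z := by
  have hhc : (h : ℂ) ≠ 0 := by exact_mod_cast hh.ne'
  have hI := Complex.I_ne_zero
  have b₀ := hT.polyGrowth hQ hh
  have b₁ := (PolyGrowth.const (2 / (Complex.I * h) * complexTanQuotient ω T)).mul b₀
  have b₂ := (PolyGrowth.const (2 / (Complex.I * h) * complexTanQuotient ω T)).mul b₁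
  have d₀ := hasFDerivAt_complexEvolutionSymbol hQ h ω T
  have d₁ (z : PhaseSpace) := ((d₀ z).const_mul
    (2 / (Complex.I * h) * complexTanQuotient ω T)).congr_fderiv (smul_smul _ _ _)
  rw [generator, LinearMap.smul_apply, weylForm_smul_left, weylForm,
    integral_mul_wigner_quadraticOp hQ b₀ b₁ b₂ d₀ d₁ hh, ← integral_const_mul, ← hω]
  refine integral_congr_ae (Eventually.of_forall fun z => ?_)
  have h2 : Complex.I ^ 2 = -1 := Complex.I_sq
  have h3 : (Complex.I)⁻¹ = -Complex.I := Complex.inv_I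
  simp only [div_eq_mul_inv, mul_inv, h3]
  field_simp
  ring_nf
  simp only [h2, show Complex.I ^ 3 = -Complex.I by rw [pow_succ, h2]; ring]
  ring

theorem hasDerivWithinAt_weylForm_evolution (hQ : Q.IsSymm) (hω : ω ^ 2 = (Q.det : ℂ))
    (hh : 0 < h) {T₀ Δ : ℂ}
    (hT : ∀ θ ∈ Icc (0 : ℝ) 1, IsRegularTime ω (quadraticSymbol Q) (T₀ + θ * Δ))
    (φ ψ : 𝓢(ℝ, ℂ)) {θ : ℝ} (hθ : θ ∈ Icc (0 : ℝ) 1) :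
    HasDerivWithinAt
      (fun θ : ℝ => weylForm h (complexEvolutionSymbol h ω (quadraticSymbol Q) (T₀ + θ * Δ)) φ ψ)
      (weylForm h (complexEvolutionSymbol h ω (quadraticSymbol Q) (T₀ + θ * Δ))
        ((Δ • generator Q h) φ) ψ) (Icc 0 1) θ := by
  have hhc : (h : ℂ) ≠ 0 := by exact_mod_cast hh.ne'
  have hpath (θ : ℝ) : HasDerivAt (fun θ : ℝ => T₀ + θ * Δ) Δ θ := by
    simpa using (Complex.ofRealCLM.hasDerivAt (x := θ)).mul_const Δ |>.const_add T₀
  have hpc : Continuous fun θ : ℝ => T₀ + θ * Δ :=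
    continuous_iff_continuousAt.2 fun θ => (hpath θ).continuousAt
  have hsec : ContinuousOn (fun θ : ℝ => (Complex.cos ((T₀ + θ * Δ) * ω / 2))⁻¹) (Icc 0 1) :=
    fun θ hθ => ((hasDerivAt_inv_cos (hT θ hθ).cos_ne_zero).continuousAt.comp
      (f := fun θ : ℝ => T₀ + θ * Δ) hpc.continuousAt).continuousWithinAt
  have htan : ContinuousOn (fun θ : ℝ => complexTanQuotient ω (T₀ + θ * Δ)) (Icc 0 1) :=
    fun θ hθ => ((hasDerivAt_complexTanQuotient (hT θ hθ).cos_ne_zero).continuousAt.comp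
      (f := fun θ : ℝ => T₀ + θ * Δ) hpc.continuousAt).continuousWithinAt
  obtain ⟨a, ha⟩ := isCompact_Icc.exists_bound_of_continuousOn hsec
  obtain ⟨b, hb⟩ := isCompact_Icc.exists_bound_of_continuousOn
    (f := fun θ : ℝ => ω ^ 2 * complexTanQuotient ω (T₀ + θ * Δ) / 2) (by fun_prop)
  obtain ⟨c, hc⟩ := isCompact_Icc.exists_bound_of_continuousOn
    (f := fun θ : ℝ => 1 / (Complex.I * h) *
      (1 + ω ^ 2 * complexTanQuotient ω (T₀ + θ * Δ) ^ 2)) (by fun_prop)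
  have ha0 : 0 ≤ a := (norm_nonneg _).trans (ha 0 (by simp))
  have hA := ((PolyGrowth.quadraticSymbol hQ).integrable_mul_wigner hh φ ψ).norm
  have hW := ((PolyGrowth.const 1).integrable_mul_wigner hh φ ψ).norm
  have key := hasDerivWithinAt_integral_of_dominated (μ := volume) (convex_Icc (0 : ℝ) 1)
    (F := fun θ z => complexEvolutionSymbol h ω (quadraticSymbol Q) (T₀ + θ * Δ) z * wigner h φ ψ z)
    (F' := fun θ z => Δ * (complexEvolutionSymbol h ω (quadraticSymbol Q) (T₀ + θ * Δ) z *
        (ω ^ 2 * complexTanQuotient ω (T₀ + θ * Δ) / 2 + quadraticSymbol Q z / (Complex.I * h) *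
          (1 + ω ^ 2 * complexTanQuotient ω (T₀ + θ * Δ) ^ 2)) * wigner h φ ψ z))
    (bound := fun z => (‖Δ‖ * a) * (b * ‖1 * wigner h φ ψ z‖ +
      c * ‖(quadraticSymbol Q z : ℂ) * wigner h φ ψ z‖))
    (fun θ hθ => ((hT θ hθ).polyGrowth hQ hh).integrable_mul_wigner hh φ ψ)
    (((hW.const_mul b).fun_add (hA.const_mul c)).const_mul _) (fun z θ hθ => ?_)
    (fun z θ hθ => ?_) hθ
  · refine key.congr_deriv ?_
    rw [integral_const_mul, ← weylForm_evolution_generator hQ hω hh (hT θ hθ), LinearMap.smul_apply,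
      weylForm_smul_left]
  · have h1 := (hasDerivAt_complexEvolutionSymbol h (quadraticSymbol Q) z
      (hT θ hθ).cos_ne_zero).comp θ (hpath θ)
    exact ((h1.mul_const (wigner h φ ψ z)).congr_deriv (by ring)).hasDerivWithinAt
  · have h1 := ((hT θ hθ).norm_complexEvolutionSymbol_le hh z).trans (ha θ hθ)
    have h2 : ‖ω ^ 2 * complexTanQuotient ω (T₀ + θ * Δ) / 2 +
        quadraticSymbol Q z / (Complex.I * h) *
          (1 + ω ^ 2 * complexTanQuotient ω (T₀ + θ * Δ) ^ 2)‖ ≤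
        b + c * ‖(quadraticSymbol Q z : ℂ)‖ := by
      refine (norm_add_le _ _).trans (add_le_add (hb θ hθ) ?_)
      rw [div_eq_mul_one_div, mul_assoc, norm_mul, mul_comm]
      exact mul_le_mul_of_nonneg_right (hc θ hθ) (norm_nonneg _)
    rw [norm_mul, norm_mul, norm_mul]
    calc _ ≤ ‖Δ‖ * (a * (b + c * ‖(quadraticSymbol Q z : ℂ)‖) * ‖wigner h φ ψ z‖) := by
          gcongr
      _ = _ := by rw [norm_mul, norm_mul, norm_one]; ring

/-! ### Taylor series -/

/-- The derivative of ∑ (1 - θ)ⁿ fₙ(θ)/n! telescopes to its last term. That sum is the Taylor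
polynomial at θ = 0 and f₀(1) at θ = 1, so the mean value inequality bounds the error by M (N + 1)
q^(N + 1). -/
theorem hasSum_of_hasDerivWithinAt_succ {f : ℕ → ℝ → ℂ} {M q : ℝ} (hq₀ : 0 ≤ q) (hq : q < 1)
    (hd : ∀ n, ∀ θ ∈ Icc (0 : ℝ) 1, HasDerivWithinAt (f n) (f (n + 1) θ) (Icc 0 1) θ)
    (hb : ∀ n, ∀ θ ∈ Icc (0 : ℝ) 1, ‖f n θ‖ ≤ M * q ^ n * n.factorial) :
    HasSum (fun n => f n 0 / n.factorial) (f 0 1) := by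
  have hM : 0 ≤ M := by simpa using (norm_nonneg _).trans (hb 0 0 (by simp))
  have hfac (n : ℕ) : (0 : ℝ) < n.factorial := by exact_mod_cast n.factorial_pos
  have hfac' (n : ℕ) : (n.factorial : ℂ) ≠ 0 := by exact_mod_cast n.factorial_ne_zero
  have hsum : Summable fun n => f n 0 / n.factorial := by
    refine Summable.of_norm_bounded ((summable_geometric_of_lt_one hq₀ hq).mul_left M) fun n => ?_
    rw [norm_div, Complex.norm_natCast, div_le_iff₀ (hfac n)]
    exact hb n 0 (by simp)
  have hder (N : ℕ) (θ : ℝ) (hθ : θ ∈ Icc (0 : ℝ) 1) : HasDerivWithinAt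
      (fun θ : ℝ => ∑ n ∈ Finset.range (N + 1), (1 - θ : ℂ) ^ n / n.factorial * f n θ)
      ((1 - θ : ℂ) ^ N / N.factorial * f (N + 1) θ) (Icc 0 1) θ := by
    have h1 : HasDerivWithinAt (fun θ : ℝ => (1 - θ : ℂ)) (-1) (Icc 0 1) θ :=
      (Complex.ofRealCLM.hasDerivAt.const_sub 1).hasDerivWithinAt
    induction N with
    | zero => simpa using hd 0 θ hθ
    | succ N ih =>
      simp only [Finset.sum_range_succ _ (N + 1)]
      refine (ih.fun_add (((h1.fun_pow (N + 1)).div_const _).fun_mul (hd (N + 1) θ hθ))).congr_deriv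
        ?_
      rw [Nat.factorial_succ]
      have := hfac' N
      have : (N + 1 : ℂ) ≠ 0 := by exact_mod_cast N.succ_ne_zero
      push_cast
      field_simp
      simp
  have hle (N : ℕ) : ‖f 0 1 - ∑ n ∈ Finset.range (N + 1), f n 0 / n.factorial‖ ≤
      M * (((N + 1 : ℕ) : ℝ) * q ^ (N + 1)) := by
    have key := norm_image_sub_le_of_norm_deriv_le_segment_01' (hder N)
      (C := M * (((N + 1 : ℕ) : ℝ) * q ^ (N + 1))) fun θ hθ => ?_
    · have e1 : ∑ n ∈ Finset.range (N + 1), (1 - (1 : ℝ) : ℂ) ^ n / n.factorial * f n 1 = f 0 1 := by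
        rw [Finset.sum_range_succ']
        simp
      have e2 : ∑ n ∈ Finset.range (N + 1), (1 - (0 : ℝ) : ℂ) ^ n / n.factorial * f n 0 =
          ∑ n ∈ Finset.range (N + 1), f n 0 / n.factorial :=
        Finset.sum_congr rfl fun n _ => by simp [div_eq_inv_mul]
      rwa [e1, e2] at key
    · have h1 : ‖(1 - θ : ℂ) ^ N‖ ≤ 1 := by
        rw [norm_pow, ← Complex.ofReal_one, ← Complex.ofReal_sub, Complex.norm_real]
        refine pow_le_one₀ (norm_nonneg _) ?_
        rw [Real.norm_eq_abs, abs_le]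
        constructor <;> linarith [hθ.1, hθ.2]
      rw [norm_mul, norm_div, Complex.norm_natCast]
      calc _ ≤ 1 / (N.factorial : ℝ) * (M * q ^ (N + 1) * (N + 1).factorial) := by
            gcongr
            exact hb _ θ (Ico_subset_Icc_self hθ)
        _ = _ := by
            rw [Nat.factorial_succ]
            have := (hfac N).ne'
            push_cast
            field_simp
  rw [hsum.hasSum_iff_tendsto_nat, ← tendsto_add_atTop_iff_nat 1, tendsto_iff_norm_sub_tendsto_zero]
  have h0 : Tendsto (fun N : ℕ => M * (((N + 1 : ℕ) : ℝ) * q ^ (N + 1))) atTop (𝓝 0) := by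
    simpa using ((tendsto_self_mul_const_pow_of_lt_one hq₀ hq).comp (tendsto_add_atTop_nat 1)).const_mul M
  refine squeeze_zero (fun _ => norm_nonneg _) (fun N => ?_) h0
  rw [norm_sub_rev]
  exact hle N

/-! ### Analytic vectors -/

theorem norm_toLp_le {φ : 𝓢(ℝ, ℂ)} {M : ℝ} (hφ : IsSchwartzBound h φ M) :
    ‖(φ.toLp 2 volume : L2)‖ ≤ 4 * M := by
  have hM : 0 ≤ M := (norm_nonneg _).trans (hφ 0 (by norm_num) 0 (by norm_num) 0)
  have h1 (x : ℝ) : (1 + x ^ 2) * ‖φ x‖ ≤ 2 * M := by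
    have h0 := hφ 0 (by norm_num) 0 (by norm_num) x
    have h2 := hφ 2 (by norm_num) 0 (by norm_num) x
    simp only [pow_zero, Module.End.one_apply, pow_two, Module.End.mul_apply, opX_apply, norm_mul,
      Complex.norm_real, Real.norm_eq_abs, ← mul_assoc, abs_mul_abs_self] at h0 h2
    nlinarith
  have h2 : ‖(φ.toLp 2 volume : L2)‖ ^ 2 ≤ ∫ x : ℝ, 4 * M ^ 2 * (1 + x ^ 2)⁻¹ := by
    have e := SchwartzMap.inner_toL2_toL2_eq φ φ
    rw [inner_self_eq_norm_sq_to_K] at e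
    have e' := congrArg norm e
    rw [norm_pow, RCLike.norm_ofReal, abs_of_nonneg (norm_nonneg _)] at e'
    refine e'.le.trans (norm_integral_le_of_norm_le (integrable_inv_one_add_sq.const_mul _)
      (Eventually.of_forall fun x => ?_))
    rw [inner_self_eq_norm_sq_to_K, norm_pow, RCLike.norm_ofReal, abs_of_nonneg (norm_nonneg _),
      ← div_eq_mul_inv, le_div_iff₀ (by positivity)]
    -- The integrand is |φ|² and (1 + x²)|φ|² ≤ (2M)²; integrating gives 4πM² ≤ (4M)².
    have h3 := h1 x
    have h4 : ‖φ x‖ ≤ 2 * M := le_trans (by nlinarith [norm_nonneg (φ x), sq_nonneg x]) h3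
    nlinarith [norm_nonneg (φ x)]
  rw [integral_const_mul, integral_univ_inv_one_add_sq] at h2
  refine abs_le_of_sq_le_sq' (h2.trans ?_) (by positivity) |>.2
  nlinarith [Real.pi_le_four, sq_nonneg M]

/-- Vectors on which the Taylor series of the evolution converges up to time `1/R`. -/
def IsAnalyticVector (Q : Matrix (Fin 2) (Fin 2) ℝ) (h R : ℝ) (φ : 𝓢(ℝ, ℂ)) : Prop :=
  ∃ M, ∀ n, IsSchwartzBound h ((generator Q h ^ n) φ) (M * R ^ n * n.factorial)

/-- From (n + m)! ≤ 2^(n + m) n! m!, all iterates share the radius 1/(2R), whatever m is.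
Continuation in time can thus proceed with a fixed step. -/
theorem IsAnalyticVector.iterate {R : ℝ} (hR : 0 ≤ R) {φ : 𝓢(ℝ, ℂ)}
    (hφ : IsAnalyticVector Q h R φ) (m : ℕ) :
    IsAnalyticVector Q h (2 * R) ((generator Q h ^ m) φ) := by
  obtain ⟨M, hM⟩ := hφ
  have hM0 : 0 ≤ M := by
    simpa using (norm_nonneg _).trans (hM 0 0 (by norm_num) 0 (by norm_num) 0)
  refine ⟨M * (2 * R) ^ m * m.factorial, fun n i hi j hj x => ?_⟩
  rw [← Module.End.mul_apply (generator Q h ^ n), ← pow_add]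
  refine (hM (n + m) i hi j hj x).trans ?_
  have h1 : ((n + m).factorial : ℝ) ≤ 2 ^ (n + m) * n.factorial * m.factorial := by
    rw [← Nat.add_choose_mul_factorial_mul_factorial n m]
    push_cast
    gcongr
    exact_mod_cast Nat.choose_le_two_pow _ _
  calc M * R ^ (n + m) * (n + m).factorial
      ≤ M * R ^ (n + m) * (2 ^ (n + m) * n.factorial * m.factorial) := by gcongr
    _ = _ := by rw [mul_pow, mul_pow]; ring

theorem smul_generator_pow_apply (c : ℂ) (n : ℕ) (φ : 𝓢(ℝ, ℂ)) :
    ((c • generator Q h) ^ n) φ = c ^ n • (generator Q h ^ n) φ := by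
  rw [smul_pow, LinearMap.smul_apply]

theorem IsAnalyticVector.hasSum_weylForm (hQ : Q.IsSymm) (hω : ω ^ 2 = (Q.det : ℂ)) (hh : 0 < h)
    {R : ℝ} (hR : 0 ≤ R) {φ : 𝓢(ℝ, ℂ)} (hφ : IsAnalyticVector Q h R φ) (ψ : 𝓢(ℝ, ℂ)) {T₀ Δ : ℂ}
    (hΔ : ‖Δ‖ * R < 1)
    (hT : ∀ θ ∈ Icc (0 : ℝ) 1, IsRegularTime ω (quadraticSymbol Q) (T₀ + θ * Δ)) :
    HasSum (fun n : ℕ => Δ ^ n * weylForm h (complexEvolutionSymbol h ω (quadraticSymbol Q) T₀)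
      ((generator Q h ^ n) φ) ψ / n.factorial)
      (weylForm h (complexEvolutionSymbol h ω (quadraticSymbol Q) (T₀ + Δ)) φ ψ) := by
  obtain ⟨M, hM⟩ := hφ
  obtain ⟨C, hC, H⟩ := norm_weylForm_le hh ψ
  have hpc : Continuous fun θ : ℝ => T₀ + θ * Δ := by fun_prop
  have hsec : ContinuousOn (fun θ : ℝ => (Complex.cos ((T₀ + θ * Δ) * ω / 2))⁻¹) (Icc 0 1) :=
    ContinuousOn.inv₀ (by fun_prop) fun θ hθ => (hT θ hθ).cos_ne_zero
  obtain ⟨b, hb⟩ := isCompact_Icc.exists_bound_of_continuousOn hsec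
  have key := hasSum_of_hasDerivWithinAt_succ (M := C * b * M) (q := ‖Δ‖ * R)
    (f := fun n θ => weylForm h (complexEvolutionSymbol h ω (quadraticSymbol Q) (T₀ + θ * Δ))
      (((Δ • generator Q h) ^ n) φ) ψ) (by positivity) hΔ
    (fun n θ hθ => ?_) (fun n θ hθ => ?_)
  · simpa only [smul_generator_pow_apply, weylForm_smul_left, Complex.ofReal_zero, zero_mul,
      add_zero, Complex.ofReal_one, one_mul, pow_zero, Module.End.one_apply] using key
  · rw [pow_succ', Module.End.mul_apply]
    exact hasDerivWithinAt_weylForm_evolution hQ hω hh hT _ ψ hθ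
  · rw [smul_generator_pow_apply]
    refine (H _ b (fun z => ((hT θ hθ).norm_complexEvolutionSymbol_le hh z).trans (hb θ hθ)) _ _
      ((hM n).smul (Δ ^ n))).trans (le_of_eq ?_)
    rw [norm_pow, mul_pow]
    ring

/-! ### The unitary group -/

theorem IsTimeEvolution.apply_zero {U : ℝ → L2 →L[ℂ] L2} {H : 𝓢(ℝ, ℂ) →ₗ[ℂ] 𝓢(ℝ, ℂ)}
    (hU : IsTimeEvolution h H U) : U 0 = 1 := by
  have h1 := hU.map_add 0 0
  rw [add_zero] at h1
  have h2 := congrArg (fun V => star (U 0) * V) h1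
  simp only [← mul_assoc, (Unitary.mem_iff.1 (hU.mem_unitary 0)).1, one_mul] at h2
  exact h2.symm

theorem norm_apply_of_mem_unitary {V : L2 →L[ℂ] L2} (hV : V ∈ unitary (L2 →L[ℂ] L2)) (v : L2) :
    ‖V v‖ = ‖v‖ :=
  ContinuousLinearMap.norm_map_of_mem_unitary hV v

/-- By the group law, the derivative at t is U(t) applied to the derivative at 0; no invariance of
the Schwartz space under U is needed. -/
theorem IsTimeEvolution.hasDerivAt_apply {U : ℝ → L2 →L[ℂ] L2}
    (hU : IsTimeEvolution h (quadraticOp Q h) U) (t : ℝ) (φ : 𝓢(ℝ, ℂ)) :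
    HasDerivAt (fun t => U t (φ.toLp 2 volume)) (U t ((generator Q h φ).toLp 2 volume)) t := by
  have h1 := ((U t).restrictScalars ℝ).hasFDerivAt.comp_hasDerivAt (0 : ℝ) (hU.hasDerivAt φ)
  have h2 : HasDerivAt (fun s => s - t) 1 t := (hasDerivAt_id t).sub_const t
  have h3 := h1.scomp_of_eq t h2 (sub_self t).symm
  rw [one_smul, ← toLp_smul] at h3
  refine h3.congr_of_eventuallyEq (Eventually.of_forall fun s => ?_)
  simp only [Function.comp_apply, ContinuousLinearMap.coe_restrictScalars']
  rw [← mul_apply_eq_comp, ← hU.map_add, add_sub_cancel]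

theorem IsTimeEvolution.hasSum_inner {U : ℝ → L2 →L[ℂ] L2}
    (hU : IsTimeEvolution h (quadraticOp Q h) U) {R : ℝ} (hR : 0 ≤ R) {φ : 𝓢(ℝ, ℂ)}
    (hφ : IsAnalyticVector Q h R φ) (v : L2) {t₀ s : ℝ} (hs : |s| * R < 1) :
    HasSum (fun n : ℕ => (s : ℂ) ^ n *
      inner ℂ v (U t₀ (((generator Q h ^ n) φ).toLp 2 volume)) / n.factorial)
      (inner ℂ v (U (t₀ + s) (φ.toLp 2 volume))) := by
  obtain ⟨M, hM⟩ := hφ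
  have key := hasSum_of_hasDerivWithinAt_succ (M := ‖v‖ * (4 * M)) (q := |s| * R)
    (f := fun n θ => inner ℂ v (U (t₀ + θ * s) ((((s : ℂ) • generator Q h) ^ n) φ |>.toLp 2 volume)))
    (by positivity) hs (fun n θ hθ => ?_) (fun n θ hθ => ?_)
  · simpa only [smul_generator_pow_apply, toLp_smul, map_smul, inner_smul_right, zero_mul, add_zero,
      one_mul, pow_zero, Module.End.one_apply] using key
  · rw [pow_succ', Module.End.mul_apply, LinearMap.smul_apply, toLp_smul, map_smul]
    have h1 : HasDerivAt (fun θ : ℝ => t₀ + θ * s) s θ := by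
      simpa using ((hasDerivAt_id θ).mul_const s).const_add t₀
    have h2 := (hU.hasDerivAt_apply (t₀ + θ * s) ((((s : ℂ) • generator Q h) ^ n) φ)).scomp θ h1
    exact ((innerSL ℂ v).restrictScalars ℝ).hasFDerivAt.comp_hasDerivAt θ h2 |>.hasDerivWithinAt
  · refine (norm_inner_le_norm _ _).trans ?_
    rw [norm_apply_of_mem_unitary (hU.mem_unitary _), smul_generator_pow_apply, mul_assoc, mul_assoc]
    refine mul_le_mul_of_nonneg_left ?_ (norm_nonneg v)
    refine (norm_toLp_le ((hM n).smul _)).trans (le_of_eq ?_)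
    rw [norm_pow, Complex.norm_real, Real.norm_eq_abs, mul_pow]
    ring

/-! ### Evolution of analytic vectors -/

/-- Two regular real times are joined, up to an arbitrarily small shift of the end point, by a
segment of regular complex times. -/
theorem exists_shift_isRegularTime (hQ : Q.IsSymm) (hω : ω ^ 2 = (Q.det : ℂ)) :
    ∃ c : ℂ, ‖c‖ ≤ 1 ∧ ∀ t₀ t : ℝ, Complex.cos (t₀ * ω / 2) ≠ 0 → Complex.cos (t * ω / 2) ≠ 0 →
      ∀ δ ∈ Ioc (0 : ℝ) 1, ∀ θ ∈ Icc (0 : ℝ) 1,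
        IsRegularTime ω (quadraticSymbol Q) (t₀ + θ * (t - t₀ + δ * c)) := by
  rcases le_or_gt Q.det 0 with hd | hd
  · refine ⟨0, by simp, fun t₀ t _ _ δ _ θ _ => ?_⟩
    have e : (t₀ + θ * (t - t₀ + δ * 0) : ℂ) = ((t₀ + θ * (t - t₀) : ℝ) : ℂ) := by push_cast; ring
    rw [e]
    refine isRegularTime_ofReal hω _ ?_
    obtain ⟨r, rfl⟩ : ∃ r : ℝ, (r : ℂ) * Complex.I = ω := by
      have h1 : ω ^ 2 = ((√(-Q.det) : ℝ) * Complex.I : ℂ) ^ 2 := by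
        rw [hω, mul_pow, ← Complex.ofReal_pow, Real.sq_sqrt (by linarith), Complex.I_sq]
        push_cast; ring
      rcases sq_eq_sq_iff_eq_or_eq_neg.1 h1 with h | h
      · exact ⟨_, h.symm⟩
      · exact ⟨-√(-Q.det), by rw [h]; push_cast; ring⟩
    have e2 (s : ℝ) : (s * (r * Complex.I) / 2 : ℂ) = ((s * r / 2 : ℝ) : ℂ) * Complex.I := by
      push_cast; ring
    rw [e2, Complex.cos_mul_I, ← Complex.ofReal_cosh]
    exact_mod_cast (Real.cosh_pos _).ne'
  · obtain ⟨σ, hσ, hA⟩ := exists_sign_mul_quadraticSymbol hQ hd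
    refine ⟨-σ * Complex.I, by simp [hσ], fun t₀ t h₀ h₁ δ hδ θ hθ => ?_⟩
    rcases hθ.1.eq_or_lt with rfl | hθ'
    · simpa using isRegularTime_ofReal hω _ h₀
    have him : (t₀ + θ * (t - t₀ + δ * (-σ * Complex.I)) : ℂ).im = -(θ * δ * σ) := by
      simp; ring
    have hσ0 : σ ≠ 0 := by rintro rfl; simp at hσ
    refine isRegularTime_of_im_ne_zero hd hω ?_ fun z => ?_
    · rw [him]
      exact neg_ne_zero.2 (mul_ne_zero (mul_ne_zero hθ'.ne' hδ.1.ne') hσ0)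
    · rw [him]
      have := mul_nonneg (mul_nonneg hθ'.le hδ.1.le) (hA z)
      linarith

/-- Both sides have the same Taylor coefficients at t₀. The series for the Weyl form is summed along
a segment ending at t + δc, which avoids the poles, and then δ tends to 0 from the right. -/
theorem IsAnalyticVector.inner_eq_weylForm_of_lt (hQ : Q.IsSymm) (hω : ω ^ 2 = (Q.det : ℂ))
    (hh : 0 < h) {U : ℝ → L2 →L[ℂ] L2} (hU : IsTimeEvolution h (quadraticOp Q h) U) {R : ℝ}
    (hR : 0 < R) {φ : 𝓢(ℝ, ℂ)} (hφ : IsAnalyticVector Q h R φ) (ψ : 𝓢(ℝ, ℂ)) {t₀ t : ℝ}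
    (h₀ : Complex.cos (t₀ * ω / 2) ≠ 0) (h₁ : Complex.cos (t * ω / 2) ≠ 0)
    (ht : |t - t₀| * R < 1)
    (heq : ∀ n, inner ℂ (ψ.toLp 2 volume : L2) (U t₀ (((generator Q h ^ n) φ).toLp 2 volume)) =
      weylForm h (complexEvolutionSymbol h ω (quadraticSymbol Q) t₀) ((generator Q h ^ n) φ) ψ) :
    inner ℂ (ψ.toLp 2 volume : L2) (U t (φ.toLp 2 volume)) =
      weylForm h (complexEvolutionSymbol h ω (quadraticSymbol Q) t) φ ψ := by
  obtain ⟨c, hc, hreg⟩ := exists_shift_isRegularTime hQ hω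
  have hE := hU.hasSum_inner hR.le hφ (ψ.toLp 2 volume) (t₀ := t₀) (s := t - t₀) ht
  rw [add_sub_cancel] at hE
  simp only [heq] at hE
  set a : ℕ → ℂ := fun n => weylForm h (complexEvolutionSymbol h ω (quadraticSymbol Q) t₀)
    ((generator Q h ^ n) φ) ψ with ha
  obtain ⟨C, hC⟩ : ∃ C, ∀ n, ‖a n‖ ≤ C * R ^ n * n.factorial := by
    obtain ⟨M, hM⟩ := hφ
    obtain ⟨C, hC, H⟩ := norm_weylForm_le hh ψ
    have hb := (isRegularTime_ofReal hω (quadraticSymbol Q) h₀).norm_complexEvolutionSymbol_le hh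
    exact ⟨C * ‖(Complex.cos (t₀ * ω / 2))⁻¹‖ * M, fun n =>
      (H _ _ hb _ _ (hM n)).trans (le_of_eq (by ring))⟩
  -- The shift must keep the end point inside the disc of convergence, uniformly in δ ≤ ε; half of
  -- the remaining margin is used.
  obtain ⟨ε, hε, hε1, hq⟩ : ∃ ε : ℝ, 0 < ε ∧ ε ≤ 1 ∧ (|t - t₀| + ε) * R < 1 := by
    refine ⟨min 1 ((1 - |t - t₀| * R) / (2 * R)), lt_min one_pos (div_pos (by linarith)
      (by linarith)), min_le_left _ _, ?_⟩
    have h1 : min 1 ((1 - |t - t₀| * R) / (2 * R)) * R ≤ (1 - |t - t₀| * R) / (2 * R) * R :=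
      mul_le_mul_of_nonneg_right (min_le_right _ _) hR.le
    have h2 : (1 - |t - t₀| * R) / (2 * R) * R = (1 - |t - t₀| * R) / 2 := by field_simp
    rw [add_mul]
    linarith
  have hΔ (δ : ℝ) (hδ : δ ∈ Ioc 0 ε) : ‖(t - t₀ + δ * c : ℂ)‖ ≤ |t - t₀| + ε := by
    refine (norm_add_le _ _).trans (add_le_add (le_of_eq ?_) ?_)
    · rw [← Complex.ofReal_sub, Complex.norm_real, Real.norm_eq_abs]
    · rw [norm_mul, Complex.norm_real, Real.norm_of_nonneg hδ.1.le]
      exact (mul_le_of_le_one_right hδ.1.le hc).trans hδ.2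
  have hmem : ∀ᶠ δ in 𝓝[>] (0 : ℝ), δ ∈ Ioc 0 ε := Ioc_mem_nhdsGT hε
  have hG (δ : ℝ) (hδ : δ ∈ Ioc 0 ε) : ∑' n : ℕ, (t - t₀ + δ * c : ℂ) ^ n * a n / n.factorial =
      weylForm h (complexEvolutionSymbol h ω (quadraticSymbol Q) (t + δ * c)) φ ψ := by
    rw [(hφ.hasSum_weylForm hQ hω hh hR.le ψ
      ((mul_le_mul_of_nonneg_right (hΔ δ hδ) hR.le).trans_lt hq)
      (hreg t₀ t h₀ h₁ δ ⟨hδ.1, hδ.2.trans hε1⟩)).tsum_eq]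
    congr 2
    ring
  have lim1 : Tendsto (fun δ : ℝ =>
      weylForm h (complexEvolutionSymbol h ω (quadraticSymbol Q) (t + δ * c)) φ ψ) (𝓝[>] 0)
      (𝓝 (weylForm h (complexEvolutionSymbol h ω (quadraticSymbol Q) t) φ ψ)) := by
    -- The approach to t runs along the segment t + θc, regular by the case t₀ = t, δ = 1;
    -- differentiability there gives continuity.
    have h2 := (hasDerivWithinAt_weylForm_evolution hQ hω hh (T₀ := t) (Δ := c) (fun θ hθ => by
      simpa using hreg t t h₁ h₁ 1 (by simp) θ hθ) φ ψ (θ := 0) (by simp)).continuousWithinAt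
    have h3 := h2.tendsto
    simp only [Complex.ofReal_zero, zero_mul, add_zero] at h3
    refine h3.mono_left (nhdsWithin_le_iff.2 ?_)
    exact mem_of_superset (Ioc_mem_nhdsGT one_pos) Ioc_subset_Icc_self
  have lim2 : Tendsto (fun δ : ℝ => ∑' n : ℕ, (t - t₀ + δ * c : ℂ) ^ n * a n / n.factorial) (𝓝[>] 0)
      (𝓝 (∑' n : ℕ, (t - t₀ : ℂ) ^ n * a n / n.factorial)) := by
    refine tendsto_tsum_of_dominated_convergence
      (bound := fun n => C * ((|t - t₀| + ε) * R) ^ n)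
      ((summable_geometric_of_lt_one (by positivity) hq).mul_left C) (fun n => ?_)
      (hmem.mono fun δ hδ n => ?_)
    · have : Continuous fun δ : ℝ => (t - t₀ + δ * c : ℂ) ^ n * a n / n.factorial := by fun_prop
      simpa using (this.tendsto 0).mono_left nhdsWithin_le_nhds
    · have hf : (0 : ℝ) < n.factorial := by exact_mod_cast n.factorial_pos
      rw [norm_div, norm_mul, norm_pow, Complex.norm_natCast, div_le_iff₀ hf]
      calc _ ≤ (|t - t₀| + ε) ^ n * (C * R ^ n * n.factorial) := by
            gcongr
            exacts [hΔ δ hδ, hC n]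
        _ = _ := by rw [mul_pow]; ring
  have e1 := tendsto_nhds_unique (lim2.congr' (hmem.mono hG)) lim1
  rw [← hE.tsum_eq, ← e1]
  push_cast
  rfl

theorem countable_setOf_cos_eq_zero (ω : ℂ) : {t : ℝ | Complex.cos (t * ω / 2) = 0}.Countable := by
  by_cases hω : ω = 0
  · simp [hω]
  · refine (countable_range fun k : ℤ => ((2 * k + 1) * Real.pi / ω : ℂ).re).mono fun t ht => ?_
    obtain ⟨k, hk⟩ := Complex.cos_eq_zero_iff.1 ht
    refine ⟨k, ?_⟩
    have : ((2 * k + 1) * Real.pi / ω : ℂ) = t := by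
      rw [div_eq_iff hω]; linear_combination -2 * hk
    simp only [this, Complex.ofReal_re]

/-- The symbol is 1 at time 0, which starts the continuation. Each step requires the equality for
all iterates of φ, not just for φ, so this stronger statement is carried through the induction. -/
theorem IsAnalyticVector.inner_eq_weylForm (hQ : Q.IsSymm) (hω : ω ^ 2 = (Q.det : ℂ))
    (hh : 0 < h) {U : ℝ → L2 →L[ℂ] L2} (hU : IsTimeEvolution h (quadraticOp Q h) U) {R : ℝ}
    (hR : 0 < R) {φ : 𝓢(ℝ, ℂ)} (hφ : IsAnalyticVector Q h R φ) (ψ : 𝓢(ℝ, ℂ)) {t : ℝ}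
    (ht : Complex.cos (t * ω / 2) ≠ 0) :
    inner ℂ (ψ.toLp 2 volume : L2) (U t (φ.toLp 2 volume)) =
      weylForm h (complexEvolutionSymbol h ω (quadraticSymbol Q) t) φ ψ := by
  have hR2 : 0 < 2 * R := by linarith
  have step {t₀ t : ℝ} (h₀ : Complex.cos (t₀ * ω / 2) ≠ 0) (h₁ : Complex.cos (t * ω / 2) ≠ 0)
      (h₂ : |t - t₀| * (2 * R) < 1)
      (heq : ∀ n, inner ℂ (ψ.toLp 2 volume : L2) (U t₀ (((generator Q h ^ n) φ).toLp 2 volume)) =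
        weylForm h (complexEvolutionSymbol h ω (quadraticSymbol Q) t₀)
          ((generator Q h ^ n) φ) ψ) (m : ℕ) :
      inner ℂ (ψ.toLp 2 volume : L2) (U t (((generator Q h ^ m) φ).toLp 2 volume)) =
        weylForm h (complexEvolutionSymbol h ω (quadraticSymbol Q) t)
          ((generator Q h ^ m) φ) ψ := by
    refine (hφ.iterate hR.le m).inner_eq_weylForm_of_lt hQ hω hh hU hR2 ψ h₀ h₁ h₂ fun n => ?_
    rw [← Module.End.mul_apply, ← pow_add]
    exact heq (n + m)
  have key (N : ℕ) : ∀ t : ℝ, Complex.cos (t * ω / 2) ≠ 0 → |t| * (4 * R) < N + 1 → ∀ m,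
      inner ℂ (ψ.toLp 2 volume : L2) (U t (((generator Q h ^ m) φ).toLp 2 volume)) =
        weylForm h (complexEvolutionSymbol h ω (quadraticSymbol Q) t)
          ((generator Q h ^ m) φ) ψ := by
    induction N with
    | zero =>
      intro t ht htN
      refine step (t₀ := 0) (by simp) ht ?_ fun n => ?_
      · have := abs_nonneg t
        rw [sub_zero]
        norm_num at htN
        nlinarith
      · rw [hU.apply_zero, one_apply_eq_self, ← weylForm_one hh]
        congr 1
        funext z
        rw [Complex.ofReal_zero, complexEvolutionSymbol_zero]
    | succ N ih =>
      intro t ht htN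
      obtain ⟨t₀, ⟨h1, h2⟩, h3⟩ : ∃ t₀ : ℝ, (|t₀| * (4 * R) < N + 1 ∧ |t - t₀| * (2 * R) < 1) ∧
          Complex.cos (t₀ * ω / 2) ≠ 0 := by
        have hopen : IsOpen {s : ℝ | |s| * (4 * R) < N + 1 ∧ |t - s| * (2 * R) < 1} := by
          rw [ofPred_and]
          exact (isOpen_lt (by fun_prop) (by fun_prop)).inter
            (isOpen_lt (by fun_prop) (by fun_prop))
        -- The natural intermediate time t(N + 1)/(N + 2) may be a pole. The constraints are open,
        -- and the poles are countable, so some nearby time is admissible. The constant 4R, against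
        -- the radius 1/(2R), leaves the necessary slack.
        refine ((countable_setOf_cos_eq_zero ω).dense_compl ℝ).inter_open_nonempty _ hopen
          ⟨t * ((N + 1) / (N + 2)), ?_, ?_⟩
        · have hN : (0 : ℝ) < N + 2 := by positivity
          rw [abs_mul, abs_of_nonneg (by positivity : (0 : ℝ) ≤ (N + 1) / (N + 2))]
          push_cast at htN
          rw [show |t| * (((N : ℝ) + 1) / (N + 2)) * (4 * R) =
            (|t| * (4 * R)) * ((N + 1) / (N + 2)) by ring]
          calc _ < ((N : ℝ) + 1 + 1) * ((N + 1) / (N + 2)) :=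
                mul_lt_mul_of_pos_right htN (by positivity)
            _ = N + 1 := by field_simp; ring
        · have hN : (0 : ℝ) < N + 2 := by positivity
          rw [show t - t * (((N : ℝ) + 1) / (N + 2)) = t * (1 / (N + 2)) by field_simp; ring,
            abs_mul, abs_of_nonneg (by positivity : (0 : ℝ) ≤ 1 / (N + 2))]
          push_cast at htN
          have : |t| * (1 / ((N : ℝ) + 2)) * (2 * R) = (|t| * (4 * R)) / (2 * (N + 2)) := by
            field_simp; ring
          rw [this, div_lt_one (by positivity)]
          linarith
      exact step h3 ht h2 (ih t₀ h3 h1)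
  obtain ⟨N, hN⟩ := exists_nat_gt (|t| * (4 * R))
  simpa using key N t ht (by linarith) 0

/-! ### Polynomials times Gaussians -/

/-- `q(x) exp(-α(x - u)²/2)`. -/
def polyGaussianFun (α u : ℝ) (q : ℂ[X]) (x : ℝ) : ℂ :=
  q.eval (x : ℂ) * (Real.exp (-(α * (x - u) ^ 2 / 2)) : ℝ)

/-- The action of the derivative on the polynomial factor of `polyGaussianFun`. -/
def gaussianDeriv (α u : ℝ) (q : ℂ[X]) : ℂ[X] :=
  Polynomial.derivative q - Polynomial.C (α : ℂ) * ((Polynomial.X - Polynomial.C (u : ℂ)) * q)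

theorem hasDerivAt_polyGaussianFun (α u : ℝ) (q : ℂ[X]) (x : ℝ) :
    HasDerivAt (polyGaussianFun α u q) (polyGaussianFun α u (gaussianDeriv α u q) x) x := by
  have h1 : HasDerivAt (fun x : ℝ => -(α * (x - u) ^ 2 / 2)) (-(α * (x - u))) x := by
    have := ((((hasDerivAt_id x).sub_const u).fun_pow 2).const_mul α).div_const 2 |>.fun_neg
    refine this.congr_deriv ?_
    simp; ring
  refine ((hasDerivAt_polynomial_eval q x).fun_mul h1.exp.ofReal_comp).congr_deriv ?_
  simp only [polyGaussianFun, gaussianDeriv, Polynomial.eval_sub, Polynomial.eval_mul,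
    Polynomial.eval_C, Polynomial.eval_X]
  push_cast
  ring

theorem iteratedDeriv_polyGaussianFun (α u : ℝ) (q : ℂ[X]) (n : ℕ) :
    iteratedDeriv n (polyGaussianFun α u q) = polyGaussianFun α u ((gaussianDeriv α u)^[n] q) := by
  induction n with
  | zero => simp
  | succ n ih =>
    rw [iteratedDeriv_succ, ih, Function.iterate_succ_apply']
    exact funext fun x => (hasDerivAt_polyGaussianFun α u _ x).deriv

theorem contDiff_polyGaussianFun (α u : ℝ) (q : ℂ[X]) :
    ContDiff ℝ (⊤ : ℕ∞) (polyGaussianFun α u q) := by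
  refine (contDiff_polynomial_eval q).mul (Complex.ofRealCLM.contDiff.comp ?_)
  exact Real.contDiff_exp.comp (by fun_prop)

/-- `∑ |cₖ| ρᵏ √(k!)`, `ρ = √(2/α)`, over the coefficients `cₖ` of order at most `d`. -/
def gaussianNorm (α : ℝ) (d : ℕ) (q : ℂ[X]) : ℝ :=
  ∑ k ∈ Finset.range (d + 1), ‖q.coeff k‖ * (√(2 / α) ^ k * √(k.factorial))

/-- This is the square root of yᵏ/k! ≤ eʸ at y = αx²/2; it dictates the weights in `gaussianNorm`.
-/
theorem pow_mul_exp_le {α : ℝ} (hα : 0 < α) (k : ℕ) (x : ℝ) :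
    |x| ^ k * Real.exp (-(α * x ^ 2 / 4)) ≤ √(2 / α) ^ k * √(k.factorial) := by
  have hf : (0 : ℝ) < k.factorial := by exact_mod_cast k.factorial_pos
  have h1 := Real.pow_div_factorial_le_exp _ (by positivity : 0 ≤ α * x ^ 2 / 2) k
  rw [div_le_iff₀ hf] at h1
  refine abs_le_of_sq_le_sq' ?_ (by positivity) |>.2
  have e1 : Real.exp (-(α * x ^ 2 / 4)) ^ 2 = (Real.exp (α * x ^ 2 / 2))⁻¹ := by
    rw [← Real.exp_nat_mul, ← Real.exp_neg]; congr 1; push_cast; ring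
  rw [mul_pow, mul_pow, e1, Real.sq_sqrt hf.le, ← pow_mul, mul_comm k 2, pow_mul, sq_abs,
    ← pow_mul √(2 / α), mul_comm k 2, pow_mul √(2 / α), Real.sq_sqrt (by positivity),
    ← div_eq_mul_inv, div_le_iff₀ (Real.exp_pos _)]
  have e2 : (x ^ 2) ^ k = (2 / α) ^ k * (α * x ^ 2 / 2) ^ k := by
    rw [← mul_pow]; congr 1; field_simp
  rw [e2, mul_assoc]
  exact mul_le_mul_of_nonneg_left (by linarith) (by positivity)

theorem norm_polyGaussianFun_le {α : ℝ} (hα : 0 < α) (u : ℝ) {q : ℂ[X]} {d : ℕ}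
    (hq : q.natDegree ≤ d) (x : ℝ) :
    ‖polyGaussianFun α u q x‖ ≤ Real.exp (α * u ^ 2 / 2) * gaussianNorm α d q := by
  -- The gap between the exponents is α(x - 2u)²/4; the centre is moved to 0 at the cost of half the
  -- decay.
  have h1 : Real.exp (-(α * (x - u) ^ 2 / 2)) ≤
      Real.exp (α * u ^ 2 / 2) * Real.exp (-(α * x ^ 2 / 4)) := by
    rw [← Real.exp_add, Real.exp_le_exp]
    nlinarith [mul_nonneg hα.le (sq_nonneg (x - 2 * u))]
  rw [polyGaussianFun, norm_mul, Complex.norm_real, Real.norm_of_nonneg (Real.exp_pos _).le,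
    Polynomial.eval_eq_sum_range' (Nat.lt_succ_of_le hq), gaussianNorm, Finset.mul_sum]
  refine (mul_le_mul (norm_sum_le _ _) h1 (Real.exp_pos _).le
    (Finset.sum_nonneg fun _ _ => norm_nonneg _)).trans ?_
  rw [Finset.sum_mul]
  refine Finset.sum_le_sum fun k _ => ?_
  rw [norm_mul, norm_pow, Complex.norm_real, Real.norm_eq_abs]
  calc _ = Real.exp (α * u ^ 2 / 2) * (‖q.coeff k‖ *
        (|x| ^ k * Real.exp (-(α * x ^ 2 / 4)))) := by ring
    _ ≤ _ := mul_le_mul_of_nonneg_left (mul_le_mul_of_nonneg_left (pow_mul_exp_le hα k x)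
        (norm_nonneg _)) (Real.exp_pos _).le

/-- `q(x) exp(-α(x - u)²/2)` as a Schwartz function. -/
def polyGaussian {α : ℝ} (hα : 0 < α) (u : ℝ) (q : ℂ[X]) : 𝓢(ℝ, ℂ) where
  toFun := polyGaussianFun α u q
  smooth' := contDiff_polyGaussianFun α u q
  decay' k n := by
    refine ⟨_, fun x => le_trans (le_of_eq ?_) (norm_polyGaussianFun_le hα u
      (q := Polynomial.X ^ k * (gaussianDeriv α u)^[n] q) le_rfl x)⟩
    rw [norm_iteratedFDeriv_eq_norm_iteratedDeriv, iteratedDeriv_polyGaussianFun, polyGaussianFun,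
      polyGaussianFun, Polynomial.eval_mul, Polynomial.eval_pow, Polynomial.eval_X, norm_mul,
      norm_mul, norm_mul, norm_pow, Complex.norm_real, Complex.norm_real, mul_assoc]

theorem polyGaussian_apply {α : ℝ} (hα : 0 < α) (u : ℝ) (q : ℂ[X]) (x : ℝ) :
    polyGaussian hα u q x = polyGaussianFun α u q x := rfl

/-- Products of the Gaussian by a polynomial of degree at most `d`, with a bound for the
coefficients. -/
def IsGaussianBound {α : ℝ} (hα : 0 < α) (u : ℝ) (d : ℕ) (K : ℝ) (φ : 𝓢(ℝ, ℂ)) : Prop :=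
  ∃ q : ℂ[X], φ = polyGaussian hα u q ∧ q.natDegree ≤ d ∧
    gaussianNorm α d q ≤ K * √(d.factorial)

theorem gaussianNorm_add_le (α : ℝ) (d : ℕ) (q r : ℂ[X]) :
    gaussianNorm α d (q + r) ≤ gaussianNorm α d q + gaussianNorm α d r := by
  unfold gaussianNorm
  rw [← Finset.sum_add_distrib]
  refine Finset.sum_le_sum fun k _ => ?_
  rw [← add_mul, Polynomial.coeff_add]
  exact mul_le_mul_of_nonneg_right (norm_add_le _ _) (by positivity)

theorem gaussianNorm_C_mul (α : ℝ) (d : ℕ) (c : ℂ) (q : ℂ[X]) :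
    gaussianNorm α d (Polynomial.C c * q) = ‖c‖ * gaussianNorm α d q := by
  unfold gaussianNorm
  simp only [Polynomial.coeff_C_mul, norm_mul, mul_assoc, Finset.mul_sum]

theorem gaussianNorm_nonneg (α : ℝ) (d : ℕ) (q : ℂ[X]) : 0 ≤ gaussianNorm α d q :=
  Finset.sum_nonneg fun _ _ => by positivity

theorem gaussianNorm_succ {α : ℝ} {d : ℕ} {q : ℂ[X]} (hq : q.natDegree ≤ d) :
    gaussianNorm α (d + 1) q = gaussianNorm α d q := by
  unfold gaussianNorm
  rw [Finset.sum_range_succ, Polynomial.coeff_eq_zero_of_natDegree_lt (by omega)]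
  simp

theorem gaussianNorm_X_mul_le (α : ℝ) (d : ℕ) (q : ℂ[X]) :
    gaussianNorm α (d + 1) (Polynomial.X * q) ≤ √(2 / α) * √(d + 1) * gaussianNorm α d q := by
  unfold gaussianNorm
  rw [Finset.sum_range_succ', Polynomial.coeff_X_mul_zero, norm_zero, zero_mul, add_zero,
    Finset.mul_sum]
  refine Finset.sum_le_sum fun k hk => ?_
  have hk' : (k : ℝ) ≤ d := by exact_mod_cast Nat.le_of_lt_succ (Finset.mem_range.1 hk)
  rw [Polynomial.coeff_X_mul, Nat.factorial_succ, Nat.cast_mul, Real.sqrt_mul (by positivity)]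
  push_cast
  calc _ = √(2 / α) * √(k + 1) * (‖q.coeff k‖ * (√(2 / α) ^ k * √(k.factorial))) := by ring
    _ ≤ _ := by gcongr

/-- Of the factor k + 1 = √(k + 1)², one root is absorbed by the weight of the coefficient k + 1 and
only the other is lost. A derivative thus costs √(d + 1), the same as a multiplication by x. -/
theorem gaussianNorm_derivative_le {α : ℝ} (hα : 0 < α) {d : ℕ} {q : ℂ[X]} (hq : q.natDegree ≤ d) :
    gaussianNorm α d (Polynomial.derivative q) ≤ (√(2 / α))⁻¹ * √(d + 1) * gaussianNorm α d q := by
  have hρ : 0 < √(2 / α) := Real.sqrt_pos.2 (by positivity)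
  rw [← gaussianNorm_succ hq]
  unfold gaussianNorm
  rw [Finset.sum_range_succ' _ (d + 1), mul_add, Finset.mul_sum]
  refine le_add_of_le_of_nonneg (Finset.sum_le_sum fun k hk => ?_) (by positivity)
  have hk' : (k : ℝ) ≤ d := by exact_mod_cast Nat.le_of_lt_succ (Finset.mem_range.1 hk)
  rw [Polynomial.coeff_derivative, Nat.factorial_succ, Nat.cast_mul, Real.sqrt_mul (by positivity),
    norm_mul]
  have e : ‖(k + 1 : ℂ)‖ = √(k + 1) * √(k + 1) := by
    rw [Real.mul_self_sqrt (by positivity)]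
    exact_mod_cast Complex.norm_natCast (k + 1)
  rw [e]
  push_cast
  calc _ = (√(2 / α))⁻¹ * √(k + 1) * (‖q.coeff (k + 1)‖ *
        (√(2 / α) ^ (k + 1) * (√(k + 1) * √(k.factorial)))) := by
        rw [pow_succ]; field_simp
    _ ≤ _ := by gcongr

namespace IsGaussianBound

variable {α : ℝ} {hα : 0 < α} {u : ℝ} {d : ℕ} {K K' : ℝ} {φ φ' : 𝓢(ℝ, ℂ)}

theorem nonneg (hφ : IsGaussianBound hα u d K φ) : 0 ≤ K := by
  obtain ⟨q, -, -, h⟩ := hφ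
  have hf : 0 < √(d.factorial : ℝ) := Real.sqrt_pos.2 (by exact_mod_cast d.factorial_pos)
  exact nonneg_of_mul_nonneg_left ((gaussianNorm_nonneg α d q).trans h) hf

theorem mono (hφ : IsGaussianBound hα u d K φ) (h : K ≤ K') : IsGaussianBound hα u d K' φ := by
  obtain ⟨q, e, hd, hK⟩ := hφ
  exact ⟨q, e, hd, hK.trans (mul_le_mul_of_nonneg_right h (Real.sqrt_nonneg _))⟩

theorem succ (hφ : IsGaussianBound hα u d K φ) : IsGaussianBound hα u (d + 1) K φ := by
  have hK0 := hφ.nonneg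
  obtain ⟨q, e, hd, hK⟩ := hφ
  refine ⟨q, e, hd.trans d.le_succ, ?_⟩
  rw [gaussianNorm_succ hd]
  refine hK.trans (mul_le_mul_of_nonneg_left (Real.sqrt_le_sqrt ?_) hK0)
  exact_mod_cast Nat.factorial_le d.le_succ

theorem of_le (hφ : IsGaussianBound hα u d K φ) {d' : ℕ} (h : d ≤ d') :
    IsGaussianBound hα u d' K φ := by
  induction h with
  | refl => exact hφ
  | step _ ih => exact ih.succ

theorem add (hφ : IsGaussianBound hα u d K φ) (hφ' : IsGaussianBound hα u d K' φ') :
    IsGaussianBound hα u d (K + K') (φ + φ') := by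
  obtain ⟨q, rfl, hd, hK⟩ := hφ
  obtain ⟨r, rfl, hd', hK'⟩ := hφ'
  refine ⟨q + r, ?_, Polynomial.natDegree_add_le_of_degree_le hd hd', ?_⟩
  · ext x
    simp only [add_apply, polyGaussian_apply, polyGaussianFun, Polynomial.eval_add, add_mul]
  · rw [add_mul]
    exact (gaussianNorm_add_le _ _ _ _).trans (add_le_add hK hK')

theorem smul (hφ : IsGaussianBound hα u d K φ) (c : ℂ) :
    IsGaussianBound hα u d (‖c‖ * K) (c • φ) := by
  obtain ⟨q, rfl, hd, hK⟩ := hφ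
  refine ⟨Polynomial.C c * q, ?_, (Polynomial.natDegree_C_mul_le c q).trans hd, ?_⟩
  · ext x
    simp only [smul_apply, polyGaussian_apply, polyGaussianFun, Polynomial.eval_mul,
      Polynomial.eval_C, mul_assoc, smul_eq_mul]
  · rw [gaussianNorm_C_mul, mul_assoc]
    exact mul_le_mul_of_nonneg_left hK (norm_nonneg c)

theorem opX (hφ : IsGaussianBound hα u d K φ) :
    IsGaussianBound hα u (d + 1) (√(2 / α) * K) (opX φ) := by
  obtain ⟨q, rfl, hd, hK⟩ := hφ
  refine ⟨Polynomial.X * q, ?_, ?_, (gaussianNorm_X_mul_le α d q).trans ?_⟩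
  · ext x
    simp only [opX_apply, polyGaussian_apply, polyGaussianFun, Polynomial.eval_mul,
      Polynomial.eval_X, mul_assoc]
  · rw [add_comm]
    exact Polynomial.natDegree_mul_le_of_le Polynomial.natDegree_X_le hd
  · rw [Nat.factorial_succ, Nat.cast_mul, Real.sqrt_mul (by positivity)]
    push_cast
    calc _ ≤ √(2 / α) * √(d + 1) * (K * √(d.factorial)) := by gcongr
      _ = _ := by ring

/-- The derivative acts as q' - α(x - u)q on the polynomial factor, and the constant adds up the
costs of its three terms. -/
theorem deriv (hφ : IsGaussianBound hα u d K φ) : IsGaussianBound hα u (d + 1)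
    (((√(2 / α))⁻¹ + α * (√(2 / α) + |u|)) * K) (SchwartzMap.derivCLM ℂ ℂ φ) := by
  have hK0 := hφ.nonneg
  have hX := hφ.opX
  obtain ⟨q, rfl, hd, hK⟩ := id hφ
  have h1 : IsGaussianBound hα u (d + 1) ((√(2 / α))⁻¹ * K)
      (polyGaussian hα u (Polynomial.derivative q)) := by
    refine ⟨_, rfl, (Polynomial.natDegree_derivative_le q).trans (by omega), ?_⟩
    rw [gaussianNorm_succ ((Polynomial.natDegree_derivative_le q).trans (by omega)),
      Nat.factorial_succ, Nat.cast_mul, Real.sqrt_mul (by positivity)]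
    push_cast
    calc _ ≤ (√(2 / α))⁻¹ * √(d + 1) * (K * √(d.factorial)) :=
          (gaussianNorm_derivative_le hα hd).trans (by gcongr)
      _ = _ := by ring
  have e : SchwartzMap.derivCLM ℂ ℂ (polyGaussian hα u q) =
      polyGaussian hα u (Polynomial.derivative q) + ((-(α : ℂ)) • QuadSymbol.opX (polyGaussian hα u q) +
        ((α * u : ℝ) : ℂ) • polyGaussian hα u q) := by
    ext x
    have := (hasDerivAt_polyGaussianFun α u q x).deriv
    simp only [SchwartzMap.derivCLM_apply, add_apply, smul_apply, opX_apply, smul_eq_mul]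
    refine Eq.trans this ?_
    simp only [polyGaussian_apply, polyGaussianFun, gaussianDeriv, Polynomial.eval_sub,
      Polynomial.eval_mul, Polynomial.eval_C, Polynomial.eval_X]
    push_cast
    ring
  rw [e]
  refine (h1.add ((hX.smul _).add (hφ.succ.smul _))).mono (le_of_eq ?_)
  rw [norm_neg, Complex.norm_real, Complex.norm_real, Real.norm_of_nonneg hα.le, Real.norm_eq_abs,
    abs_mul, abs_of_pos hα]
  ring

theorem norm_apply_le (hφ : IsGaussianBound hα u d K φ) (x : ℝ) :
    ‖φ x‖ ≤ Real.exp (α * u ^ 2 / 2) * (K * √(d.factorial)) := by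
  obtain ⟨q, rfl, hd, hK⟩ := hφ
  exact (norm_polyGaussianFun_le hα u hd x).trans
    (mul_le_mul_of_nonneg_left hK (Real.exp_pos _).le)

/-- Position and momentum raise the degree by one and multiply the bound by a constant. -/
theorem exists_opX_opP {α : ℝ} (hα : 0 < α) (u h : ℝ) : ∃ R, 1 ≤ R ∧ ∀ d K φ,
    IsGaussianBound hα u d K φ → IsGaussianBound hα u (d + 1) (R * K) (QuadSymbol.opX φ) ∧
      IsGaussianBound hα u (d + 1) (R * K) (QuadSymbol.opP h φ) := by
  refine ⟨1 + √(2 / α) + ‖(-Complex.I * h : ℂ)‖ * ((√(2 / α))⁻¹ + α * (√(2 / α) + |u|)), ?_,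
    fun d K φ hφ => ?_⟩
  · have : 0 ≤ √(2 / α) + ‖(-Complex.I * h : ℂ)‖ * ((√(2 / α))⁻¹ + α * (√(2 / α) + |u|)) := by
      positivity
    linarith
  · have hK := hφ.nonneg
    have h1 : 0 ≤ ‖(-Complex.I * h : ℂ)‖ * ((√(2 / α))⁻¹ + α * (√(2 / α) + |u|)) * K := by
      positivity
    have h2 : 0 ≤ √(2 / α) * K := by positivity
    exact ⟨hφ.opX.mono (by nlinarith), (hφ.deriv.smul (-Complex.I * h)).mono (by nlinarith)⟩

end IsGaussianBound

/-- Applying the generator n times raises the degree by 2n, and the bounds on PʲXⁱ add at most 4.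
The square root brings this back to growth of order n!, as analyticity requires. -/
theorem sqrt_factorial_le (n : ℕ) : √((2 * n + 4).factorial : ℝ) ≤ 32 * 4 ^ n * n.factorial := by
  have h1 (m : ℕ) : (2 * m).factorial ≤ 4 ^ m * m.factorial ^ 2 := by
    have := Nat.choose_mul_factorial_mul_factorial (show m ≤ 2 * m by omega)
    rw [show 2 * m - m = m by omega] at this
    rw [← this, pow_two, ← mul_assoc, show (4 : ℕ) ^ m = 2 ^ (2 * m) by rw [pow_mul]; norm_num]
    gcongr
    exact Nat.choose_le_two_pow _ _
  have h2 : (n + 2).factorial ≤ 8 * 2 ^ n * n.factorial := by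
    rw [Nat.factorial_succ, Nat.factorial_succ, ← mul_assoc]
    refine Nat.mul_le_mul_right _ ?_
    induction n with
    | zero => norm_num
    | succ n ih => rw [pow_succ]; nlinarith [Nat.lt_two_pow_self (n := n)]
  have h3 : ((2 * n + 4).factorial : ℝ) ≤ (32 * 4 ^ n * n.factorial) ^ 2 := by
    have h4 : (2 * n + 4).factorial ≤ (32 * 4 ^ n * n.factorial) ^ 2 := by
      refine (h1 (n + 2)).trans ?_
      calc 4 ^ (n + 2) * (n + 2).factorial ^ 2 ≤ 4 ^ (n + 2) * (8 * 2 ^ n * n.factorial) ^ 2 := by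
            gcongr
        _ = (32 * 4 ^ n * n.factorial) ^ 2 := by
          have : (4 : ℕ) ^ n = 2 ^ n * 2 ^ n := by rw [← mul_pow]; norm_num
          rw [pow_add, this]; ring
    exact_mod_cast h4
  exact (Real.sqrt_le_sqrt h3).trans_eq (Real.sqrt_sq (by positivity))

/-- Gaussians are analytic vectors. -/
theorem exists_isAnalyticVector_gaussian (Q : Matrix (Fin 2) (Fin 2) ℝ) (h : ℝ) {α : ℝ}
    (hα : 0 < α) (u : ℝ) : ∃ R, 0 < R ∧ IsAnalyticVector Q h R (polyGaussian hα u 1) := by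
  obtain ⟨R, hR, H⟩ := IsGaussianBound.exists_opX_opP hα u h
  -- Every term of the generator is a product of two operators among X and P, each costing R.
  set c : ℝ := ‖(-Complex.I / h : ℂ)‖ * (‖(Q 0 0 / 2 : ℂ)‖ + 2 * ‖(Q 0 1 / 2 : ℂ)‖ +
    ‖(Q 1 1 / 2 : ℂ)‖) * R ^ 2 with hc
  have hc0 : 0 ≤ c := by positivity
  have hgen {d : ℕ} {K : ℝ} {φ : 𝓢(ℝ, ℂ)} (hφ : IsGaussianBound hα u d K φ) :
      IsGaussianBound hα u (d + 2) (c * K) (generator Q h φ) := by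
    obtain ⟨hX, hP⟩ := H _ _ _ hφ
    obtain ⟨hXX, hPX⟩ := H _ _ _ hX
    obtain ⟨hXP, hPP⟩ := H _ _ _ hP
    rw [generator, LinearMap.smul_apply, quadraticOp_apply]
    refine ((((hXX.smul _).add ((hXP.add hPX).smul _)).add (hPP.smul _)).smul _).mono
      (le_of_eq ?_)
    rw [hc]; ring
  have hpow (n : ℕ) : IsGaussianBound hα u (2 * n) (c ^ n)
      ((generator Q h ^ n) (polyGaussian hα u 1)) := by
    induction n with
    | zero => exact ⟨1, rfl, by simp, by simp [gaussianNorm]⟩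
    | succ n ih =>
      rw [pow_succ', pow_succ', Module.End.mul_apply]
      exact hgen ih
  -- The 4 and the 32 come from `sqrt_factorial_le`; c + 1 instead of c keeps the radius parameter
  -- positive.
  refine ⟨4 * (c + 1), by positivity, Real.exp (α * u ^ 2 / 2) * (R ^ 4 * 32), fun n => ?_⟩
  have hX (i : ℕ) : IsGaussianBound hα u (2 * n + i) (R ^ i * c ^ n)
      ((opX ^ i) ((generator Q h ^ n) (polyGaussian hα u 1))) := by
    induction i with
    | zero => simpa using hpow n
    | succ i ih =>
      rw [pow_succ', pow_succ', Module.End.mul_apply, mul_assoc]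
      exact (H _ _ _ ih).1
  have hP (i j : ℕ) : IsGaussianBound hα u (2 * n + i + j) (R ^ (i + j) * c ^ n)
      ((opP h ^ j) ((opX ^ i) ((generator Q h ^ n) (polyGaussian hα u 1)))) := by
    induction j with
    | zero => simpa using hX i
    | succ j ih =>
      rw [← add_assoc, ← add_assoc i j, pow_succ', pow_succ', Module.End.mul_apply, mul_assoc]
      exact (H _ _ _ ih).2
  intro i hi j hj x
  have h1 := ((hP i j).of_le (d' := 2 * n + 4) (by omega)).norm_apply_le x
  refine h1.trans ?_
  have h2 : R ^ (i + j) ≤ R ^ 4 := pow_le_pow_right₀ hR (by omega)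
  have h3 : c ^ n ≤ (c + 1) ^ n := pow_le_pow_left₀ hc0 (by linarith) n
  calc _ ≤ Real.exp (α * u ^ 2 / 2) * (R ^ 4 * (c + 1) ^ n * (32 * 4 ^ n * n.factorial)) := by
        gcongr
        exact sqrt_factorial_le n
    _ = _ := by rw [mul_pow]; ring

/-! ### Translations -/

/-- `φ(x - u)`. -/
def translate (u : ℝ) (φ : 𝓢(ℝ, ℂ)) : 𝓢(ℝ, ℂ) := SchwartzMap.compSubConstCLM ℂ u φ

theorem translate_apply (u : ℝ) (φ : 𝓢(ℝ, ℂ)) (x : ℝ) : translate u φ x = φ (x - u) := rfl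

theorem translate_zero (φ : 𝓢(ℝ, ℂ)) : translate 0 φ = φ := by
  ext x; rw [translate_apply, sub_zero]

theorem translate_polyGaussian {α : ℝ} (hα : 0 < α) (u : ℝ) :
    translate u (polyGaussian hα 0 1) = polyGaussian hα u 1 := by
  ext x
  rw [translate_apply, polyGaussian_apply, polyGaussian_apply, polyGaussianFun, polyGaussianFun,
    sub_zero, Polynomial.eval_one, Polynomial.eval_one]

theorem norm_toLp_translate (u : ℝ) (φ : 𝓢(ℝ, ℂ)) :
    ‖((translate u φ).toLp 2 volume : L2)‖ = ‖(φ.toLp 2 volume : L2)‖ := by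
  have e (φ : 𝓢(ℝ, ℂ)) : ((‖(φ.toLp 2 volume : L2)‖ : ℂ)) ^ 2 = ∫ x, inner ℂ (φ x) (φ x) := by
    have := SchwartzMap.inner_toL2_toL2_eq φ φ
    rwa [inner_self_eq_norm_sq_to_K] at this
  have h1 := e (translate u φ)
  simp only [translate_apply] at h1
  rw [integral_sub_right_eq_self (fun x => inner ℂ (φ x) (φ x)) u, ← e φ] at h1
  have h2 : ‖((translate u φ).toLp 2 volume : L2)‖ ^ 2 = ‖(φ.toLp 2 volume : L2)‖ ^ 2 := by
    exact_mod_cast h1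
  exact (pow_left_inj₀ (norm_nonneg _) (norm_nonneg _) two_ne_zero).1 h2

theorem wigner_translate (h u : ℝ) (φ ψ : 𝓢(ℝ, ℂ)) (z : PhaseSpace) :
    wigner h (translate u φ) ψ z = Complex.exp (-(Complex.I * u * z 1 / h)) *
      wigner h φ ψ (z - Pi.single 0 (u / 2)) := by
  have e (w : PhaseSpace) := integral_sub_right_eq_self (μ := volume) (fun s : ℝ =>
    Complex.exp (-(Complex.I * u * z 1 / h)) * wignerIntegrand h (w 0) (w 1) φ ψ s) u
  rw [wigner_eq, wigner_eq, mul_left_comm, ← integral_const_mul (Complex.exp _), ← e]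
  congr 1
  refine integral_congr_ae (Eventually.of_forall fun s => ?_)
  simp only [wignerIntegrand, translate_apply, Pi.sub_apply, Pi.single_eq_same, ne_eq,
    one_ne_zero, not_false_eq_true, Pi.single_eq_of_ne, sub_zero]
  rw [← mul_assoc, ← mul_assoc, ← Complex.exp_add,
    show z 0 + s / 2 - u = z 0 - u / 2 + (s - u) / 2 by ring,
    show z 0 - s / 2 = z 0 - u / 2 - (s - u) / 2 by ring]
  congr 3
  push_cast
  ring

theorem norm_wigner_translate (h u : ℝ) (φ ψ : 𝓢(ℝ, ℂ)) (z : PhaseSpace) :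
    ‖wigner h (translate u φ) ψ z‖ = ‖wigner h φ ψ (z - Pi.single 0 (u / 2))‖ := by
  rw [wigner_translate, norm_mul, norm_exp_phase, one_mul]

/-! ### Functionals which commute with convolutions -/

/-- Functionals whose values on the translates of a Schwartz function depend continuously on the
translation, and which take the same value on `g * φ` computed as a superposition of translates of
`φ` or of `g`. -/
structure IsTame (L : 𝓢(ℝ, ℂ) → ℂ) : Prop where
  continuous : ∀ φ, Continuous fun u => L (translate u φ)
  bounded : ∀ φ, ∃ C, ∀ u, ‖L (translate u φ)‖ ≤ C
  integral_comm : ∀ φ g : 𝓢(ℝ, ℂ), ∫ u, g u * L (translate u φ) = ∫ u, φ u * L (translate u g)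

namespace IsTame

variable {L L' : 𝓢(ℝ, ℂ) → ℂ}

theorem integrable (hL : IsTame L) (φ g : 𝓢(ℝ, ℂ)) :
    Integrable fun u => g u * L (translate u φ) := by
  obtain ⟨C, hC⟩ := hL.bounded φ
  exact g.integrable.mul_bdd (hL.continuous φ).aestronglyMeasurable (Eventually.of_forall hC)

theorem sub (hL : IsTame L) (hL' : IsTame L') : IsTame fun φ => L φ - L' φ where
  continuous φ := (hL.continuous φ).sub (hL'.continuous φ)
  bounded φ := by
    obtain ⟨C, hC⟩ := hL.bounded φ
    obtain ⟨C', hC'⟩ := hL'.bounded φ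
    exact ⟨C + C', fun u => (norm_sub_le _ _).trans (add_le_add (hC u) (hC' u))⟩
  integral_comm φ g := by
    simp only [mul_sub]
    rw [integral_sub (hL.integrable φ g) (hL'.integrable φ g),
      integral_sub (hL.integrable g φ) (hL'.integrable g φ), hL.integral_comm, hL'.integral_comm]

/-- Translations preserve the L² norm, so the convergence is uniform along each orbit of translates.
-/
theorem of_tendsto {L : ℕ → 𝓢(ℝ, ℂ) → ℂ} {L' : 𝓢(ℝ, ℂ) → ℂ} (hL : ∀ n, IsTame (L n)) {ε : ℕ → ℝ}
    (hε : Tendsto ε atTop (𝓝 0))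
    (h : ∀ n φ, ‖L n φ - L' φ‖ ≤ ε n * ‖(φ.toLp 2 volume : L2)‖) : IsTame L' := by
  have hu (φ : 𝓢(ℝ, ℂ)) (n : ℕ) (u : ℝ) : ‖L n (translate u φ) - L' (translate u φ)‖ ≤
      ε n * ‖(φ.toLp 2 volume : L2)‖ := by
    rw [← norm_toLp_translate u φ]; exact h n _
  have hε' (φ : 𝓢(ℝ, ℂ)) : Tendsto (fun n => ε n * ‖(φ.toLp 2 volume : L2)‖) atTop (𝓝 0) := by
    simpa using hε.mul_const ‖(φ.toLp 2 volume : L2)‖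
  have hc (φ : 𝓢(ℝ, ℂ)) : Continuous fun u => L' (translate u φ) := by
    refine TendstoUniformly.continuous (F := fun n u => L n (translate u φ)) (p := atTop) ?_
      (Frequently.of_forall fun n => (hL n).continuous φ)
    rw [Metric.tendstoUniformly_iff]
    intro δ hδ
    filter_upwards [(hε' φ).eventually_lt_const hδ] with n hn u
    rw [dist_comm, dist_eq_norm]
    exact (hu φ n u).trans_lt hn
  have hb (φ : 𝓢(ℝ, ℂ)) : ∃ C, ∀ u, ‖L' (translate u φ)‖ ≤ C := by
    obtain ⟨C, hC⟩ := (hL 0).bounded φ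
    refine ⟨C + ε 0 * ‖(φ.toLp 2 volume : L2)‖, fun u => ?_⟩
    have := norm_sub_le (L 0 (translate u φ)) (L 0 (translate u φ) - L' (translate u φ))
    rw [sub_sub_cancel] at this
    exact this.trans (add_le_add (hC u) (hu φ 0 u))
  have hi (φ g : 𝓢(ℝ, ℂ)) : Integrable fun u => g u * L' (translate u φ) := by
    obtain ⟨C, hC⟩ := hb φ
    exact g.integrable.mul_bdd (hc φ).aestronglyMeasurable (Eventually.of_forall hC)
  have ht (φ g : 𝓢(ℝ, ℂ)) : Tendsto (fun n => ∫ u, g u * L n (translate u φ)) atTop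
      (𝓝 (∫ u, g u * L' (translate u φ))) := by
    rw [tendsto_iff_norm_sub_tendsto_zero]
    refine squeeze_zero (fun _ => norm_nonneg _) (fun n => ?_)
      (by simpa using (hε' φ).const_mul (∫ u, ‖g u‖))
    rw [← integral_sub ((hL n).integrable φ g) (hi φ g), ← integral_mul_const]
    refine norm_integral_le_of_norm_le (g.integrable.norm.mul_const _)
      (Eventually.of_forall fun u => ?_)
    rw [← mul_sub, norm_mul]
    exact mul_le_mul_of_nonneg_left (hu φ n u) (norm_nonneg _)
  exact ⟨hc, hb, fun φ g => tendsto_nhds_unique ((ht φ g).congr fun n => (hL n).integral_comm φ g)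
    (ht g φ)⟩

end IsTame

/-- After exchanging the integrals, φ and g enter only through their convolution at x + s/2, which
is commutative. -/
theorem integral_mul_wigner_translate_comm (h : ℝ) (φ g ψ : 𝓢(ℝ, ℂ)) (z : PhaseSpace) :
    ∫ u, g u * wigner h (translate u φ) ψ z = ∫ u, φ u * wigner h (translate u g) ψ z := by
  have key (φ g : 𝓢(ℝ, ℂ)) : ∫ u, g u * wigner h (translate u φ) ψ z =
      (1 / (2 * Real.pi * h) : ℂ) * ∫ s : ℝ, Complex.exp (-(Complex.I * s * z 1 / h)) *
        (starRingEnd ℂ) (ψ (z 0 - s / 2)) * ∫ u, g u * φ (z 0 + s / 2 - u) := by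
    obtain ⟨M, hM⟩ := exists_norm_le φ
    have hint : Integrable (Function.uncurry fun u s =>
        g u * wignerIntegrand h (z 0) (z 1) (translate u φ) ψ s) (volume.prod volume) := by
      refine (((g.integrable.norm).mul_prod ((integrable_comp_sub_half (fun y => ‖ψ y‖)
        ψ.integrable.norm (z 0)).const_mul M))).mono' (Continuous.aestronglyMeasurable ?_)
        (Eventually.of_forall fun q => ?_)
      · simp only [wignerIntegrand, translate_apply, Function.uncurry_def]
        have h1 := φ.continuous
        have h2 := ψ.continuous
        have h3 := g.continuous
        have h4 := Complex.continuous_conj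
        fun_prop
      · rw [Function.uncurry, norm_mul, norm_wignerIntegrand]
        exact mul_le_mul_of_nonneg_left (mul_le_mul_of_nonneg_right (hM _) (norm_nonneg _))
          (norm_nonneg _)
    have e1 (u : ℝ) : g u * wigner h (translate u φ) ψ z = (1 / (2 * Real.pi * h) : ℂ) *
        ∫ s, g u * wignerIntegrand h (z 0) (z 1) (translate u φ) ψ s := by
      rw [wigner_eq, integral_const_mul, mul_left_comm]
    simp only [e1]
    rw [integral_const_mul, integral_integral_swap hint]
    congr 1
    refine integral_congr_ae (Eventually.of_forall fun s => ?_)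
    simp only
    rw [← integral_const_mul]
    refine integral_congr_ae (Eventually.of_forall fun u => ?_)
    simp only [wignerIntegrand, translate_apply]
    ring_nf
  rw [key φ g, key g φ]
  congr 2
  funext s
  congr 1
  rw [← integral_sub_left_eq_self (fun u => φ u * g (z 0 + s / 2 - u)) volume (z 0 + s / 2)]
  refine integral_congr_ae (Eventually.of_forall fun u => ?_)
  simp only [sub_sub_cancel]
  ring

/-- Translating φ merely translates |W| in phase space, so the bound for the inner integral does not
depend on u. -/
theorem integrable_mul_wigner_translate (hh : 0 < h) {B : PhaseSpace → ℂ} (hB : Continuous B)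
    {b : ℝ} (hb : ∀ z, ‖B z‖ ≤ b) (φ g ψ : 𝓢(ℝ, ℂ)) : Integrable (Function.uncurry fun u z =>
      g u * (B z * wigner h (translate u φ) ψ z)) (volume.prod volume) := by
  have hW : Integrable (wigner h φ ψ) := by
    simpa using (PolyGrowth.const 1).integrable_mul_wigner hh φ ψ
  have hm : AEStronglyMeasurable (Function.uncurry fun u z =>
      g u * (B z * wigner h (translate u φ) ψ z)) (volume.prod volume) := by
    simp only [wigner_translate, Function.uncurry_def]
    have h1 : Continuous fun q : ℝ × PhaseSpace =>
        q.2 - (Pi.single 0 (q.1 / 2) : PhaseSpace) :=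
      continuous_snd.sub ((continuous_single (A := fun _ : Fin 2 => ℝ) 0).comp (by fun_prop))
    have h2 := (stronglyMeasurable_wigner h φ ψ).comp_measurable h1.measurable
    have h3 : Continuous fun q : ℝ × PhaseSpace => g q.1 * B q.2 *
        Complex.exp (-(Complex.I * q.1 * q.2 1 / h)) := by
      have := g.continuous
      fun_prop
    refine (h3.aestronglyMeasurable.mul h2.aestronglyMeasurable).congr
      (Eventually.of_forall fun q => ?_)
    simp only [Pi.mul_apply, Function.comp_apply]
    ring
  rw [integrable_prod_iff hm]
  refine ⟨Eventually.of_forall fun u => ((PolyGrowth.of_norm_le hB hb).integrable_mul_wigner hh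
    (translate u φ) ψ).const_mul (g u), ?_⟩
  refine (g.integrable.norm.mul_const (∫ z, b * ‖wigner h φ ψ z‖)).mono'
    hm.norm.integral_prod_right' (Eventually.of_forall fun u => ?_)
  rw [Real.norm_of_nonneg (integral_nonneg fun _ => norm_nonneg _),
    ← integral_sub_right_eq_self (fun z => b * ‖wigner h φ ψ z‖)
      (Pi.single 0 (u / 2) : PhaseSpace), ← integral_const_mul]
  refine integral_mono_of_nonneg (Eventually.of_forall fun _ => norm_nonneg _)
    (((hW.norm.const_mul b).comp_sub_right (Pi.single 0 (u / 2))).const_mul _)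
    (Eventually.of_forall fun z => ?_)
  simp only [Function.uncurry, norm_mul, norm_wigner_translate]
  exact mul_le_mul_of_nonneg_left (mul_le_mul_of_nonneg_right (hb z) (norm_nonneg _))
    (norm_nonneg _)

/-- The translation is shifted from W to B together with a phase; the integrand is then dominated by
b|W(φ, ψ)| for every u. -/
theorem isTame_weylForm (hh : 0 < h) {B : PhaseSpace → ℂ} (hB : Continuous B) {b : ℝ}
    (hb : ∀ z, ‖B z‖ ≤ b) (ψ : 𝓢(ℝ, ℂ)) : IsTame fun φ => weylForm h B φ ψ := by
  have hW (φ : 𝓢(ℝ, ℂ)) : Integrable (wigner h φ ψ) := by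
    simpa using (PolyGrowth.const 1).integrable_mul_wigner hh φ ψ
  have e (u : ℝ) (φ : 𝓢(ℝ, ℂ)) : weylForm h B (translate u φ) ψ =
      ∫ z, B (z + Pi.single 0 (u / 2)) * Complex.exp (-(Complex.I * u * z 1 / h)) *
        wigner h φ ψ z := by
    rw [weylForm, ← integral_sub_right_eq_self (fun z =>
      B (z + (Pi.single 0 (u / 2) : PhaseSpace)) * Complex.exp (-(Complex.I * u * z 1 / h)) * wigner h φ ψ z)
      (Pi.single 0 (u / 2) : PhaseSpace)]
    refine integral_congr_ae (Eventually.of_forall fun z => ?_)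
    simp [wigner_translate, mul_assoc]
  refine ⟨fun φ => ?_, fun φ => ⟨∫ z, b * ‖wigner h φ ψ z‖, fun u => ?_⟩, fun φ g => ?_⟩
  · simp only [e]
    refine continuous_of_dominated (bound := fun z => b * ‖wigner h φ ψ z‖) (fun u => ?_)
      (fun u => Eventually.of_forall fun z => ?_) ((hW φ).norm.const_mul b)
      (Eventually.of_forall fun z => ?_)
    · refine Continuous.aestronglyMeasurable ?_ |>.mul
        (stronglyMeasurable_wigner h φ ψ).aestronglyMeasurable
      fun_prop
    · rw [norm_mul, norm_mul, norm_exp_phase, mul_one]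
      exact mul_le_mul_of_nonneg_right (hb _) (norm_nonneg _)
    · have : Continuous fun u : ℝ => (Pi.single 0 (u / 2) : PhaseSpace) :=
        (continuous_single (A := fun _ : Fin 2 => ℝ) 0).comp (by fun_prop)
      fun_prop
  · rw [e]
    refine norm_integral_le_of_norm_le ((hW φ).norm.const_mul b) (Eventually.of_forall fun z => ?_)
    rw [norm_mul, norm_mul, norm_exp_phase, mul_one]
    exact mul_le_mul_of_nonneg_right (hb _) (norm_nonneg _)
  · have swap (φ g : 𝓢(ℝ, ℂ)) : ∫ u, g u * weylForm h B (translate u φ) ψ =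
        ∫ z, B z * ∫ u, g u * wigner h (translate u φ) ψ z := by
      simp only [weylForm, ← integral_const_mul]
      rw [integral_integral_swap (integrable_mul_wigner_translate hh hB hb φ g ψ)]
      refine integral_congr_ae (Eventually.of_forall fun z => ?_)
      exact integral_congr_ae (Eventually.of_forall fun u => mul_left_comm _ _ _)
    rw [swap, swap]
    simp only [integral_mul_wigner_translate_comm h φ g]

/-- For Schwartz v this is the Weyl form of the symbol 1, at any value of ħ, here 1. The general
case follows by density. -/
theorem isTame_inner (v : L2) : IsTame fun φ => inner ℂ v (φ.toLp 2 volume : L2) := by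
  have hd := SchwartzMap.denseRange_toLpCLM (E := ℝ) (F := ℂ) (μ := volume) (p := 2)
    (by norm_num)
  have hv (n : ℕ) : ∃ ψ : 𝓢(ℝ, ℂ), ‖(ψ.toLp 2 volume : L2) - v‖ < 1 / ((n : ℝ) + 1) := by
    obtain ⟨ψ, hψ⟩ := hd.exists_dist_lt v (ε := 1 / ((n : ℝ) + 1)) (by positivity)
    rw [dist_comm, dist_eq_norm] at hψ
    exact ⟨ψ, hψ⟩
  choose ψ hψ using hv
  refine IsTame.of_tendsto (L := fun n φ => weylForm 1 (fun _ => 1) φ (ψ n))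
    (fun n => isTame_weylForm one_pos continuous_const (fun _ => le_rfl) (ψ n))
    tendsto_one_div_add_atTop_nhds_zero_nat fun n φ => ?_
  rw [weylForm_one one_pos, ← inner_sub_left]
  exact (norm_inner_le_norm _ _).trans (mul_le_mul_of_nonneg_right (hψ n).le (norm_nonneg _))

/-- A tame functional is determined by its values on Gaussians. -/
theorem IsTame.eq_zero {L : 𝓢(ℝ, ℂ) → ℂ} (hL : IsTame L)
    (h : ∀ (α : ℝ) (hα : 0 < α) (u : ℝ), L (polyGaussian hα u 1) = 0) (φ : 𝓢(ℝ, ℂ)) : L φ = 0 := by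
  set a : ℝ → ℂ := fun u => L (translate u φ) with ha
  obtain ⟨C, hC⟩ := hL.bounded φ
  have hn (n : ℕ) : ∫ v : ℝ, (Real.exp (-(1 / 2) * v ^ 2) : ℂ) * a (((n : ℝ) + 1)⁻¹ * v) = 0 := by
    -- The Gaussian has width 1/(n + 1). Its translates are Gaussians, on which L vanishes, so the
    -- other superposition is zero; rescaling u lets the Gaussian concentrate at 0 by dominated
    -- convergence.
    have hα : (0 : ℝ) < (n + 1) ^ 2 := by positivity
    have h1 := hL.integral_comm φ (polyGaussian hα 0 1)
    simp only [translate_polyGaussian, h, mul_zero, integral_zero] at h1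
    have h2 := Measure.integral_comp_mul_left
      (fun u => polyGaussian hα 0 1 u * L (translate u φ)) ((n : ℝ) + 1)⁻¹
    rw [h1, smul_zero] at h2
    rw [← h2]
    refine integral_congr_ae (Eventually.of_forall fun v => ?_)
    simp only [ha, polyGaussian_apply, polyGaussianFun, Polynomial.eval_one, one_mul, sub_zero]
    congr 3
    have : (n : ℝ) + 1 ≠ 0 := by positivity
    field_simp
  have hlim : Tendsto (fun n : ℕ => ∫ v : ℝ, (Real.exp (-(1 / 2) * v ^ 2) : ℂ) *
      a (((n : ℝ) + 1)⁻¹ * v)) atTop (𝓝 (∫ v : ℝ, (Real.exp (-(1 / 2) * v ^ 2) : ℂ) * a 0)) := by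
    have hc := hL.continuous φ
    refine tendsto_integral_of_dominated_convergence
      (fun v => Real.exp (-(1 / 2) * v ^ 2) * C) (fun n => Continuous.aestronglyMeasurable ?_)
      ((integrable_exp_neg_mul_sq (by norm_num)).mul_const C)
      (fun n => Eventually.of_forall fun v => ?_) (Eventually.of_forall fun v => ?_)
    · exact (Complex.continuous_ofReal.comp (by fun_prop)).mul (hc.comp (by fun_prop))
    · rw [norm_mul, Complex.norm_real, Real.norm_of_nonneg (Real.exp_pos _).le]
      exact mul_le_mul_of_nonneg_left (hC _) (Real.exp_pos _).le
    · refine ((hc.tendsto 0).comp ?_).const_mul _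
      have := (tendsto_inv_atTop_zero.comp (tendsto_natCast_atTop_atTop (R := ℝ) |>.atTop_add
        (tendsto_const_nhds (x := (1 : ℝ))))).mul_const v
      simpa using this
  simp only [hn] at hlim
  have h0 := tendsto_nhds_unique hlim tendsto_const_nhds
  rw [integral_mul_const, integral_complex_ofReal, integral_gaussian, mul_eq_zero] at h0
  rcases h0 with h0 | h0
  · exact absurd h0 (by
      have : (0 : ℝ) < √(Real.pi / (1 / 2)) := by positivity
      exact_mod_cast this.ne')
  · simpa [ha, translate_zero] using h0

/-! ### The symbol of the evolution -/

theorem hasWeylSymbol_evolutionSymbol {Q : Matrix (Fin 2) (Fin 2) ℝ} (hQ : Q.IsSymm) {ω : ℂ}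
    (hω : ω ^ 2 = (Q.det : ℂ)) (hh : 0 < h) {U : ℝ → L2 →L[ℂ] L2}
    (hU : IsTimeEvolution h (quadraticOp Q h) U) {t : ℝ} (ht : Complex.cos (t * ω / 2) ≠ 0) :
    HasWeylSymbol h (fun φ => U t (φ.toLp 2 volume))
      (evolutionSymbol h ω (quadraticSymbol Q) t) := by
  intro φ ψ
  have hreg := isRegularTime_ofReal hω (quadraticSymbol Q) ht
  rw [evolutionSymbol_eq]
  refine ⟨(hreg.polyGrowth hQ hh).integrable_mul_wigner hh φ ψ, ?_⟩
  -- Passing U(t) to the other side makes the first functional an inner product with a fixed vector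
  -- of L², which need not be a Schwartz function.
  have hL := (isTame_inner (ContinuousLinearMap.adjoint (U t) (ψ.toLp 2 volume))).sub
    (isTame_weylForm hh (continuous_complexEvolutionSymbol hQ h ω t)
      (hreg.norm_complexEvolutionSymbol_le hh) ψ)
  simp only [ContinuousLinearMap.adjoint_inner_left] at hL
  refine sub_eq_zero.1 (hL.eq_zero (fun α hα u => ?_) φ)
  obtain ⟨R, hR, hA⟩ := exists_isAnalyticVector_gaussian Q h hα u
  exact sub_eq_zero.2 (hA.inner_eq_weylForm hQ hω hh hU hR ψ ht)

end QuadSymbol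

end

theorem mainTheorem4 (Q : Matrix (Fin 2) (Fin 2) ℝ) (hQ : Q.IsSymm)
    (ω : ℂ) (hω : ω ^ 2 = (Q.det : ℂ)) :
    (∀ (𝒜 : Subalgebra ℂ (ℝ → ℂ)) (Φ : 𝒜 →ₗ[ℂ] FormalSymbol),
      IsSmoothFunctionAlgebra 𝒜 → IsFunctionalCalculus 𝒜 (quadraticSymbol Q) Φ →
        ∀ f : 𝒜, Φ f = secExpFormula ω (quadraticSymbol Q) f) ∧
    (∀ (h : ℝ) (H : 𝓢(ℝ, ℂ) →ₗ[ℂ] 𝓢(ℝ, ℂ)), 0 < h →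
      HasWeylSymbol h (fun φ => (H φ).toLp 2) (fun z => (quadraticSymbol Q z : ℂ)) →
        (∀ f : ℂ[X],
          HasWeylSymbol h (fun φ => ((Polynomial.aeval H f : Module.End ℂ 𝓢(ℝ, ℂ)) φ).toLp 2)
            (fun z => ∑ n ∈ Finset.range (f.natDegree + 1), (h : ℂ) ^ n *
              PowerSeries.coeff n
                (secExpFormula ω (quadraticSymbol Q) (fun y : ℝ => f.eval (y : ℂ))) z)) ∧
        (∀ U : ℝ → L2 →L[ℂ] L2, IsTimeEvolution h H U →
          ∀ t : ℝ, Complex.cos (t * ω / 2) ≠ 0 →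
            HasWeylSymbol h (fun φ => U t (φ.toLp 2))
              (evolutionSymbol h ω (quadraticSymbol Q) t))) := by
  refine ⟨fun 𝒜 Φ h𝒜 hΦ f => hΦ.eq_secExpFormula hQ hω h𝒜 f, fun h H hh hH => ?_⟩
  obtain rfl := eq_quadraticOp_of_hasWeylSymbol hQ hh hH
  refine ⟨fun f => ?_, fun U hU t ht => hasWeylSymbol_evolutionSymbol hQ hω hh hU ht⟩
  simp only [coeff_secExpFormula]
  exact hasWeylSymbol_aeval_quadraticOp hQ hω hh f
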